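/- For a triple $\mathbf P=(P_1,P_2,P_3)$ of real polynomials put $L_{\mathbf P}(t)=\det\bigl(\mathbf P'(t)\ \mathbf P''(t)\ \mathbf P'''(t)\bigr)$ and, for $f:\mathbb R^3\to\mathbb C$, $$\mathcal A_{\mathbb R}f(x)=\int_{\mathbb R} f(x-\mathbf P(t))\,|L_{\mathbf P}(t)|^{1/6}\,dt .$$ For measurable $f$ on $\mathbb R^3$ let $\lambda_f(s)=|\{x:|f(x)|>s\}|$ (Lebesgue measure), and for $1<p<\infty$ let $$\|f\|_{L^{p,1}}=p\int_0^\infty \lambda_f(s)^{1/p}\,ds,\qquad \|f\|_{L^{p,\infty}}=\sup_{s>0}s\,\lambda_f(s)^{1/p};$$ $L^{p,1}(\mathbb R^3)$ and $L^{p,\infty}(\mathbb R^3)$ consist of the $f$ for which these are finite. Then for every $N\in\mathbb N$ there is a finite constant $C$, depending only on $N$, such that for all $\mathbf P$ with $\deg P_i\le N$ $(i=1,2,3)$: 1. for every $f\in L^{2,1}(\mathbb R^3)$ the integral defining $\mathcal A_{\mathbb R}f(x)$ converges absolutely for almost every $x$, $\mathcal A_{\mathbb R}f\in L^{3,\infty}(\mathbb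 R^3)$, and $\|\mathcal A_{\mathbb R}f\|_{L^{3,\infty}}\le C\,\|f\|_{L^{2,1}}$; 2. for every $f\in L^{3/2,1}(\mathbb R^3)$ the integral defining $\mathcal A_{\mathbb R}f(x)$ converges absolutely for almost every $x$, $\mathcal A_{\mathbb R}f\in L^{2,\infty}(\mathbb R^3)$, and $\|\mathcal A_{\mathbb R}f\|_{L^{2,\infty}}\le C\,\|f\|_{L^{3/2,1}}$. -/

import Mathlib

open MeasureTheory Set Polynomial
open scoped ENNReal NNReal

noncomputable section

namespace PolyAverage

/-- The polynomial curve `t ↦ (P₁(t), …, P_d(t))` in Euclidean space. -/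
def curve {d : ℕ} (P : Fin d → ℝ[X]) (t : ℝ) : EuclideanSpace ℝ (Fin d) :=
  WithLp.toLp 2 fun i => (P i).eval t

/-- `L_P(t) = det (P'(t) P''(t) ⋯ P^{(d)}(t))`: column `j = 0, …, d - 1` of the matrix is the
derivative of order `j + 1` of the curve. -/
def torsion {d : ℕ} (P : Fin d → ℝ[X]) (t : ℝ) : ℝ :=
  (Matrix.of fun i j : Fin d => ((derivative^[(j : ℕ) + 1]) (P i)).eval t).det

/-- The affine arclength density `|L_P(t)|^{2/(d(d+1))}`. -/
def affineDensity {d : ℕ} (P : Fin d → ℝ[X]) (t : ℝ) : ℝ :=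
  |torsion P t| ^ ((2 : ℝ) / ((d : ℝ) * ((d : ℝ) + 1)))

/-- The integrand of the averaging operator at the point `x`. -/
def averageIntegrand {d : ℕ} (P : Fin d → ℝ[X]) (f : EuclideanSpace ℝ (Fin d) → ℂ)
    (x : EuclideanSpace ℝ (Fin d)) (t : ℝ) : ℂ :=
  affineDensity P t • f (x - curve P t)

/-- The global averaging operator
`A f(x) = ∫_ℝ f(x - P(t)) |L_P(t)|^{2/(d(d+1))} dt`. -/
def average {d : ℕ} (P : Fin d → ℝ[X]) (f : EuclideanSpace ℝ (Fin d) → ℂ)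
    (x : EuclideanSpace ℝ (Fin d)) : ℂ :=
  ∫ t : ℝ, averageIntegrand P f x t

/-- The distribution function `s ↦ μ {x : |f(x)| > s}`. -/
def distribFun {α : Type*} [MeasurableSpace α] (μ : Measure α) (f : α → ℂ) (s : ℝ) : ℝ≥0∞ :=
  μ {x | s < ‖f x‖}

/-- The Lorentz `L^{p,r}` quasi-norm, for `0 < p < ∞` and `0 < r ≤ ∞`, written with the
distribution function `λ` of `f`: it is `(p ∫₀^∞ (s λ(s)^{1/p})^r ds/s)^{1/r}` for `r < ∞` and
`sup_{s > 0} s λ(s)^{1/p}` for `r = ∞`. -/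
def lorentzNorm {α : Type*} [MeasurableSpace α] (p : ℝ) (r : ℝ≥0∞) (μ : Measure α)
    (f : α → ℂ) : ℝ≥0∞ :=
  if r = ∞ then
    ⨆ s ∈ Ioi (0 : ℝ), ENNReal.ofReal s * distribFun μ f s ^ (1 / p)
  else
    (ENNReal.ofReal p * ∫⁻ s in Ioi (0 : ℝ),
      (ENNReal.ofReal s * distribFun μ f s ^ (1 / p)) ^ r.toReal / ENNReal.ofReal s)
        ^ (1 / r.toReal)

/-- Membership in the Lorentz space `L^{p,r}(μ)`. -/
def MemLorentz {α : Type*} [MeasurableSpace α] (p : ℝ) (r : ℝ≥0∞) (μ : Measure α)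
    (f : α → ℂ) : Prop :=
  AEStronglyMeasurable f μ ∧ lorentzNorm p r μ f < ∞

end PolyAverage

end

/-!
The heart of the matter is the restricted weak type estimate
`⟨1_F, A 1_E⟩ ≤ C |E|^{1/2} |F|^{2/3}` (`exists_form_le`), proved by M. Christ's method of
refinements. The estimate `⟨1_F, A 1_E⟩ ≤ C |E|^{2/3} |F|^{1/2}` is its dual: the adjoint of `A` is
the averaging operator of the curve `-P` (`form_neg`). Writing `|f|` as an integral of indicator
functions turns a restricted weak type estimate into an estimate from `L^{p,1}` to `L^{q,∞}`
(`lorentz_bound`), which also gives the absolute convergence almost everywhere.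

Let `α = ⟨1_F, A 1_E⟩ / |F|` and `β = ⟨1_F, A 1_E⟩ / |E|`. After refining `F` and `E` there is a
point `x₀` from which the paths `x₀ - P(t₁) + P(t₂) - P(t₃)` reach `E` for many parameters: `t₁`
and `t₃` range over sets of measure about `α` and `t₂` over sets of measure about `β`, for the
measure `|L|^{1/6} dt`. The map from the parameters to the endpoint is at most six to one, and its
Jacobian is, up to sign, the alternant `det (P'(t₁) P'(t₂) P'(t₃))`. Hence a lower bound for the
alternant at well separated parameters bounds `|E|` from below by a multiple of `α⁴ β²`
(`le_volume_of_three_steps`), and this is the estimate wanted (`form_pow_le`).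

Three facts about polynomial curves enter; they hold on each of boundedly many intervals that cover
the line up to finitely many points (`exists_coveredBy_compl`), and the constants and the number of
intervals depend only on the degree.

* The geometric inequality `|det (P'(x) P'(y) P'(z))|³ ≥ c |L(x) L(y) L(z)| |V(x, y, z)|³`, where
  `V` is the Vandermonde product, and the constancy of the sign of the alternant on ordered triples
  (`GeomIneq`). Let each point of the line be assigned to the nearest one among the origin and the
  roots of `L` and `L'`. About such a centre the curve of velocities is, after a linear change of
  coordinates, close to a curve of monomials at all distances except those in boundedly many ranges
  of bounded ratio (`IsDominant`); for curves close to monomial the Wronskians are close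
  to those of the monomials and the alternant is bounded below by iterated integration
  (`alternant_of_nearMonomial`). In the exceptional ranges `L` has the doubling property, and
  pigeonholing over scales finds a scale at which the expansion about the point is dominated by its
  first three coefficients (`exists_good_scale`).
* The primitive `u` of `|L|^{1/6}` on an interval on which `|L|` is monotone is a variable in which
  the product of `|L|^{1/6}` over three points with their Vandermonde product is large at separated
  values of `u` (`IsVariable`).
* A signed sum of three points of the curve determines the ordered parameters
  (`eq_of_signed_sum_eq`). Two such triples give six points with signs adding up to zero, whose
  partial sums change sign at most twice. The sign of the alternant provides a linear combination of
  the coordinates whose monotonicity matches these changes (`exists_test_function`), so that the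
  signed sum of its values vanishes only if the points cancel in pairs.
-/

namespace PolyAverage

/-! ### Elementary facts on polynomials of bounded degree -/

/-- The size of a polynomial of degree at most `n` on an interval controls its size on the
interval of twice the length with the same initial point; `h` may be negative. -/
theorem exists_doubling (n : ℕ) :
    ∃ D : ℝ, 1 ≤ D ∧ ∀ p : ℝ[X], p.natDegree ≤ n → ∀ a h M : ℝ,
      (∀ s ∈ Icc (0 : ℝ) 1, |p.eval (a + h * s)| ≤ M) →
        ∀ s ∈ Icc (0 : ℝ) 2, |p.eval (a + h * s)| ≤ D * M := by
  classical
  set v : ℕ → ℝ := fun i => (i : ℝ) / (n + 1) with hv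
  have hn : (0 : ℝ) < n + 1 := by positivity
  have hinj : Set.InjOn v (Finset.range (n + 1) : Finset ℕ) := by
    intro i _ j _ hij
    have : (i : ℝ) = j := by
      simpa [hv, div_left_inj' hn.ne'] using hij
    exact_mod_cast this
  have hv01 : ∀ i ∈ Finset.range (n + 1), v i ∈ Icc (0 : ℝ) 1 := by
    intro i hi
    refine ⟨by positivity, ?_⟩
    rw [hv, div_le_one hn]
    have : i ≤ n + 1 := (Finset.mem_range.1 hi).le
    exact_mod_cast this
  set B : ℝ → ℝ := fun s =>
    ∑ i ∈ Finset.range (n + 1), |(Lagrange.basis (Finset.range (n + 1)) v i).eval s| with hB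
  have hBc : Continuous B := by
    refine continuous_finsetSum _ fun i _ => ?_
    exact (Polynomial.continuous _).abs
  obtain ⟨D, hD⟩ := (isCompact_Icc (a := (0 : ℝ)) (b := 2)).exists_bound_of_continuousOn
    hBc.continuousOn
  refine ⟨max D 1, le_max_right _ _, ?_⟩
  intro p hp a h M hM s hs
  set f : ℝ[X] := p.comp (C a + C h * X) with hf
  have hfe : ∀ s, f.eval s = p.eval (a + h * s) := by
    intro s; simp [hf, eval_comp]
  have hfd : f.degree < (Finset.range (n + 1)).card := by
    rw [Finset.card_range]
    refine lt_of_le_of_lt degree_le_natDegree ?_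
    have h1 : f.natDegree ≤ p.natDegree * (C a + C h * X : ℝ[X]).natDegree := natDegree_comp_le
    have h2 : (C a + C h * X : ℝ[X]).natDegree ≤ 1 := by
      rw [add_comm]; exact natDegree_linear_le
    have h3 : f.natDegree ≤ n := by nlinarith
    exact_mod_cast Nat.lt_succ_of_le h3
  have hM0 : 0 ≤ M := (abs_nonneg _).trans (hM 0 (by simp))
  have e1 := Lagrange.eq_interpolate hinj hfd
  have e2 : f.eval s = ∑ i ∈ Finset.range (n + 1),
      f.eval (v i) * (Lagrange.basis (Finset.range (n + 1)) v i).eval s := by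
    conv_lhs => rw [e1]
    simp [Lagrange.interpolate_apply, eval_finsetSum]
  rw [← hfe, e2]
  calc |∑ i ∈ Finset.range (n + 1),
        f.eval (v i) * (Lagrange.basis (Finset.range (n + 1)) v i).eval s|
      ≤ ∑ i ∈ Finset.range (n + 1),
        M * |(Lagrange.basis (Finset.range (n + 1)) v i).eval s| := by
        refine (Finset.abs_sum_le_sum_abs _ _).trans (Finset.sum_le_sum fun i hi => ?_)
        rw [abs_mul]
        refine mul_le_mul_of_nonneg_right ?_ (abs_nonneg _)
        rw [hfe]; exact hM _ (hv01 i hi)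
    _ = B s * M := by rw [← Finset.mul_sum, mul_comm]
    _ ≤ max D 1 * M := by
        refine mul_le_mul_of_nonneg_right ?_ hM0
        exact ((le_abs_self _).trans (hD s hs)).trans (le_max_left _ _)

/-! ### Lower bounds for alternants from Wronskians -/

theorem mul_sub_le_sub_of_le_deriv {f f' : ℝ → ℝ} {a b m : ℝ} (hab : a ≤ b)
    (hf : ∀ x ∈ Icc a b, HasDerivAt f (f' x) x) (hm : ∀ x ∈ Icc a b, m ≤ f' x) :
    m * (b - a) ≤ f b - f a := by
  refine Convex.mul_sub_le_image_sub_of_le_deriv (convex_Icc a b)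
    (fun x hx => (hf x hx).continuousAt.continuousWithinAt)
    (fun x hx => (hf x (interior_subset hx)).differentiableAt.differentiableWithinAt)
    (fun x hx => ?_) a (left_mem_Icc.2 hab) b (right_mem_Icc.2 hab) hab
  rw [(hf x (interior_subset hx)).deriv]
  exact hm x (interior_subset hx)

/-- The rectangle increment of `(x, y) ↦ g x * k y - k x * g y` is bounded below by the area
of the rectangle times a lower bound for the mixed derivative. -/
theorem mul_area_le_increment {g k g' k' : ℝ → ℝ} {a b c d m : ℝ} (hab : a ≤ b) (hcd : c ≤ d)
    (hg : ∀ x ∈ Icc a b, HasDerivAt g (g' x) x) (hk : ∀ x ∈ Icc a b, HasDerivAt k (k' x) x)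
    (hg2 : ∀ x ∈ Icc c d, HasDerivAt g (g' x) x) (hk2 : ∀ x ∈ Icc c d, HasDerivAt k (k' x) x)
    (hm : ∀ x ∈ Icc a b, ∀ y ∈ Icc c d, m ≤ g' x * k' y - k' x * g' y) :
    m * ((b - a) * (d - c)) ≤ (g b - g a) * (k d - k c) - (k b - k a) * (g d - g c) := by
  have key : ∀ x ∈ Icc a b, m * (d - c) ≤ g' x * (k d - k c) - k' x * (g d - g c) := by
    intro x hx
    have := mul_sub_le_sub_of_le_deriv (f := fun y => g' x * k y - k' x * g y)
      (f' := fun y => g' x * k' y - k' x * g' y) hcd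
      (fun y hy => ((hk2 y hy).const_mul _).sub ((hg2 y hy).const_mul _))
      (fun y hy => hm x hx y hy)
    linarith
  have := mul_sub_le_sub_of_le_deriv (f := fun x => g x * (k d - k c) - k x * (g d - g c))
      (f' := fun x => g' x * (k d - k c) - k' x * (g d - g c)) hab
      (fun y hy => ((hg y hy).mul_const _).sub ((hk y hy).mul_const _))
      (fun y hy => key y hy)
  linarith

/-- The alternant `det (p i (t j))` of three polynomials at three points. -/
noncomputable def alternant (p : Fin 3 → ℝ[X]) (x y z : ℝ) : ℝ :=
  (Matrix.of fun i j : Fin 3 => (p i).eval (![x, y, z] j)).det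

/-- The Wronskian of three polynomials. -/
noncomputable def wron (p : Fin 3 → ℝ[X]) : ℝ[X] :=
  (Matrix.of fun i j : Fin 3 => (derivative^[(j : ℕ)]) (p i)).det

theorem alternant_eq (p : Fin 3 → ℝ[X]) (x y z : ℝ) :
    alternant p x y z =
      (p 0).eval x * ((p 1).eval y * (p 2).eval z - (p 2).eval y * (p 1).eval z)
      - (p 0).eval y * ((p 1).eval x * (p 2).eval z - (p 2).eval x * (p 1).eval z)
      + (p 0).eval z * ((p 1).eval x * (p 2).eval y - (p 2).eval x * (p 1).eval y) := by
  simp only [alternant, Matrix.det_fin_three, Matrix.of_apply, Matrix.cons_val]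
  ring

theorem wron_eq (p : Fin 3 → ℝ[X]) :
    wron p = p 0 * (derivative (p 1) * derivative (derivative (p 2))
        - derivative (p 2) * derivative (derivative (p 1)))
      - derivative (p 0) * (p 1 * derivative (derivative (p 2))
        - p 2 * derivative (derivative (p 1)))
      + derivative (derivative (p 0)) * (p 1 * derivative (p 2) - p 2 * derivative (p 1)) := by
  simp only [wron, Matrix.det_fin_three, Matrix.of_apply, Fin.val_zero, Fin.val_one,
    Fin.val_two, Function.iterate_zero, id, Function.iterate_succ, Function.comp]
  ring

/-- If the successive Wronskians of `p` are bounded below by monomials on an interval `K`, in the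
normalization in which they are the weights of the iterated integral representation of the
alternant, then so is the alternant. -/
theorem le_alternant {p : Fin 3 → ℝ[X]} {K : Set ℝ} (hK : K.OrdConnected) (hpos : K ⊆ Ioi 0)
    {A : ℝ} (hA : 0 < A) {n b c : ℕ}
    (h1 : ∀ x ∈ K, A * x ^ n ≤ (p 0).eval x)
    (hW : ∀ x ∈ K, 0 < (p 0 * derivative (p 1) - derivative (p 0) * p 1).eval x)
    (h2 : ∀ x ∈ K, A * x ^ b ≤
      (p 0 * derivative (p 1) - derivative (p 0) * p 1).eval x / (p 0).eval x ^ 2)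
    (h3 : ∀ x ∈ K, A * x ^ c ≤ (p 0).eval x * (wron p).eval x /
      (p 0 * derivative (p 1) - derivative (p 0) * p 1).eval x ^ 2)
    {x y z : ℝ} (hx : x ∈ K) (hy : y ∈ K) (hz : z ∈ K) (hxy : x < y) (hyz : y < z) :
    A ^ 6 / (64 * 2 ^ b * 2 ^ b * 4 ^ c) * ((x * y * z) ^ n * y ^ b * z ^ (b + c) *
      ((y - x) * (z - y) * (z - x))) ≤ alternant p x y z := by
  set W := p 0 * derivative (p 1) - derivative (p 0) * p 1 with hWdef
  set g : ℝ → ℝ := fun t => (p 1).eval t / (p 0).eval t with hg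
  set k : ℝ → ℝ := fun t => (p 2).eval t / (p 0).eval t with hk
  set h : ℝ → ℝ := fun t =>
    (p 0 * derivative (p 2) - derivative (p 0) * p 2).eval t / W.eval t with hh
  set ψ : ℝ → ℝ := fun t => W.eval t / (p 0).eval t ^ 2 with hψ
  have hx0 : 0 < x := hpos hx
  have hy0 : 0 < y := hpos hy
  have hz0 : 0 < z := hpos hz
  have hp0 : ∀ t ∈ K, 0 < (p 0).eval t := fun t ht =>
    lt_of_lt_of_le (mul_pos hA (pow_pos (hpos ht) _)) (h1 t ht)
  have hgd : ∀ t ∈ K, HasDerivAt g (ψ t) t := by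
    intro t ht
    refine (((p 1).hasDerivAt t).div ((p 0).hasDerivAt t) (hp0 t ht).ne').congr_deriv ?_
    simp only [hψ, hWdef, eval_sub, eval_mul]
    ring
  have hkd : ∀ t ∈ K, HasDerivAt k (ψ t * h t) t := by
    intro t ht
    refine (((p 2).hasDerivAt t).div ((p 0).hasDerivAt t) (hp0 t ht).ne').congr_deriv ?_
    have := (hW t ht).ne'
    simp only [hψ, hh]
    rw [div_mul_div_comm, mul_comm (eval t W), mul_div_mul_right _ _ this]
    simp only [eval_sub, eval_mul]
    ring
  have hhd : ∀ t ∈ K, HasDerivAt h ((p 0).eval t * (wron p).eval t / W.eval t ^ 2) t := by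
    intro t ht
    refine (((p 0 * derivative (p 2) - derivative (p 0) * p 2).hasDerivAt t).div
      (W.hasDerivAt t) (hW t ht).ne').congr_deriv ?_
    congr 1
    simp only [wron_eq, hWdef, derivative_sub, derivative_mul, eval_sub, eval_mul, eval_add]
    ring
  have hψp : ∀ t ∈ K, 0 < ψ t := fun t ht =>
    lt_of_lt_of_le (mul_pos hA (pow_pos (hpos ht) _)) (h2 t ht)
  -- lower bound for increments of `h`, from the upper half of the interval
  have hinc : ∀ s ∈ K, ∀ t ∈ K, s ≤ t → A * (t / 2) ^ c * ((t - s) / 2) ≤ h t - h s := by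
    intro s hs t ht hst
    have hs0 : 0 < s := hpos hs
    have hmK : (s + t) / 2 ∈ K := hK.out hs ht ⟨by linarith, by linarith⟩
    have e1 := mul_sub_le_sub_of_le_deriv (f := h) (m := A * (t / 2) ^ c)
      (a := (s + t) / 2) (b := t) (by linarith)
      (fun u hu => hhd u (hK.out hmK ht hu))
      (fun u hu => le_trans (mul_le_mul_of_nonneg_left
        (pow_le_pow_left₀ (by linarith) (by linarith [hu.1]) _) hA.le)
          (h3 u (hK.out hmK ht hu)))
    have e2 := mul_sub_le_sub_of_le_deriv (f := h) (m := 0)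
      (a := s) (b := (s + t) / 2) (by linarith)
      (fun u hu => hhd u (hK.out hs hmK hu))
      (fun u hu => le_trans (mul_nonneg hA.le (pow_nonneg (hs0.le.trans hu.1) _))
          (h3 u (hK.out hs hmK hu)))
    linarith
  have hmixed : ∀ s ∈ K, ∀ t ∈ K, ψ s * (ψ t * h t) - ψ s * h s * ψ t
      = ψ s * ψ t * (h t - h s) := by intros; ring
  have hmono : ∀ s ∈ K, ∀ t ∈ K, s ≤ t → 0 ≤ h t - h s := fun s hs t ht hst =>
    le_trans (mul_nonneg (mul_nonneg hA.le (pow_nonneg (half_pos (hpos ht)).le _))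
      (by linarith)) (hinc s hs t ht hst)
  have hsub1 : Icc x y ⊆ K := hK.out hx hy
  have hsub2 : Icc y z ⊆ K := hK.out hy hz
  -- the increments over subrectangles of `[x, y] × [y, z]` are nonnegative
  have hrect : ∀ a b c d, x ≤ a → a ≤ b → b ≤ y → y ≤ c → c ≤ d → d ≤ z →
      0 ≤ (g b - g a) * (k d - k c) - (k b - k a) * (g d - g c) := by
    intro a b c d h1 h2 h3 h4 h5 h6
    have i1 : Icc a b ⊆ K := (Icc_subset_Icc h1 h3).trans hsub1
    have i2 : Icc c d ⊆ K := (Icc_subset_Icc h4 h6).trans hsub2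
    have := mul_area_le_increment (m := 0) h2 h5 (fun t ht => hgd t (i1 ht))
      (fun t ht => hkd t (i1 ht)) (fun t ht => hgd t (i2 ht)) (fun t ht => hkd t (i2 ht))
      (fun s hs t ht => by
        rw [hmixed s (i1 hs) t (i2 ht)]
        exact mul_nonneg (mul_nonneg (hψp s (i1 hs)).le (hψp t (i2 ht)).le)
          (hmono s (i1 hs) t (i2 ht) (by linarith [hs.2, ht.1])))
    simpa using this
  -- on this subrectangle `s` is comparable to `y`, `t` to `z` and `t - s` to `z - x`
  have hsubrect : (A * (y / 2) ^ b) * (A * (z / 2) ^ b) * (A * (z / 4) ^ c * ((z - x) / 8)) *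
      (((x + 3 * y) / 4 - (x + y) / 2) * (z - (y + z) / 2)) ≤
      (g ((x + 3 * y) / 4) - g ((x + y) / 2)) * (k z - k ((y + z) / 2))
       - (k ((x + 3 * y) / 4) - k ((x + y) / 2)) * (g z - g ((y + z) / 2)) := by
    have i1 : Icc ((x + y) / 2) ((x + 3 * y) / 4) ⊆ K :=
      (Icc_subset_Icc (by linarith) (by linarith)).trans hsub1
    have i2 : Icc ((y + z) / 2) z ⊆ K := (Icc_subset_Icc (by linarith) le_rfl).trans hsub2
    refine mul_area_le_increment (by linarith) (by linarith) (fun t ht => hgd t (i1 ht))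
      (fun t ht => hkd t (i1 ht)) (fun t ht => hgd t (i2 ht)) (fun t ht => hkd t (i2 ht))
      (fun s hs t ht => ?_)
    rw [hmixed s (i1 hs) t (i2 ht)]
    have hsK := i1 hs
    have htK := i2 ht
    obtain ⟨hs1, hs2⟩ := hs
    obtain ⟨ht1, ht2⟩ := ht
    have q1 : A * (y / 2) ^ b ≤ ψ s := le_trans (mul_le_mul_of_nonneg_left
      (pow_le_pow_left₀ (by linarith) (by linarith) _) hA.le) (h2 s hsK)
    have q2 : A * (z / 2) ^ b ≤ ψ t := le_trans (mul_le_mul_of_nonneg_left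
      (pow_le_pow_left₀ (by linarith) (by linarith) _) hA.le) (h2 t htK)
    have q3 : A * (z / 4) ^ c * ((z - x) / 8) ≤ h t - h s := by
      refine le_trans ?_ (hinc s hsK t htK (by linarith))
      have : (z / 4) ^ c ≤ (t / 2) ^ c := pow_le_pow_left₀ (by linarith) (by linarith) _
      have h8 : (z - x) / 8 ≤ (t - s) / 2 := by linarith
      have : A * (z / 4) ^ c ≤ A * (t / 2) ^ c := by gcongr
      have h9 : 0 ≤ (z - x) / 8 := by linarith
      have h10 : 0 ≤ A * (t / 2) ^ c := mul_nonneg hA.le (pow_nonneg (by linarith) _)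
      exact mul_le_mul this h8 h9 h10
    have r1 : 0 ≤ A * (y / 2) ^ b := by positivity
    have r2 : 0 ≤ A * (z / 2) ^ b := by positivity
    have r3 : 0 ≤ A * (z / 4) ^ c * ((z - x) / 8) :=
      mul_nonneg (by positivity) (by linarith)
    exact mul_le_mul (mul_le_mul q1 q2 r2 (hψp s hsK).le) q3 r3
      (mul_nonneg (hψp s hsK).le (hψp t htK).le)
  have hD : (A * (y / 2) ^ b) * (A * (z / 2) ^ b) * (A * (z / 4) ^ c * ((z - x) / 8)) *
      (((x + 3 * y) / 4 - (x + y) / 2) * (z - (y + z) / 2)) ≤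
      (g y - g x) * (k z - k y) - (k y - k x) * (g z - g y) := by
    have a1 := hrect x ((x + y) / 2) y z le_rfl (by linarith) (by linarith) le_rfl
      (by linarith) le_rfl
    have a2 := hrect ((x + 3 * y) / 4) y y z (by linarith) (by linarith) le_rfl le_rfl
      (by linarith) le_rfl
    have a3 := hrect ((x + y) / 2) ((x + 3 * y) / 4) y ((y + z) / 2) (by linarith) (by linarith)
      (by linarith) le_rfl (by linarith) (by linarith)
    linarith
  have hfac : alternant p x y z = (p 0).eval x * (p 0).eval y * (p 0).eval z *
      ((g y - g x) * (k z - k y) - (k y - k x) * (g z - g y)) := by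
    have e1 := (hp0 x hx).ne'
    have e2 := (hp0 y hy).ne'
    have e3 := (hp0 z hz).ne'
    rw [alternant_eq]
    simp only [hg, hk]
    field_simp
    ring
  have hprod : A ^ 3 * (x * y * z) ^ n ≤ (p 0).eval x * (p 0).eval y * (p 0).eval z := by
    have := mul_le_mul (mul_le_mul (h1 x hx) (h1 y hy) (by positivity) (hp0 x hx).le) (h1 z hz)
      (by positivity) (mul_nonneg (hp0 x hx).le (hp0 y hy).le)
    calc A ^ 3 * (x * y * z) ^ n = A * x ^ n * (A * y ^ n) * (A * z ^ n) := by
          rw [mul_pow, mul_pow]; ring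
      _ ≤ _ := this
  rw [hfac]
  refine le_trans (le_of_eq ?_) (mul_le_mul hprod hD ?_ ?_)
  · rw [div_pow, div_pow, div_pow, pow_add]
    field_simp
    ring
  · have : 0 ≤ z - x := by linarith
    have : 0 ≤ (x + 3 * y) / 4 - (x + y) / 2 := by linarith
    have : 0 ≤ z - (y + z) / 2 := by linarith
    positivity
  · exact mul_nonneg (mul_nonneg (hp0 x hx).le (hp0 y hy).le) (hp0 z hz).le

/-! ### Triples of perturbed monomials -/

theorem coeff_X_mul_derivative (q : ℝ[X]) (k : ℕ) :
    (X * derivative q).coeff k = k * q.coeff k := by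
  cases k with
  | zero => simp
  | succ k => rw [coeff_X_mul, coeff_derivative]; push_cast; ring

/-- A linear combination of coefficients close to those of a monomial is close to the
corresponding value for the monomial. -/
theorem abs_sum_coeff_sub_le {N n : ℕ} (hn : n ≤ N) {a f : ℕ → ℝ} {x ε B : ℝ} (hx : 0 < x)
    (hB : ∀ k ≤ N, |f k| ≤ B)
    (ha : ∀ k ≤ N, |a k - if k = n then 1 else 0| * x ^ k ≤ ε * x ^ n) :
    |∑ k ∈ Finset.range (N + 1), f k * a k * x ^ k - f n * x ^ n| ≤
      (N + 1) * B * ε * x ^ n := by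
  have e : f n * x ^ n =
      ∑ k ∈ Finset.range (N + 1), f k * (if k = n then 1 else 0) * x ^ k := by
    rw [Finset.sum_eq_single n]
    · simp
    · intro k _ hk; simp [hk]
    · intro h; exact absurd (Finset.mem_range.2 (by omega)) h
  rw [e, ← Finset.sum_sub_distrib]
  calc |∑ k ∈ Finset.range (N + 1),
        (f k * a k * x ^ k - f k * (if k = n then 1 else 0) * x ^ k)|
      ≤ ∑ k ∈ Finset.range (N + 1), B * (ε * x ^ n) := by
        refine (Finset.abs_sum_le_sum_abs _ _).trans (Finset.sum_le_sum fun k hk => ?_)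
        have hk' : k ≤ N := by have := Finset.mem_range.1 hk; omega
        have : f k * a k * x ^ k - f k * (if k = n then 1 else 0) * x ^ k
          = f k * ((a k - if k = n then 1 else 0) * x ^ k) := by ring
        rw [this, abs_mul, abs_mul, abs_of_pos (pow_pos hx k)]
        exact mul_le_mul (hB k hk') (ha k hk') (by positivity)
          ((abs_nonneg _).trans (hB k hk'))
    _ = (N + 1) * B * ε * x ^ n := by
        rw [Finset.sum_const, Finset.card_range, nsmul_eq_mul]; push_cast; ring

/-- The values at `x` of `q`, `x q'` and `x² q''` agree with those of `X ^ n` up to `η x ^ n`. -/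
structure NearMonomial (q : ℝ[X]) (n : ℕ) (η x : ℝ) : Prop where
  zero : |q.eval x - x ^ n| ≤ η * x ^ n
  one : |x * (derivative q).eval x - n * x ^ n| ≤ η * x ^ n
  two : |x ^ 2 * (derivative (derivative q)).eval x - n * (n - 1) * x ^ n| ≤ η * x ^ n

theorem nearMonomial_of_coeff {N n : ℕ} (hn : n ≤ N) {q : ℝ[X]} (hq : q.natDegree ≤ N)
    {x ε : ℝ} (hx : 0 < x) (hε : 0 ≤ ε)
    (ha : ∀ k ≤ N, |q.coeff k - if k = n then 1 else 0| * x ^ k ≤ ε * x ^ n) :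
    NearMonomial q n (((N : ℝ) + 1) ^ 3 * ε) x := by
  have hsum : ∀ r : ℝ[X], r.natDegree ≤ N →
      r.eval x = ∑ k ∈ Finset.range (N + 1), r.coeff k * x ^ k := fun r hr =>
    eval_eq_sum_range' (by omega) x
  have hdeg : ∀ r : ℝ[X], r.natDegree ≤ N → (X * derivative r).natDegree ≤ N := by
    intro r hr
    refine natDegree_le_iff_coeff_eq_zero.2 fun k hk => ?_
    rw [coeff_X_mul_derivative, coeff_eq_zero_of_natDegree_lt (by omega), mul_zero]
  have hN : (0 : ℝ) ≤ N := Nat.cast_nonneg N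
  have hx' : 0 ≤ x ^ n := (pow_pos hx n).le
  have hkN : ∀ k ≤ N, (k : ℝ) ≤ N := fun k hk => by exact_mod_cast hk
  have hbd : ∀ B : ℝ, B ≤ ((N : ℝ) + 1) ^ 2 →
      ((N : ℝ) + 1) * B * ε * x ^ n ≤ (((N : ℝ) + 1) ^ 3 * ε) * x ^ n := by
    intro B hB
    have : ((N : ℝ) + 1) * B ≤ ((N : ℝ) + 1) ^ 3 := by nlinarith
    gcongr
  refine ⟨?_, ?_, ?_⟩
  · have := abs_sum_coeff_sub_le (f := fun _ => 1) (B := 1) hn hx (by simp) ha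
    simp only [one_mul] at this
    rw [hsum q hq]
    exact this.trans (hbd 1 (by nlinarith))
  · have := abs_sum_coeff_sub_le (f := fun k => (k : ℝ)) (B := N) hn hx
      (fun k hk => by simpa using hkN k hk) ha
    have e : x * (derivative q).eval x =
        ∑ k ∈ Finset.range (N + 1), (k : ℝ) * q.coeff k * x ^ k := by
      have e1 : x * (derivative q).eval x = (X * derivative q).eval x := by
        rw [eval_mul, eval_X]
      rw [e1, hsum _ (hdeg q hq)]
      simp only [coeff_X_mul_derivative]
    rw [e]
    exact this.trans (hbd N (by nlinarith))
  · have := abs_sum_coeff_sub_le (f := fun k => (k : ℝ) * (k - 1)) (B := ((N : ℝ) + 1) ^ 2)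
      hn hx (fun k hk => by
        have h0 : (0 : ℝ) ≤ k := Nat.cast_nonneg k
        have h1 := hkN k hk
        rw [abs_le]; constructor <;> nlinarith) ha
    have e : x ^ 2 * (derivative (derivative q)).eval x =
        ∑ k ∈ Finset.range (N + 1), (k : ℝ) * (k - 1) * q.coeff k * x ^ k := by
      have e1 : x ^ 2 * (derivative (derivative q)).eval x =
          (X * derivative (X * derivative q) - X * derivative q).eval x := by
        simp only [eval_sub, eval_mul, eval_X, derivative_mul, derivative_X, eval_add, eval_one]
        ring
      rw [e1, eval_sub, hsum _ (hdeg _ (hdeg q hq)), hsum _ (hdeg q hq),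
        ← Finset.sum_sub_distrib]
      refine Finset.sum_congr rfl fun k _ => ?_
      simp only [coeff_X_mul_derivative]; ring
    rw [e]
    exact this.trans (hbd _ le_rfl)

theorem abs_mul_mul_sub_le {a b c a' b' c' η M : ℝ} (hη : 0 ≤ η)
    (ha : |a - a'| ≤ η) (hb : |b - b'| ≤ η) (hc : |c - c'| ≤ η)
    (ha' : |a'| ≤ M) (hb1 : |b| ≤ M) (hb' : |b'| ≤ M) (hc1 : |c| ≤ M) :
    |a * b * c - a' * b' * c'| ≤ 3 * η * M ^ 2 := by
  have e : a * b * c - a' * b' * c' =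
      (a - a') * (b * c) + a' * ((b - b') * c) + a' * (b' * (c - c')) := by ring
  have hM : 0 ≤ M := (abs_nonneg _).trans ha'
  have t1 : |(a - a') * (b * c)| ≤ η * (M * M) := by
    rw [abs_mul, abs_mul]; gcongr
  have t2 : |a' * ((b - b') * c)| ≤ M * (η * M) := by
    rw [abs_mul, abs_mul]; gcongr
  have t3 : |a' * (b' * (c - c'))| ≤ M * (M * η) := by
    rw [abs_mul, abs_mul]; gcongr
  rw [e]
  refine (abs_add_le _ _).trans ((add_le_add (abs_add_le _ _) le_rfl).trans ?_)
  linarith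

/-- The determinant of a small perturbation of the matrix with rows `(1, n, n (n - 1))`. -/
theorem wronskianMatrix_bounds {N : ℕ} {n : Fin 3 → ℕ} (hnN : ∀ j, (n j : ℝ) ≤ N)
    (hd10 : (1 : ℝ) ≤ n 1 - n 0) (hd21 : (1 : ℝ) ≤ n 2 - n 1) {η : ℝ} (hη : 0 ≤ η)
    (hη1 : 36 * η * ((N : ℝ) + 2) ^ 4 ≤ 1) {a b c : Fin 3 → ℝ}
    (ha1 : ∀ j, |a j - 1| ≤ η) (hb1 : ∀ j, |b j - n j| ≤ η)
    (hc1 : ∀ j, |c j - n j * (n j - 1)| ≤ η) :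
    1 / 2 ≤ a 0 * (b 1 * c 2 - b 2 * c 1) - b 0 * (a 1 * c 2 - a 2 * c 1)
        + c 0 * (a 1 * b 2 - a 2 * b 1) ∧
    a 0 * (b 1 * c 2 - b 2 * c 1) - b 0 * (a 1 * c 2 - a 2 * c 1)
        + c 0 * (a 1 * b 2 - a 2 * b 1) ≤ 6 * ((N : ℝ) + 2) ^ 6 := by
  set M : ℝ := (N : ℝ) + 2 with hM
  have hN0 : (0 : ℝ) ≤ N := Nat.cast_nonneg N
  have hM2 : 2 ≤ M := by rw [hM]; linarith
  have hn0 : ∀ j, (0 : ℝ) ≤ n j := fun j => Nat.cast_nonneg _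
  have hM4 : 1 ≤ M ^ 4 := one_le_pow₀ (by linarith)
  have hη2 : η ≤ 1 := by nlinarith
  have hM' : (N : ℝ) ^ 2 + 2 * N + 4 ≤ M ^ 2 := by rw [hM]; nlinarith
  have hNN : 0 ≤ (N : ℝ) ^ 2 := by positivity
  have sM : ∀ j, |a j| ≤ M ^ 2 ∧ |b j| ≤ M ^ 2 ∧ |c j| ≤ M ^ 2 ∧ |(1 : ℝ)| ≤ M ^ 2 ∧
      |(n j : ℝ)| ≤ M ^ 2 ∧ |(n j : ℝ) * (n j - 1)| ≤ M ^ 2 := by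
    intro j
    have A0 := abs_le.1 (ha1 j)
    have B0 := abs_le.1 (hb1 j)
    have C0 := abs_le.1 (hc1 j)
    have h1 := hnN j
    have h0 := hn0 j
    have hq : (n j : ℝ) * (n j - 1) ≤ N ^ 2 := by nlinarith
    have hq' : -1 ≤ (n j : ℝ) * (n j - 1) := by nlinarith [sq_nonneg ((n j : ℝ) - 1)]
    clear_value M
    refine ⟨?_, ?_, ?_, ?_, ?_, ?_⟩ <;> rw [abs_le] <;> constructor <;> linarith
  have T : ∀ i j k, |a i * b j * c k - 1 * n j * (n k * (n k - 1))| ≤ 3 * η * (M ^ 2) ^ 2 :=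
    fun i j k => abs_mul_mul_sub_le hη (ha1 i) (hb1 j) (hc1 k) (sM i).2.2.2.1 (sM j).2.1
      (sM j).2.2.2.2.1 (sM k).2.2.1
  have U : ∀ i j k, |a i * b j * c k| ≤ M ^ 6 := by
    intro i j k
    rw [abs_mul, abs_mul, show M ^ 6 = M ^ 2 * M ^ 2 * M ^ 2 by ring]
    exact mul_le_mul (mul_le_mul (sM i).1 (sM j).2.1 (abs_nonneg _) (by positivity))
      (sM k).2.2.1 (abs_nonneg _) (by positivity)
  have hv : (1 : ℝ) ≤ (n 1 - n 0) * (n 2 - n 0) * (n 2 - n 1) := by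
    have h20 : (1 : ℝ) ≤ n 2 - n 0 := by linarith
    have := one_le_mul_of_one_le_of_one_le hd10 h20
    exact one_le_mul_of_one_le_of_one_le this hd21
  have hvand : ((n 1 : ℝ) - n 0) * (n 2 - n 0) * (n 2 - n 1) =
      1 * n 1 * (n 2 * (n 2 - 1)) - 1 * n 2 * (n 1 * (n 1 - 1)) - 1 * n 0 * (n 2 * (n 2 - 1))
      + 1 * n 0 * (n 1 * (n 1 - 1)) + 1 * n 2 * (n 0 * (n 0 - 1))
      - 1 * n 1 * (n 0 * (n 0 - 1)) := by ring
  have hη4 : 3 * η * (M ^ 2) ^ 2 ≤ 1 / 12 := by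
    rw [← pow_mul]; linarith
  constructor
  · have t1 := abs_le.1 (T 0 1 2)
    have t2 := abs_le.1 (T 0 2 1)
    have t3 := abs_le.1 (T 1 0 2)
    have t4 := abs_le.1 (T 2 0 1)
    have t5 := abs_le.1 (T 1 2 0)
    have t6 := abs_le.1 (T 2 1 0)
    linarith [t1.1, t2.2, t3.2, t4.1, t5.1, t6.2]
  · have t1 := abs_le.1 (U 0 1 2)
    have t2 := abs_le.1 (U 0 2 1)
    have t3 := abs_le.1 (U 1 0 2)
    have t4 := abs_le.1 (U 2 0 1)
    have t5 := abs_le.1 (U 1 2 0)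
    have t6 := abs_le.1 (U 2 1 0)
    linarith [t1.2, t2.1, t3.1, t4.2, t5.2, t6.1]

/-- For perturbed monomials, the Wronskians of orders one, two and three are comparable to those
of the monomials. The tolerance depends only on a bound `N` for the exponents. -/
theorem wron_bounds {N : ℕ} {q : Fin 3 → ℝ[X]} {n : Fin 3 → ℕ} (hn : StrictMono n)
    (hN : n 2 ≤ N) {η x : ℝ} (hx : 0 < x) (hη : 0 ≤ η) (hη1 : 36 * η * ((N : ℝ) + 2) ^ 4 ≤ 1)
    (hq : ∀ j, NearMonomial (q j) (n j) η x) :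
    (x ^ n 0 / 2 ≤ (q 0).eval x ∧ (q 0).eval x ≤ 2 * x ^ n 0) ∧
    (x ^ (n 0 + n 1) / 2 ≤ x * (q 0 * derivative (q 1) - derivative (q 0) * q 1).eval x ∧
      x * (q 0 * derivative (q 1) - derivative (q 0) * q 1).eval x ≤
        (N + 2) * x ^ (n 0 + n 1)) ∧
    (x ^ (n 0 + n 1 + n 2) / 2 ≤ x ^ 3 * (wron q).eval x ∧
      x ^ 3 * (wron q).eval x ≤ 6 * ((N : ℝ) + 2) ^ 6 * x ^ (n 0 + n 1 + n 2)) := by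
  have h01 : n 0 < n 1 := hn (by decide)
  have h12 : n 1 < n 2 := hn (by decide)
  set M : ℝ := (N : ℝ) + 2 with hM
  have hN0 : (0 : ℝ) ≤ N := Nat.cast_nonneg N
  have hM2 : 2 ≤ M := by rw [hM]; linarith
  have hle : ∀ j, n j ≤ n 2 := fun j => hn.monotone (Fin.le_last j)
  have hnN : ∀ j, (n j : ℝ) ≤ N := fun j => by exact_mod_cast (hle j).trans hN
  have hn0 : ∀ j, (0 : ℝ) ≤ n j := fun j => Nat.cast_nonneg _
  -- normalized jets
  obtain ⟨a, ha⟩ : ∃ a : Fin 3 → ℝ, ∀ j, (q j).eval x = a j * x ^ n j :=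
    ⟨fun j => (q j).eval x / x ^ n j, fun j => by field_simp⟩
  obtain ⟨b, hb⟩ : ∃ b : Fin 3 → ℝ, ∀ j, x * (derivative (q j)).eval x = b j * x ^ n j :=
    ⟨fun j => x * (derivative (q j)).eval x / x ^ n j, fun j => by field_simp⟩
  obtain ⟨c, hc⟩ : ∃ c : Fin 3 → ℝ,
      ∀ j, x ^ 2 * (derivative (derivative (q j))).eval x = c j * x ^ n j :=
    ⟨fun j => x ^ 2 * (derivative (derivative (q j))).eval x / x ^ n j, fun j => by field_simp⟩
  have hdiv : ∀ j (u v : ℝ), |u * x ^ n j - v * x ^ n j| ≤ η * x ^ n j → |u - v| ≤ η := by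
    intro j u v h
    have hp : 0 < x ^ n j := pow_pos hx _
    rw [← sub_mul, abs_mul, abs_of_pos hp] at h
    exact le_of_mul_le_mul_right h hp
  have ha1 : ∀ j, |a j - 1| ≤ η := fun j => hdiv j _ _ (by rw [← ha, one_mul]; exact (hq j).zero)
  have hb1 : ∀ j, |b j - n j| ≤ η := fun j => hdiv j _ _ (by rw [← hb]; exact (hq j).one)
  have hc1 : ∀ j, |c j - n j * (n j - 1)| ≤ η := fun j =>
    hdiv j _ _ (by rw [← hc]; exact (hq j).two)
  have hM4 : 16 ≤ M ^ 4 := by nlinarith [sq_nonneg (M ^ 2 - 4), sq_nonneg (M - 2)]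
  have hη2 : η ≤ 1 / 36 / 16 := by nlinarith
  have hηM : 36 * η * M ≤ 1 / 8 := by
    have : 8 * M ≤ M ^ 4 := by nlinarith [sq_nonneg (M ^ 2 - 4), sq_nonneg (M - 2)]
    nlinarith
  have p0 := pow_pos hx (n 0)
  have p1 := pow_pos hx (n 1)
  have p2 := pow_pos hx (n 2)
  have hd10 : (1 : ℝ) ≤ n 1 - n 0 := by
    have : (n 0 : ℝ) + 1 ≤ n 1 := by exact_mod_cast h01
    linarith
  have hd21 : (1 : ℝ) ≤ n 2 - n 1 := by
    have : (n 1 : ℝ) + 1 ≤ n 2 := by exact_mod_cast h12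
    linarith
  refine ⟨?_, ?_, ?_⟩
  · rw [ha]
    have := abs_le.1 (ha1 0)
    constructor <;> nlinarith
  · have e : x * (q 0 * derivative (q 1) - derivative (q 0) * q 1).eval x
        = (a 0 * b 1 - b 0 * a 1) * x ^ (n 0 + n 1) := by
      rw [eval_sub, eval_mul, eval_mul, pow_add]
      linear_combination (q 0).eval x * hb 1 - (q 1).eval x * hb 0 +
        b 1 * x ^ n 1 * ha 0 - b 0 * x ^ n 0 * ha 1
    have hp : 0 < x ^ (n 0 + n 1) := pow_pos hx _
    rw [e]
    have A0 := abs_le.1 (ha1 0)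
    have A1 := abs_le.1 (ha1 1)
    have B0 := abs_le.1 (hb1 0)
    have B1 := abs_le.1 (hb1 1)
    have key : |a 0 * b 1 - b 0 * a 1 - (n 1 - n 0)| ≤ 1 / 2 := by
      have t1 : |(a 0 - 1) * b 1| ≤ η * M := by
        rw [abs_mul]
        refine mul_le_mul (ha1 0) ?_ (abs_nonneg _) hη
        have := hnN 1; have := hn0 1
        rw [abs_le]; constructor <;> linarith
      have t2 : |(a 1 - 1) * b 0| ≤ η * M := by
        rw [abs_mul]
        refine mul_le_mul (ha1 1) ?_ (abs_nonneg _) hη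
        have := hnN 0; have := hn0 0
        rw [abs_le]; constructor <;> linarith
      have T1 := abs_le.1 t1
      have T2 := abs_le.1 t2
      rw [abs_le]; constructor <;> nlinarith
    have key' := abs_le.1 key
    have h1N := hnN 1
    have h0n := hn0 0
    constructor
    · nlinarith
    · have : a 0 * b 1 - b 0 * a 1 ≤ (N : ℝ) + 2 := by linarith
      exact mul_le_mul_of_nonneg_right this hp.le
  · have e : x ^ 3 * (wron q).eval x = (a 0 * (b 1 * c 2 - b 2 * c 1)
          - b 0 * (a 1 * c 2 - a 2 * c 1) + c 0 * (a 1 * b 2 - a 2 * b 1))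
          * x ^ (n 0 + n 1 + n 2) := by
      have : x ^ 3 * (wron q).eval x =
        (q 0).eval x * (x * (derivative (q 1)).eval x *
            (x ^ 2 * (derivative (derivative (q 2))).eval x)
          - x * (derivative (q 2)).eval x * (x ^ 2 * (derivative (derivative (q 1))).eval x))
        - x * (derivative (q 0)).eval x * ((q 1).eval x *
            (x ^ 2 * (derivative (derivative (q 2))).eval x)
          - (q 2).eval x * (x ^ 2 * (derivative (derivative (q 1))).eval x))
        + x ^ 2 * (derivative (derivative (q 0))).eval x *
          ((q 1).eval x * (x * (derivative (q 2)).eval x)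
          - (q 2).eval x * (x * (derivative (q 1)).eval x)) := by
        rw [wron_eq]; simp only [eval_add, eval_sub, eval_mul]; ring
      rw [this]
      simp only [ha, hb, hc, pow_add]
      ring
    have hp : 0 < x ^ (n 0 + n 1 + n 2) := pow_pos hx _
    rw [e]
    have hdet := wronskianMatrix_bounds (n := n) (a := a) (b := b) (c := c) hnN hd10 hd21 hη hη1
      ha1 hb1 hc1
    constructor
    · nlinarith [hdet.1]
    · exact mul_le_mul_of_nonneg_right hdet.2 hp.le

/-- The alternant of perturbed monomials dominates the geometric mean of the values of the
Wronskian times the Vandermonde determinant (both sides are cubed). -/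
theorem alternant_of_nearMonomial (N : ℕ) :
    ∃ c : ℝ, 0 < c ∧ ∀ (q : Fin 3 → ℝ[X]) (n : Fin 3 → ℕ) (η : ℝ) (K : Set ℝ),
      StrictMono n → n 2 ≤ N → 0 ≤ η → 36 * η * ((N : ℝ) + 2) ^ 4 ≤ 1 → K.OrdConnected →
      K ⊆ Ioi 0 → (∀ x ∈ K, ∀ j, NearMonomial (q j) (n j) η x) →
      ∀ x ∈ K, ∀ y ∈ K, ∀ z ∈ K, x < y → y < z →
        0 < alternant q x y z ∧
        c * ((wron q).eval x * (wron q).eval y * (wron q).eval z) *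
          ((y - x) * (z - y) * (z - x)) ^ 3 ≤ alternant q x y z ^ 3 := by
  set M : ℝ := (N : ℝ) + 2 with hM
  have hM0 : 0 < M := by positivity
  have hM2 : 2 ≤ M := by rw [hM]; linarith [(Nat.cast_nonneg N : (0 : ℝ) ≤ N)]
  set A : ℝ := 1 / (8 * M ^ 2) with hA
  have hA0 : 0 < A := by positivity
  have hAM : A * (8 * M ^ 2) = 1 := by rw [hA]; field_simp
  have hA32 : 32 * A ≤ 1 := by
    have h4 : 4 ≤ M ^ 2 := by nlinarith
    linarith [mul_le_mul_of_nonneg_left h4 hA0.le]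
  set d : ℝ := A ^ 6 / (64 * 2 ^ N * 2 ^ N * 4 ^ N) with hd
  have hd0 : 0 < d := by positivity
  refine ⟨d ^ 3 / (6 * M ^ 6) ^ 3, by positivity, ?_⟩
  intro q n η K hn hN hη hη1 hK hpos hq x hx y hy z hz hxy hyz
  have h01 : n 0 < n 1 := hn (by decide)
  have h12 : n 1 < n 2 := hn (by decide)
  obtain ⟨b, hb⟩ : ∃ b, n 1 = n 0 + b + 1 := ⟨n 1 - n 0 - 1, by omega⟩
  obtain ⟨c, hc⟩ : ∃ c, n 2 = n 1 + c + 1 := ⟨n 2 - n 1 - 1, by omega⟩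
  have B := fun t (ht : t ∈ K) => wron_bounds hn hN (hpos ht) hη hη1 (hq t ht)
  have hW2 : ∀ t ∈ K, t ^ (2 * n 0 + b) / 2 ≤
        (q 0 * derivative (q 1) - derivative (q 0) * q 1).eval t ∧
      (q 0 * derivative (q 1) - derivative (q 0) * q 1).eval t ≤ M * t ^ (2 * n 0 + b) := by
    intro t ht
    have ht0 : 0 < t := hpos ht
    obtain ⟨-, ⟨h1, h2⟩, -⟩ := B t ht
    have e : t ^ (n 0 + n 1) = t * t ^ (2 * n 0 + b) := by
      rw [← pow_succ']; congr 1; omega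
    rw [e] at h1 h2
    constructor
    · refine le_of_mul_le_mul_left ?_ ht0; linarith
    · refine le_of_mul_le_mul_left ?_ ht0
      calc _ ≤ _ := h2
        _ = _ := by ring
  have hW3 : ∀ t ∈ K, t ^ (3 * n 0 + 2 * b + c) / 2 ≤ (wron q).eval t ∧
      (wron q).eval t ≤ 6 * M ^ 6 * t ^ (3 * n 0 + 2 * b + c) := by
    intro t ht
    have ht0 : 0 < t := hpos ht
    obtain ⟨-, -, ⟨h1, h2⟩⟩ := B t ht
    have e : t ^ (n 0 + n 1 + n 2) = t ^ 3 * t ^ (3 * n 0 + 2 * b + c) := by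
      rw [← pow_add]; congr 1; omega
    rw [e] at h1 h2
    constructor
    · refine le_of_mul_le_mul_left ?_ (pow_pos ht0 3); linarith
    · refine le_of_mul_le_mul_left ?_ (pow_pos ht0 3)
      calc _ ≤ _ := h2
        _ = _ := by ring
  have hx0 : 0 < x := hpos hx
  have hy0 : 0 < y := hpos hy
  have hz0 : 0 < z := hpos hz
  have hmain := le_alternant (p := q) hK hpos hA0 (n := n 0) (b := b) (c := c)
    (fun t ht => by
      have ht0 : 0 < t := hpos ht
      have := (B t ht).1.1
      have hp := pow_pos ht0 (n 0)
      nlinarith)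
    (fun t ht => lt_of_lt_of_le (by have ht0 : 0 < t := hpos ht; positivity) (hW2 t ht).1)
    (fun t ht => by
      have ht0 : 0 < t := hpos ht
      have hu := (B t ht).1
      have hq0 : 0 < (q 0).eval t := lt_of_lt_of_le (by positivity) hu.1
      rw [le_div_iff₀ (by positivity)]
      refine le_trans ?_ (hW2 t ht).1
      have hsq : (q 0).eval t ^ 2 ≤ (2 * t ^ n 0) ^ 2 := pow_le_pow_left₀ hq0.le hu.2 2
      calc A * t ^ b * (q 0).eval t ^ 2 ≤ A * t ^ b * (2 * t ^ n 0) ^ 2 := by gcongr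
        _ = (8 * A) * (t ^ (2 * n 0 + b) / 2) := by rw [pow_add, mul_pow, ← pow_mul']; ring
        _ ≤ 1 * (t ^ (2 * n 0 + b) / 2) := by gcongr; linarith
        _ = _ := one_mul _)
    (fun t ht => by
      have ht0 : 0 < t := hpos ht
      have hu := (B t ht).1
      have hw2 := hW2 t ht
      have hw3 := hW3 t ht
      have hw20 : 0 < (q 0 * derivative (q 1) - derivative (q 0) * q 1).eval t :=
        lt_of_lt_of_le (by positivity) hw2.1
      rw [le_div_iff₀ (by positivity)]
      have hsq := pow_le_pow_left₀ hw20.le hw2.2 2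
      calc A * t ^ c * (q 0 * derivative (q 1) - derivative (q 0) * q 1).eval t ^ 2
          ≤ A * t ^ c * (M * t ^ (2 * n 0 + b)) ^ 2 := by gcongr
        _ = (A * (8 * M ^ 2) / 2) *
            (t ^ n 0 / 2 * (t ^ (3 * n 0 + 2 * b + c) / 2)) := by
            rw [mul_pow, ← pow_mul]
            have : t ^ n 0 * t ^ (3 * n 0 + 2 * b + c) = t ^ c * t ^ ((2 * n 0 + b) * 2) := by
              rw [← pow_add, ← pow_add]; congr 1; ring
            linear_combination (-A * M ^ 2) * this
        _ ≤ 1 * (t ^ n 0 / 2 * (t ^ (3 * n 0 + 2 * b + c) / 2)) := by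
            rw [hAM]; gcongr; norm_num
        _ ≤ _ := by
            rw [one_mul]
            exact mul_le_mul hu.1 hw3.1 (by positivity)
              (le_trans (by positivity) hu.1)) hx hy hz hxy hyz
  set V := (y - x) * (z - y) * (z - x) with hV
  have hV0 : 0 < V := mul_pos (mul_pos (by linarith) (by linarith)) (by linarith)
  have hbN : b ≤ N := by omega
  have hcN : c ≤ N := by omega
  have hdle : d ≤ A ^ 6 / (64 * 2 ^ b * 2 ^ b * 4 ^ c) := by
    rw [hd]
    have h2b : (2 : ℝ) ^ b ≤ 2 ^ N := pow_le_pow_right₀ (by norm_num) hbN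
    have h4c : (4 : ℝ) ^ c ≤ 4 ^ N := pow_le_pow_right₀ (by norm_num) hcN
    gcongr
  have hm : d * ((x * y * z) ^ n 0 * y ^ b * z ^ (b + c) * V) ≤ alternant q x y z :=
    le_trans (mul_le_mul_of_nonneg_right hdle (by positivity)) hmain
  refine ⟨lt_of_lt_of_le (by positivity) hm, ?_⟩
  have hcube := pow_le_pow_left₀ (by positivity) hm 3
  refine le_trans ?_ hcube
  have hww : (wron q).eval x * (wron q).eval y * (wron q).eval z ≤
      (6 * M ^ 6) ^ 3 * (x * y * z) ^ (3 * n 0 + 2 * b + c) := by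
    have wp : ∀ t ∈ K, 0 ≤ (wron q).eval t := fun t ht =>
      le_trans (by have ht0 : 0 < t := hpos ht; positivity) (hW3 t ht).1
    calc _ ≤ (6 * M ^ 6 * x ^ (3 * n 0 + 2 * b + c)) * (6 * M ^ 6 * y ^ (3 * n 0 + 2 * b + c)) *
          (6 * M ^ 6 * z ^ (3 * n 0 + 2 * b + c)) :=
          mul_le_mul (mul_le_mul (hW3 x hx).2 (hW3 y hy).2 (wp y hy) (by positivity))
            (hW3 z hz).2 (wp z hz) (by positivity)
      _ = _ := by rw [mul_pow, mul_pow]; ring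
  -- the exponents of `y` and `z` majorize their average
  have hmaj : (x * y * z) ^ (2 * b + c) ≤ (y ^ b * z ^ (b + c)) ^ 3 := by
    have e1 : (x * y * z) ^ (2 * b + c) = (x ^ (b + (b + c)) * y ^ c) * (y ^ (2 * b) *
        z ^ (2 * b + c)) := by
      rw [mul_pow, mul_pow]
      have : y ^ (2 * b + c) = y ^ c * y ^ (2 * b) := by rw [← pow_add]; congr 1; ring
      rw [this, show b + (b + c) = 2 * b + c by ring]; ring
    have e2 : (y ^ b * z ^ (b + c)) ^ 3 = (y ^ b * z ^ (b + c) * z ^ c) * (y ^ (2 * b) *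
        z ^ (2 * b + c)) := by
      rw [mul_pow, ← pow_mul, ← pow_mul]
      rw [show b * 3 = b + 2 * b by ring, show (b + c) * 3 = (b + c) + c + (2 * b + c) by ring]
      simp only [pow_add]; ring
    rw [e1, e2]
    refine mul_le_mul_of_nonneg_right ?_ (by positivity)
    rw [pow_add]
    have hxz : x ≤ z := by linarith
    gcongr
  calc d ^ 3 / (6 * M ^ 6) ^ 3 * ((wron q).eval x * (wron q).eval y * (wron q).eval z) * V ^ 3
      ≤ d ^ 3 / (6 * M ^ 6) ^ 3 *
          ((6 * M ^ 6) ^ 3 * (x * y * z) ^ (3 * n 0 + 2 * b + c)) * V ^ 3 := by gcongr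
    _ = d ^ 3 * ((x * y * z) ^ (3 * n 0) * (x * y * z) ^ (2 * b + c)) * V ^ 3 := by
        rw [← pow_add]
        have : (6 * M ^ 6) ^ 3 ≠ 0 := by positivity
        rw [show 3 * n 0 + (2 * b + c) = 3 * n 0 + 2 * b + c by ring]
        field_simp
    _ ≤ d ^ 3 * ((x * y * z) ^ (3 * n 0) * (y ^ b * z ^ (b + c)) ^ 3) * V ^ 3 := by gcongr
    _ = (d * ((x * y * z) ^ n 0 * y ^ b * z ^ (b + c) * V)) ^ 3 := by
        rw [show 3 * n 0 = n 0 * 3 by ring, pow_mul]; ring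

/-! ### Dominant minors of the coefficient matrix -/

/-- The minor of the coefficient matrix of `p` in the columns `κ`. -/
noncomputable def coeffMinor (p : Fin 3 → ℝ[X]) (κ : Fin 3 → ℕ) : ℝ :=
  (Matrix.of fun i j : Fin 3 => (p i).coeff (κ j)).det

/-- At the scale `r`, the minor in the columns `κ` is nonzero and, weighted by the power of `r`
which it carries in the Wronskian, exceeds by the factor `ε⁻¹` all minors that carry a different
power. -/
def IsDominant (N : ℕ) (ε : ℝ) (p : Fin 3 → ℝ[X]) (κ : Fin 3 → ℕ) (r : ℝ) : Prop :=
  coeffMinor p κ ≠ 0 ∧ ∀ κ' : Fin 3 → ℕ, (∀ j, κ' j ≤ N) → ∑ j, κ' j ≠ ∑ j, κ j →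
    |coeffMinor p κ'| * r ^ (∑ j, κ' j) ≤ ε * (|coeffMinor p κ| * r ^ (∑ j, κ j))

/-- The triple of linear combinations of `p` given by the rows of the matrix `B`. -/
noncomputable def linComb (B : Matrix (Fin 3) (Fin 3) ℝ) (p : Fin 3 → ℝ[X]) : Fin 3 → ℝ[X] :=
  fun i => ∑ j, C (B i j) * p j

theorem natDegree_linComb_le {N : ℕ} (B : Matrix (Fin 3) (Fin 3) ℝ) {p : Fin 3 → ℝ[X]}
    (hp : ∀ i, (p i).natDegree ≤ N) (i : Fin 3) : (linComb B p i).natDegree ≤ N :=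
  natDegree_sum_le_of_forall_le _ _ fun j _ => (natDegree_C_mul_le _ _).trans (hp j)

theorem alternant_linComb (B : Matrix (Fin 3) (Fin 3) ℝ) (p : Fin 3 → ℝ[X]) (x y z : ℝ) :
    alternant (linComb B p) x y z = B.det * alternant p x y z := by
  rw [alternant, alternant, ← Matrix.det_mul]
  congr 1
  ext i j
  simp [linComb, Matrix.mul_apply, eval_finsetSum]

theorem eval_wron (p : Fin 3 → ℝ[X]) (x : ℝ) :
    (wron p).eval x =
      (Matrix.of fun i j : Fin 3 => (derivative^[(j : ℕ)] (p i)).eval x).det := by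
  rw [wron, ← coe_evalRingHom, RingHom.map_det]
  rfl

theorem eval_wron_linComb (B : Matrix (Fin 3) (Fin 3) ℝ) (p : Fin 3 → ℝ[X]) (x : ℝ) :
    (wron (linComb B p)).eval x = B.det * (wron p).eval x := by
  rw [eval_wron, eval_wron, ← Matrix.det_mul]
  congr 1
  ext i j
  simp [linComb, Matrix.mul_apply, eval_finsetSum, iterate_derivative_sum]

theorem coeff_linComb_inv {p : Fin 3 → ℝ[X]} {κ : Fin 3 → ℕ}
    (i : Fin 3) (k : ℕ) :
    (linComb (Matrix.of fun i j : Fin 3 => (p i).coeff (κ j))⁻¹ p i).coeff k =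
      coeffMinor p (Function.update κ i k) / coeffMinor p κ := by
  set A : Matrix (Fin 3) (Fin 3) ℝ := Matrix.of fun i j : Fin 3 => (p i).coeff (κ j) with hA
  have e : (linComb A⁻¹ p i).coeff k = (A⁻¹.mulVec fun j => (p j).coeff k) i := by
    simp [linComb, Matrix.mulVec, dotProduct]
  have e2 : coeffMinor p (Function.update κ i k) =
      (A.updateCol i fun j => (p j).coeff k).det := by
    rw [coeffMinor]
    congr 1
    ext a b
    by_cases hb : b = i
    · subst hb; simp
    · simp [hb, hA]
  rw [e, e2, ← Matrix.cramer_apply, Matrix.cramer_eq_adjugate_mulVec, Matrix.inv_def,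
    Matrix.smul_mulVec, Pi.smul_apply, Ring.inverse_eq_inv', smul_eq_mul, div_eq_inv_mul]
  rfl

/-- The tolerance in `IsDominant` for which the normalized polynomials are perturbed monomials. -/
noncomputable def tol (N : ℕ) : ℝ := 1 / (36 * ((N : ℝ) + 1) ^ 3 * ((N : ℝ) + 2) ^ 4)

theorem tol_pos (N : ℕ) : 0 < tol N := by unfold tol; positivity

theorem IsDominant.nearMonomial {N : ℕ} {ε : ℝ} (hε : 0 ≤ ε) {p : Fin 3 → ℝ[X]}
    (hp : ∀ i, (p i).natDegree ≤ N) {κ : Fin 3 → ℕ} (hκ : ∀ j, κ j ≤ N) {r : ℝ} (hr : 0 < r)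
    (h : IsDominant N ε p κ r) (i : Fin 3) :
    NearMonomial (linComb (Matrix.of fun i j : Fin 3 => (p i).coeff (κ j))⁻¹ p i) (κ i)
      (((N : ℝ) + 1) ^ 3 * ε) r := by
  refine nearMonomial_of_coeff (hκ i) (natDegree_linComb_le _ hp i) hr hε fun k hk => ?_
  rw [coeff_linComb_inv]
  by_cases hki : k = κ i
  · subst hki
    rw [Function.update_eq_self, div_self h.1]
    simp only [if_true, sub_self, abs_zero, zero_mul]
    positivity
  · rw [if_neg hki, sub_zero]
    have hsum : ∑ j, Function.update κ i k j + κ i = ∑ j, κ j + k := by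
      rw [Finset.sum_update_of_mem (Finset.mem_univ i)]
      have := Finset.sum_erase_add Finset.univ κ (Finset.mem_univ i)
      rw [← this, Finset.sdiff_singleton_eq_erase]
      ring
    have hdom := h.2 (Function.update κ i k) (fun j => by
      by_cases hj : j = i
      · subst hj; simpa using hk
      · simpa [hj] using hκ j) (by omega)
    have hm : 0 < |coeffMinor p κ| := abs_pos.2 h.1
    rw [abs_div, div_mul_eq_mul_div, div_le_iff₀ hm]
    have hs := pow_pos hr (∑ j, κ j)
    refine le_of_mul_le_mul_right ?_ hs
    have e : r ^ (∑ j, Function.update κ i k j) * r ^ κ i = r ^ (∑ j, κ j) * r ^ k := by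
      rw [← pow_add, ← pow_add, hsum]
    calc |coeffMinor p (Function.update κ i k)| * r ^ k * r ^ (∑ j, κ j)
        = (|coeffMinor p (Function.update κ i k)| * r ^ (∑ j, Function.update κ i k j))
            * r ^ κ i := by linear_combination -|coeffMinor p (Function.update κ i k)| * e
      _ ≤ ε * (|coeffMinor p κ| * r ^ (∑ j, κ j)) * r ^ κ i :=
          mul_le_mul_of_nonneg_right hdom (by positivity)
      _ = _ := by ring

theorem tol_spec {N : ℕ} {ε : ℝ} (hεN : ε ≤ tol N) :
    36 * (((N : ℝ) + 1) ^ 3 * ε) * ((N : ℝ) + 2) ^ 4 ≤ 1 := by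
  rw [tol, le_div_iff₀ (by positivity)] at hεN
  linarith

theorem det_inv_coeffMatrix {p : Fin 3 → ℝ[X]} {κ : Fin 3 → ℕ} :
    (Matrix.of fun i j : Fin 3 => (p i).coeff (κ j))⁻¹.det = (coeffMinor p κ)⁻¹ := by
  rw [Matrix.det_nonsing_inv, Ring.inverse_eq_inv']; rfl

/-- At a scale where the minor `κ` dominates, the Wronskian is comparable to its monomial. -/
theorem IsDominant.le_wron {N : ℕ} {ε : ℝ} (hε : 0 ≤ ε) (hεN : ε ≤ tol N) {p : Fin 3 → ℝ[X]}
    (hp : ∀ i, (p i).natDegree ≤ N) {κ : Fin 3 → ℕ} (hmono : StrictMono κ) (hκ : κ 2 ≤ N)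
    {r : ℝ} (hr : 0 < r) (h : IsDominant N ε p κ r) :
    |coeffMinor p κ| * r ^ (∑ j, κ j) ≤ 2 * (r ^ 3 * |(wron p).eval r|) := by
  have hκ' : ∀ j, κ j ≤ N := fun j => (hmono.monotone (Fin.le_last j)).trans hκ
  have hB := (wron_bounds hmono hκ hr (by positivity) (tol_spec hεN)
    (h.nearMonomial hε hp hκ' hr)).2.2.1
  rw [eval_wron_linComb, det_inv_coeffMatrix] at hB
  have hm : 0 < |coeffMinor p κ| := abs_pos.2 h.1
  have h1 : r ^ (κ 0 + κ 1 + κ 2) / 2 ≤ r ^ 3 * (|coeffMinor p κ|⁻¹ * |(wron p).eval r|) := by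
    refine hB.trans ?_
    rw [← abs_inv, ← abs_mul]
    exact mul_le_mul_of_nonneg_left (le_abs_self _) (by positivity)
  rw [Fin.sum_univ_three]
  calc |coeffMinor p κ| * r ^ (κ 0 + κ 1 + κ 2)
      = 2 * |coeffMinor p κ| * (r ^ (κ 0 + κ 1 + κ 2) / 2) := by ring
    _ ≤ 2 * |coeffMinor p κ| * (r ^ 3 * (|coeffMinor p κ|⁻¹ * |(wron p).eval r|)) := by gcongr
    _ = _ := by field_simp

/-- The inequality `|J| ≥ c ∏ |L(tᵢ)| ^ {1/3} V` (cubed), with constancy of the sign of `J` on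
ordered triples: `J` is the alternant and `L` the Wronskian of `p`, and `V` is the Vandermonde
determinant. -/
def GeomIneq (c : ℝ) (p : Fin 3 → ℝ[X]) (K : Set ℝ) : Prop :=
  ∃ σ : ℝ, ∀ x ∈ K, ∀ y ∈ K, ∀ z ∈ K, x < y → y < z →
    0 < σ * alternant p x y z ∧
    c * |(wron p).eval x * (wron p).eval y * (wron p).eval z| *
      ((y - x) * (z - y) * (z - x)) ^ 3 ≤ |alternant p x y z| ^ 3

theorem geomIneq_of_dominant (N : ℕ) :
    ∃ c : ℝ, 0 < c ∧ ∀ (p : Fin 3 → ℝ[X]) (κ : Fin 3 → ℕ) (ε : ℝ) (K : Set ℝ),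
      (∀ i, (p i).natDegree ≤ N) → StrictMono κ → κ 2 ≤ N → 0 ≤ ε → ε ≤ tol N →
      K.OrdConnected → K ⊆ Ioi 0 → (∀ x ∈ K, IsDominant N ε p κ x) → GeomIneq c p K := by
  obtain ⟨c, hc, h⟩ := alternant_of_nearMonomial N
  refine ⟨c, hc, fun p κ ε K hp hmono hκ hε hεN hK hpos hdom => ?_⟩
  have hκ' : ∀ j, κ j ≤ N := fun j => (hmono.monotone (Fin.le_last j)).trans hκ
  refine ⟨(coeffMinor p κ)⁻¹, fun x hx y hy z hz hxy hyz => ?_⟩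
  have hm := (hdom x hx).1
  obtain ⟨h1, h2⟩ := h _ κ _ K hmono hκ (by positivity) (tol_spec hεN) hK hpos
    (fun t ht j => (hdom t ht).nearMonomial hε hp hκ' (hpos ht) j) x hx y hy z hz hxy hyz
  rw [alternant_linComb, det_inv_coeffMatrix] at h1
  refine ⟨h1, ?_⟩
  rw [alternant_linComb, det_inv_coeffMatrix, eval_wron_linComb, eval_wron_linComb,
    eval_wron_linComb, det_inv_coeffMatrix] at h2
  set m := (coeffMinor p κ)⁻¹ with hmdef
  have hm' : 0 < |m| := abs_pos.2 (inv_ne_zero hm)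
  have hV : 0 < (y - x) * (z - y) * (z - x) :=
    mul_pos (mul_pos (by linarith) (by linarith)) (by linarith)
  have wp : ∀ t ∈ K, 0 ≤ m * (wron p).eval t := by
    intro t ht
    have := (wron_bounds hmono hκ (hpos ht) (by positivity) (tol_spec hεN)
      ((hdom t ht).nearMonomial hε hp hκ' (hpos ht))).2.2.1
    rw [eval_wron_linComb, det_inv_coeffMatrix] at this
    have ht0 : 0 < t := hpos ht
    have h3 : 0 ≤ t ^ 3 * (m * (wron p).eval t) := le_trans (by positivity) this
    exact nonneg_of_mul_nonneg_right h3 (by positivity)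
  rw [← abs_of_nonneg (mul_nonneg (mul_nonneg (wp x hx) (wp y hy)) (wp z hz)),
    ← abs_of_pos h1] at h2
  have e1 : |m * (wron p).eval x * (m * (wron p).eval y) * (m * (wron p).eval z)| =
      |m| ^ 3 * |(wron p).eval x * (wron p).eval y * (wron p).eval z| := by
    rw [← abs_pow, ← abs_mul]; congr 1; ring
  rw [e1, abs_mul m, mul_pow |m|] at h2
  refine le_of_mul_le_mul_left ?_ (pow_pos hm' 3)
  calc _ = c * (|m| ^ 3 * |(wron p).eval x * (wron p).eval y * (wron p).eval z|) *
        ((y - x) * (z - y) * (z - x)) ^ 3 := by ring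
    _ ≤ _ := h2

/-- The columns of a nonvanishing minor can be sorted. -/
theorem exists_strictMono_coeffMinor {p : Fin 3 → ℝ[X]} {κ : Fin 3 → ℕ}
    (h : coeffMinor p κ ≠ 0) :
    ∃ σ : Equiv.Perm (Fin 3), StrictMono (κ ∘ σ) ∧
      |coeffMinor p (κ ∘ σ)| = |coeffMinor p κ| := by
  have hinj : Function.Injective κ := by
    intro i j hij
    by_contra hne
    exact h (Matrix.det_zero_of_column_eq hne fun k => by simp [hij])
  refine ⟨Tuple.sort κ, (Tuple.monotone_sort κ).strictMono_of_injective
    (hinj.comp (Tuple.sort κ).injective), ?_⟩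
  have : coeffMinor p (κ ∘ Tuple.sort κ) =
      Equiv.Perm.sign (Tuple.sort κ) * coeffMinor p κ := by
    rw [coeffMinor, coeffMinor, ← Matrix.det_permute']
    rfl
  rw [this, abs_mul]
  rcases Int.units_eq_one_or (Equiv.Perm.sign (Tuple.sort κ)) with h | h <;> simp [h]

/-! ### Scales at which a minor dominates -/

theorem wron_eq_zero_of_coeffMinor {N : ℕ} {p : Fin 3 → ℝ[X]} (hp : ∀ i, (p i).natDegree ≤ N)
    (h : ∀ κ : Fin 3 → Fin (N + 1), coeffMinor p (fun j => κ j) = 0) : wron p = 0 := by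
  refine Polynomial.funext fun x => ?_
  rw [eval_wron, eval_zero, ← Matrix.det_transpose]
  have e : (Matrix.of fun i j : Fin 3 => (derivative^[(j : ℕ)] (p i)).eval x).transpose =
      fun j : Fin 3 => ∑ k : Fin (N + 1), ((derivative^[(j : ℕ)] (X ^ (k : ℕ) : ℝ[X])).eval x) •
        fun i => (p i).coeff k := by
    ext j i
    have : (p i) = ∑ k ∈ Finset.range (N + 1), C ((p i).coeff k) * X ^ k :=
      as_sum_range_C_mul_X_pow' _ (by have := hp i; omega)
    rw [Matrix.transpose_apply, Matrix.of_apply, Finset.sum_apply]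
    conv_lhs => rw [this]
    rw [iterate_derivative_sum, eval_finsetSum, Finset.sum_range]
    refine Finset.sum_congr rfl fun k _ => ?_
    rw [iterate_derivative_C_mul, eval_C_mul, Pi.smul_apply, smul_eq_mul, mul_comm]
  have e2 := (Matrix.detRowAlternating (n := Fin 3) (R := ℝ)).toMultilinearMap.map_sum
    (fun (j : Fin 3) (k : Fin (N + 1)) =>
      ((derivative^[(j : ℕ)] (X ^ (k : ℕ) : ℝ[X])).eval x) • fun i : Fin 3 => (p i).coeff k)
  rw [e]
  refine e2.trans (Finset.sum_eq_zero fun κ _ => ?_)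
  rw [MultilinearMap.map_smul_univ]
  have : (Matrix.detRowAlternating (n := Fin 3) (R := ℝ)).toMultilinearMap
      (fun j i => (p i).coeff (κ j)) = coeffMinor p (fun j => κ j) := by
    rw [coeffMinor, ← Matrix.det_transpose]; rfl
  rw [this, h, smul_zero]

theorem exists_balance {a b : ℝ} (ha : 0 < a) (hb : 0 < b) {m n : ℕ} (hmn : m < n) :
    ∃ ρ : ℝ, 0 < ρ ∧ b * ρ ^ n = a * ρ ^ m := by
  obtain ⟨d, rfl⟩ : ∃ d, n = m + d := ⟨n - m, by omega⟩
  have hd : d ≠ 0 := by omega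
  refine ⟨(a / b) ^ ((d : ℝ)⁻¹), by positivity, ?_⟩
  rw [pow_add, Real.rpow_inv_natCast_pow (by positivity) hd]
  field_simp

/-- Away from boundedly many multiplicative intervals `(ρ / Λ, Λ ρ)`, some minor dominates. -/
theorem exists_scales {N : ℕ} {p : Fin 3 → ℝ[X]} (hp : ∀ i, (p i).natDegree ≤ N)
    (hw : wron p ≠ 0) :
    ∃ ρ : (Fin 3 → Fin (N + 1)) × (Fin 3 → Fin (N + 1)) → ℝ, (∀ π, 0 < ρ π) ∧
      ∀ Λ r : ℝ, 1 < Λ → 0 < r → (∀ π, r ∉ Ioo (ρ π / Λ) (Λ * ρ π)) →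
        ∃ κ : Fin 3 → Fin (N + 1), StrictMono (fun j => (κ j : ℕ)) ∧
          IsDominant N Λ⁻¹ p (fun j => κ j) r := by
  classical
  set m : (Fin 3 → Fin (N + 1)) → ℝ := fun κ => |coeffMinor p (fun j => κ j)| with hm
  set S : (Fin 3 → Fin (N + 1)) → ℕ := fun κ => ∑ j, (κ j : ℕ) with hS
  have hρ : ∀ π : (Fin 3 → Fin (N + 1)) × (Fin 3 → Fin (N + 1)), ∃ ρ : ℝ, 0 < ρ ∧
      (0 < m π.1 → 0 < m π.2 → S π.1 < S π.2 → m π.2 * ρ ^ S π.2 = m π.1 * ρ ^ S π.1) := by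
    intro π
    by_cases h : 0 < m π.1 ∧ 0 < m π.2 ∧ S π.1 < S π.2
    · obtain ⟨ρ, h1, h2⟩ := exists_balance h.1 h.2.1 h.2.2
      exact ⟨ρ, h1, fun _ _ _ => h2⟩
    · exact ⟨1, one_pos, fun h1 h2 h3 => absurd ⟨h1, h2, h3⟩ h⟩
  choose ρ hρ0 hρ using hρ
  refine ⟨ρ, hρ0, fun Λ r hΛ hr hout => ?_⟩
  have hΛ0 : 0 < Λ := by linarith
  -- on either side of a balance scale one of the two minors wins by the factor `Λ`
  have hcomp : ∀ κ κ', 0 < m κ → 0 < m κ' → S κ < S κ' →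
      Λ * (m κ' * r ^ S κ') ≤ m κ * r ^ S κ ∨ Λ * (m κ * r ^ S κ) ≤ m κ' * r ^ S κ' := by
    intro κ κ' h1 h2 h3
    have hb := hρ (κ, κ') h1 h2 h3
    have h0 := hρ0 (κ, κ')
    have ho := hout (κ, κ')
    set ρ0 := ρ (κ, κ')
    dsimp only at hb
    obtain ⟨d, hd⟩ : ∃ d, S κ' = S κ + (d + 1) := ⟨S κ' - S κ - 1, by omega⟩
    rw [hd] at hb ⊢
    have hb' : m κ = m κ' * ρ0 ^ (d + 1) := by
      have hp := pow_pos h0 (S κ)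
      rw [pow_add] at hb
      refine mul_right_cancel₀ hp.ne' ?_
      rw [← hb]; ring
    have hrS := pow_pos hr (S κ)
    have hΛd : Λ ≤ Λ ^ (d + 1) := le_self_pow₀ hΛ.le (Nat.succ_ne_zero d)
    rcases le_or_gt r (ρ0 / Λ) with h | h
    · left
      have h4 : Λ * r ≤ ρ0 := by rw [le_div_iff₀ hΛ0] at h; linarith
      have h5 : (Λ * r) ^ (d + 1) ≤ ρ0 ^ (d + 1) := pow_le_pow_left₀ (by positivity) h4 _
      rw [mul_pow] at h5
      have h6 : Λ * r ^ (d + 1) ≤ ρ0 ^ (d + 1) :=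
        le_trans (mul_le_mul_of_nonneg_right hΛd (by positivity)) h5
      rw [hb', pow_add r]
      calc Λ * (m κ' * (r ^ S κ * r ^ (d + 1))) = (m κ' * r ^ S κ) * (Λ * r ^ (d + 1)) := by ring
        _ ≤ (m κ' * r ^ S κ) * ρ0 ^ (d + 1) := by gcongr
        _ = _ := by ring
    · right
      have h4 : Λ * ρ0 ≤ r := by
        by_contra hlt
        exact ho ⟨h, not_le.1 hlt⟩
      have h5 : (Λ * ρ0) ^ (d + 1) ≤ r ^ (d + 1) := pow_le_pow_left₀ (by positivity) h4 _
      rw [mul_pow] at h5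
      have h6 : Λ * ρ0 ^ (d + 1) ≤ r ^ (d + 1) :=
        le_trans (mul_le_mul_of_nonneg_right hΛd (by positivity)) h5
      rw [hb', pow_add r]
      calc Λ * (m κ' * ρ0 ^ (d + 1) * r ^ S κ) = (m κ' * r ^ S κ) * (Λ * ρ0 ^ (d + 1)) := by ring
        _ ≤ (m κ' * r ^ S κ) * r ^ (d + 1) := by gcongr
        _ = _ := by ring
  obtain ⟨κ, -, hmax⟩ := Finset.exists_max_image Finset.univ (fun κ => m κ * r ^ S κ)
    Finset.univ_nonempty
  have hmax' : ∀ κ', m κ' * r ^ S κ' ≤ m κ * r ^ S κ := fun κ' => hmax κ' (Finset.mem_univ _)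
  have hκ0 : coeffMinor p (fun j => κ j) ≠ 0 := by
    intro h0
    refine hw (wron_eq_zero_of_coeffMinor hp fun κ' => ?_)
    have h1 := hmax' κ'
    have h2 : m κ = 0 := by rw [hm]; simpa using h0
    rw [h2, zero_mul] at h1
    have h3 : m κ' ≤ 0 := nonpos_of_mul_nonpos_left h1 (pow_pos hr _)
    exact abs_eq_zero.1 (le_antisymm h3 (abs_nonneg _))
  have hmκ : 0 < m κ := abs_pos.2 hκ0
  obtain ⟨σ, hσ1, hσ2⟩ := exists_strictMono_coeffMinor hκ0
  have hsum : ∑ j, (κ (σ j) : ℕ) = ∑ j, (κ j : ℕ) := Equiv.sum_comp σ fun j => (κ j : ℕ)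
  refine ⟨fun j => κ (σ j), hσ1, ?_, ?_⟩
  · intro h0
    have : |coeffMinor p ((fun j => (κ j : ℕ)) ∘ σ)| = 0 := by rw [abs_eq_zero]; exact h0
    exact hmκ.ne' (hσ2.symm.trans this)
  · intro κ' hκ' hne
    have e1 : |coeffMinor p (fun j => (κ (σ j) : ℕ))| = m κ := hσ2
    rw [e1, hsum]
    rw [hsum] at hne
    obtain ⟨κ'', rfl⟩ : ∃ κ'' : Fin 3 → Fin (N + 1), κ' = fun j => (κ'' j : ℕ) :=
      ⟨fun j => ⟨κ' j, by have := hκ' j; omega⟩, rfl⟩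
    change m κ'' * r ^ S κ'' ≤ Λ⁻¹ * (m κ * r ^ S κ)
    have hpos : 0 < m κ * r ^ S κ := by positivity
    rcases (abs_nonneg (coeffMinor p fun j => (κ'' j : ℕ))).eq_or_lt with h0 | h0
    · have : m κ'' = 0 := h0.symm
      rw [this, zero_mul]; positivity
    rw [inv_mul_eq_div, le_div_iff₀ hΛ0, mul_comm]
    have hpos'' : 0 < m κ'' * r ^ S κ'' := mul_pos h0 (pow_pos hr _)
    rcases lt_or_gt_of_ne hne with hlt | hlt
    · rcases hcomp κ'' κ h0 hmκ hlt with h | h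
      · nlinarith [hmax' κ'']
      · exact h
    · rcases hcomp κ κ'' hmκ h0 hlt with h | h
      · exact h
      · nlinarith [hmax' κ'']

/-- Among the scales `s Λ^{-2 i}`, `1 ≤ i ≤ n + 1`, one avoids `n` intervals `(ρ / Λ, Λ ρ)`. -/
theorem exists_good_scale {ι : Type*} [Fintype ι] (ρ : ι → ℝ)
    {Λ s : ℝ} (hΛ : 1 < Λ) (hs : 0 < s) :
    ∃ r : ℝ, s / Λ ^ (2 * (Fintype.card ι + 1)) ≤ r ∧ r ≤ s / Λ ^ 2 ∧
      ∀ π, r ∉ Ioo (ρ π / Λ) (Λ * ρ π) := by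
  by_contra hcon
  push Not at hcon
  have hΛ0 : 0 < Λ := by linarith
  have h : ∀ i : Fin (Fintype.card ι + 1), ∃ π,
      s / Λ ^ (2 * ((i : ℕ) + 1)) ∈ Ioo (ρ π / Λ) (Λ * ρ π) := by
    intro i
    have hi := i.2
    refine hcon _ ?_ ?_
    · exact div_le_div_of_nonneg_left hs.le (by positivity)
        (pow_le_pow_right₀ hΛ.le (by omega))
    · exact div_le_div_of_nonneg_left hs.le (by positivity)
        (pow_le_pow_right₀ hΛ.le (by omega))
  choose f hf using h
  obtain ⟨i, j, hij, hfij⟩ := Fintype.exists_ne_map_eq_of_card_lt f (by simp)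
  wlog hlt : i < j generalizing i j
  · exact this j i hij.symm hfij.symm (lt_of_le_of_ne (not_lt.1 hlt) hij.symm)
  have h1 := (hf i).2
  have h2 := (hf j).1
  rw [hfij] at h1
  have h3 : s / Λ ^ (2 * ((j : ℕ) + 1)) * Λ ^ 2 ≤ s / Λ ^ (2 * ((i : ℕ) + 1)) := by
    rw [div_mul_eq_mul_div, div_le_div_iff₀ (by positivity) (by positivity), mul_assoc, ← pow_add]
    have : (i : ℕ) < j := hlt
    exact mul_le_mul_of_nonneg_left (pow_le_pow_right₀ hΛ.le (by omega)) hs.le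
  rw [div_lt_iff₀ hΛ0] at h2
  have h4 : Λ * ρ (f j) < Λ * (s / Λ ^ (2 * ((j : ℕ) + 1)) * Λ) :=
    mul_lt_mul_of_pos_left h2 hΛ0
  nlinarith

/-! ### Changes of variable in the parameter -/

/-- The triple `p` in the parameter `s`, where `t = b + e s`. -/
noncomputable def shift (e b : ℝ) (p : Fin 3 → ℝ[X]) : Fin 3 → ℝ[X] :=
  fun i => (p i).comp (C b + C e * X)

theorem natDegree_shift_le {N : ℕ} (e b : ℝ) {p : Fin 3 → ℝ[X]}
    (hp : ∀ i, (p i).natDegree ≤ N) (i : Fin 3) : (shift e b p i).natDegree ≤ N := by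
  have h1 : ((p i).comp (C b + C e * X)).natDegree ≤
    (p i).natDegree * (C b + C e * X : ℝ[X]).natDegree := natDegree_comp_le
  have h2 : (C b + C e * X : ℝ[X]).natDegree ≤ 1 := by
    rw [add_comm]; exact natDegree_linear_le
  have h3 := hp i
  exact h1.trans (by nlinarith)

theorem alternant_shift (e b : ℝ) (p : Fin 3 → ℝ[X]) (x y z : ℝ) :
    alternant (shift e b p) x y z = alternant p (b + e * x) (b + e * y) (b + e * z) := by
  simp [alternant_eq, shift, eval_comp]

theorem wron_shift (e b : ℝ) (p : Fin 3 → ℝ[X]) :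
    wron (shift e b p) = C (e ^ 3) * (wron p).comp (C b + C e * X) := by
  simp only [wron_eq, shift, derivative_comp, derivative_add, derivative_C, derivative_mul,
    derivative_X, zero_mul, mul_one, zero_add, sub_comp, add_comp, mul_comp, C_pow]
  ring

theorem eval_wron_shift (e b : ℝ) (p : Fin 3 → ℝ[X]) (x : ℝ) :
    (wron (shift e b p)).eval x = e ^ 3 * (wron p).eval (b + e * x) := by
  simp [wron_shift, eval_comp]

theorem abs_wron_shift {e : ℝ} (he : e = 1 ∨ e = -1) (b : ℝ) (p : Fin 3 → ℝ[X]) (x : ℝ) :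
    |(wron (shift e b p)).eval x| = |(wron p).eval (b + e * x)| := by
  rw [eval_wron_shift, abs_mul]
  rcases he with rfl | rfl <;> simp

theorem alternant_reverse (p : Fin 3 → ℝ[X]) (x y z : ℝ) :
    alternant p z y x = -alternant p x y z := by
  simp only [alternant_eq]; ring

theorem GeomIneq.of_shift {c e b : ℝ} (he : e = 1 ∨ e = -1) {p : Fin 3 → ℝ[X]} {K : Set ℝ}
    (h : GeomIneq c (shift e b p) K) : GeomIneq c p {t | e * (t - b) ∈ K} := by
  obtain ⟨σ, h⟩ := h
  have hback : ∀ t, b + e * (e * (t - b)) = t := by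
    intro t; rcases he with rfl | rfl <;> ring
  rcases he with rfl | rfl
  · refine ⟨σ, fun x hx y hy z hz hxy hyz => ?_⟩
    have := h _ hx _ hy _ hz (by linarith) (by linarith)
    simp only [alternant_shift, eval_wron_shift, hback] at this
    refine ⟨this.1, ?_⟩
    convert this.2 using 2
    · congr 2; ring
    · congr 1; ring
  · refine ⟨-σ, fun x hx y hy z hz hxy hyz => ?_⟩
    have := h _ hz _ hy _ hx (by linarith) (by linarith)
    simp only [alternant_shift, eval_wron_shift, hback] at this
    rw [alternant_reverse p x y z] at this
    refine ⟨by linarith [this.1], ?_⟩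
    rw [abs_neg] at this
    convert this.2 using 2
    · congr 1
      rw [← abs_neg]
      congr 1; ring
    · congr 1; ring

theorem GeomIneq.mono {c : ℝ} {p : Fin 3 → ℝ[X]} {K K' : Set ℝ} (h : GeomIneq c p K)
    (hK : K' ⊆ K) : GeomIneq c p K' := by
  obtain ⟨σ, h⟩ := h
  exact ⟨σ, fun x hx y hy z hz => h x (hK hx) y (hK hy) z (hK hz)⟩

theorem GeomIneq.mono_const {c c' : ℝ} {p : Fin 3 → ℝ[X]} {K : Set ℝ} (h : GeomIneq c p K)
    (hc : c' ≤ c) : GeomIneq c' p K := by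
  obtain ⟨σ, h⟩ := h
  refine ⟨σ, fun x hx y hy z hz hxy hyz => ⟨(h x hx y hy z hz hxy hyz).1, ?_⟩⟩
  refine le_trans ?_ (h x hx y hy z hz hxy hyz).2
  have : 0 ≤ (y - x) * (z - y) * (z - x) :=
    mul_nonneg (mul_nonneg (by linarith) (by linarith)) (by linarith)
  gcongr

theorem eval_zero_wron (p : Fin 3 → ℝ[X]) :
    (wron p).eval 0 = 2 * coeffMinor p ![0, 1, 2] := by
  have h1 : ∀ q : ℝ[X], (derivative (derivative q)).eval 0 = 2 * q.coeff 2 := by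
    intro q
    rw [← coeff_zero_eq_eval_zero, coeff_derivative, coeff_derivative]
    norm_num; ring
  have h2 : ∀ q : ℝ[X], (derivative q).eval 0 = q.coeff 1 := by
    intro q
    rw [← coeff_zero_eq_eval_zero, coeff_derivative]
    norm_num
  simp only [wron_eq, eval_sub, eval_add, eval_mul, h1, h2, ← coeff_zero_eq_eval_zero,
    coeffMinor, Matrix.det_fin_three, Matrix.of_apply, Matrix.cons_val]
  ring

theorem sum_le_of_coeffMinor_ne_zero {p : Fin 3 → ℝ[X]} {κ : Fin 3 → ℕ}
    (h : coeffMinor p κ ≠ 0) : 3 ≤ ∑ j, κ j := by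
  have hinj : Function.Injective κ := by
    intro i j hij
    by_contra hne
    exact h (Matrix.det_zero_of_column_eq hne fun k => by simp [hij])
  have h01 : κ 0 ≠ κ 1 := fun h => absurd (hinj h) (by decide)
  have h02 : κ 0 ≠ κ 2 := fun h => absurd (hinj h) (by decide)
  have h12 : κ 1 ≠ κ 2 := fun h => absurd (hinj h) (by decide)
  rw [Fin.sum_univ_three]
  omega

/-- Near a point where the Wronskian `L` is doubling at the scale `s`, the geometric inequality
holds on an interval of length comparable to `s`: at a scale where a minor of the Taylor
coefficients dominates, `|L|` would be too small at the centre unless that minor is the one of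
the columns `0, 1, 2`. -/
theorem geomIneq_near_doubling_point (N : ℕ) (D : ℝ) :
    ∃ c δ : ℝ, 0 < c ∧ 0 < δ ∧ δ ≤ 1 ∧ ∀ (p : Fin 3 → ℝ[X]) (t s : ℝ),
      (∀ i, (p i).natDegree ≤ N) → (wron p).eval t ≠ 0 → 0 < s →
      (∀ u ∈ Icc 0 (s / 2), |(wron p).eval (t + u)| ≤ D * |(wron p).eval t|) →
      GeomIneq c p (Ioc t (t + δ * s)) := by
  obtain ⟨c, hc, hgeom⟩ := geomIneq_of_dominant N
  set Λ : ℝ := max ((tol N)⁻¹) (max 2 (4 * D + 1)) with hΛ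
  have hΛ2 : 2 ≤ Λ := (le_max_left _ _).trans (le_max_right _ _)
  have hΛD : 4 * D < Λ := lt_of_lt_of_le (by linarith)
    ((le_max_right 2 (4 * D + 1)).trans (le_max_right _ _))
  have hΛt : Λ⁻¹ ≤ tol N := inv_le_of_inv_le₀ (tol_pos N) (le_max_left _ _)
  have hΛ0 : 0 < Λ := by linarith
  set P := Fintype.card ((Fin 3 → Fin (N + 1)) × (Fin 3 → Fin (N + 1))) with hP
  have hpow : 1 ≤ Λ ^ (2 * (P + 1)) := one_le_pow₀ (by linarith)
  refine ⟨c, 1 / Λ ^ (2 * (P + 1)), hc, by positivity, ?_, ?_⟩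
  · rw [div_le_one (by positivity)]; exact hpow
  intro p t s hp hLt hs hdouble
  set q := shift 1 t p with hq
  have hqN : ∀ i, (q i).natDegree ≤ N := natDegree_shift_le 1 t hp
  have hwq : ∀ u, (wron q).eval u = (wron p).eval (t + u) := by
    intro u; rw [hq, eval_wron_shift]; simp
  have hw0 : wron q ≠ 0 := by
    intro h0
    apply hLt
    have := hwq 0
    rw [h0, eval_zero, add_zero] at this
    exact this.symm
  obtain ⟨ρ, -, hρ⟩ := exists_scales hqN hw0
  obtain ⟨r, hr1, hr2, hr3⟩ := exists_good_scale ρ (by linarith : 1 < Λ) hs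
  have hr0 : 0 < r := lt_of_lt_of_le (by positivity) hr1
  obtain ⟨κ, hκ, hdom⟩ := hρ Λ r (by linarith) hr0 hr3
  have hrs : r ≤ s / 2 := by
    refine hr2.trans (div_le_div_of_nonneg_left hs.le (by norm_num) ?_)
    nlinarith
  have hκN : ∀ j, (κ j : ℕ) ≤ N := fun j => by have := (κ j).2; omega
  have hm0 : |(wron p).eval t| = 2 * |coeffMinor q ![0, 1, 2]| := by
    have := eval_zero_wron q
    rw [hwq, add_zero] at this
    rw [this, abs_mul, abs_two]
  have hmpos : 0 < |coeffMinor q ![0, 1, 2]| := by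
    have : 0 < |(wron p).eval t| := abs_pos.2 hLt
    linarith
  have hsum : ∑ j, (κ j : ℕ) = 3 := by
    by_contra hne
    have h012 : ∀ j : Fin 3, (![0, 1, 2] : Fin 3 → ℕ) j ≤ N := by
      have h0 : (κ 0 : ℕ) < κ 1 := hκ (by decide)
      have h1 : (κ 1 : ℕ) < κ 2 := hκ (by decide)
      have h2 := hκN 2
      intro j; fin_cases j <;> simp <;> omega
    have hsum012 : ∑ j, (![0, 1, 2] : Fin 3 → ℕ) j = 3 := by simp [Fin.sum_univ_three]
    have h1 := hdom.2 ![0, 1, 2] h012 (by rw [hsum012]; exact fun h => hne h.symm)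
    have h2 := hdom.le_wron (by positivity) hΛt hqN hκ (hκN 2) hr0
    have h3 := hdouble r ⟨hr0.le, hrs⟩
    rw [hsum012] at h1
    rw [hwq] at h2
    have hr3 : 0 < r ^ 3 := by positivity
    have h4 : Λ * (|coeffMinor q ![0, 1, 2]| * r ^ 3) ≤
        2 * (r ^ 3 * (D * (2 * |coeffMinor q ![0, 1, 2]|))) := by
      rw [inv_mul_eq_div, le_div_iff₀ hΛ0] at h1
      rw [hm0] at h3
      calc _ = |coeffMinor q ![0, 1, 2]| * r ^ 3 * Λ := by ring
        _ ≤ _ := h1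
        _ ≤ _ := h2
        _ ≤ _ := by gcongr
    have h5 : 0 < |coeffMinor q ![0, 1, 2]| * r ^ 3 := by positivity
    nlinarith
  have hdom' : ∀ u ∈ Ioc 0 r, IsDominant N Λ⁻¹ q (fun j => κ j) u := by
    intro u hu
    refine ⟨hdom.1, fun κ' hκ' hne => ?_⟩
    by_cases h0 : coeffMinor q κ' = 0
    · rw [h0, abs_zero, zero_mul]
      have := hu.1
      positivity
    have h3 := sum_le_of_coeffMinor_ne_zero h0
    have h4 := hdom.2 κ' hκ' hne
    rw [hsum] at h4 hne ⊢
    obtain ⟨d, hd⟩ : ∃ d, ∑ j, κ' j = 3 + d := ⟨∑ j, κ' j - 3, by omega⟩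
    rw [hd] at h4 ⊢
    rw [pow_add] at h4 ⊢
    have h5 : |coeffMinor q κ'| * r ^ d ≤ Λ⁻¹ * |coeffMinor q fun j => ↑(κ j)| := by
      refine le_of_mul_le_mul_right ?_ (pow_pos hr0 3)
      linarith
    have h6 : u ^ d ≤ r ^ d := pow_le_pow_left₀ hu.1.le hu.2 _
    calc |coeffMinor q κ'| * (u ^ 3 * u ^ d) = (|coeffMinor q κ'| * u ^ d) * u ^ 3 := by ring
      _ ≤ (|coeffMinor q κ'| * r ^ d) * u ^ 3 := by
          have := pow_pos hu.1 3
          gcongr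
      _ ≤ (Λ⁻¹ * |coeffMinor q fun j => ↑(κ j)|) * u ^ 3 :=
          mul_le_mul_of_nonneg_right h5 (pow_pos hu.1 3).le
      _ = _ := by ring
  have := hgeom q (fun j => κ j) Λ⁻¹ (Ioc 0 r) hqN hκ (hκN 2) (by positivity) hΛt
    ordConnected_Ioc (fun u hu => hu.1) hdom'
  refine (GeomIneq.of_shift (Or.inl rfl) this).mono fun u hu => ?_
  refine ⟨by linarith [hu.1], ?_⟩
  have h1 := hu.2
  have h2 : 1 / Λ ^ (2 * (P + 1)) * s = s / Λ ^ (2 * (P + 1)) := by ring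
  rw [h2] at h1
  linarith

/-! ### Decomposition of the line -/

/-- `A` is covered by at most `M` sets with the property `G`. -/
def CoveredBy (G : Set ℝ → Prop) (M : ℕ) (A : Set ℝ) : Prop :=
  ∃ 𝒦 : Finset (Set ℝ), 𝒦.card ≤ M ∧ (∀ K ∈ 𝒦, G K) ∧ A ⊆ ⋃ K ∈ 𝒦, K

theorem CoveredBy.of_self {G : Set ℝ → Prop} {A : Set ℝ} (h : G A) : CoveredBy G 1 A :=
  ⟨{A}, by simp, by simpa using h, by simp⟩

theorem CoveredBy.empty {G : Set ℝ → Prop} (M : ℕ) : CoveredBy G M ∅ :=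
  ⟨∅, by simp, by simp, by simp⟩

theorem CoveredBy.mono {G : Set ℝ → Prop} {M M' : ℕ} {A A' : Set ℝ} (h : CoveredBy G M A)
    (hM : M ≤ M') (hA : A' ⊆ A) : CoveredBy G M' A' := by
  obtain ⟨𝒦, h1, h2, h3⟩ := h
  exact ⟨𝒦, h1.trans hM, h2, hA.trans h3⟩

theorem CoveredBy.biUnion {ι : Type*} {G : Set ℝ → Prop} {m : ℕ} (s : Finset ι)
    {A : ι → Set ℝ} (h : ∀ i ∈ s, CoveredBy G m (A i)) :
    CoveredBy G (s.card * m) (⋃ i ∈ s, A i) := by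
  classical
  have h' : ∀ i, ∃ 𝒦 : Finset (Set ℝ), i ∈ s →
      𝒦.card ≤ m ∧ (∀ K ∈ 𝒦, G K) ∧ A i ⊆ ⋃ K ∈ 𝒦, K := by
    intro i
    by_cases hi : i ∈ s
    · obtain ⟨𝒦, h⟩ := h i hi; exact ⟨𝒦, fun _ => h⟩
    · exact ⟨∅, fun h => absurd h hi⟩
  choose 𝒦 h𝒦 using h'
  refine ⟨s.biUnion 𝒦, Finset.card_biUnion_le_card_mul _ _ _ fun i hi => (h𝒦 i hi).1, ?_, ?_⟩
  · intro K hK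
    obtain ⟨i, hi, hK⟩ := Finset.mem_biUnion.1 hK
    exact (h𝒦 i hi).2.1 K hK
  · refine iUnion₂_subset fun i hi => (h𝒦 i hi).2.2.trans ?_
    exact iUnion₂_subset fun K hK =>
      subset_biUnion_of_mem (u := id) (Finset.mem_biUnion.2 ⟨i, hi, hK⟩)

theorem CoveredBy.iUnion {ι : Type*} [Fintype ι] {G : Set ℝ → Prop} {m : ℕ}
    {A : ι → Set ℝ} (h : ∀ i, CoveredBy G m (A i)) :
    CoveredBy G (Fintype.card ι * m) (⋃ i, A i) := by
  have := CoveredBy.biUnion (Finset.univ : Finset ι) (A := A) fun i _ => h i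
  simpa using this

theorem CoveredBy.union {G : Set ℝ → Prop} {m n : ℕ} {A B : Set ℝ} (hA : CoveredBy G m A)
    (hB : CoveredBy G n B) : CoveredBy G (m + n) (A ∪ B) := by
  classical
  obtain ⟨𝒦, h1, h2, h3⟩ := hA
  obtain ⟨𝒦', h1', h2', h3'⟩ := hB
  refine ⟨𝒦 ∪ 𝒦', (Finset.card_union_le _ _).trans (by omega), ?_, ?_⟩
  · intro K hK
    rcases Finset.mem_union.1 hK with h | h
    exacts [h2 K h, h2' K h]
  · refine union_subset (h3.trans ?_) (h3'.trans ?_)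
    · exact iUnion₂_subset fun K hK =>
        subset_biUnion_of_mem (u := id) (Finset.mem_union_left _ hK)
    · exact iUnion₂_subset fun K hK =>
        subset_biUnion_of_mem (u := id) (Finset.mem_union_right _ hK)

theorem CoveredBy.preimage {G G' : Set ℝ → Prop} {M : ℕ} {A : Set ℝ} (f : ℝ → ℝ)
    (h : CoveredBy G M A) (hG : ∀ K, G K → G' (f ⁻¹' K)) : CoveredBy G' M (f ⁻¹' A) := by
  classical
  obtain ⟨𝒦, h1, h2, h3⟩ := h
  refine ⟨𝒦.image (f ⁻¹' ·), Finset.card_image_le.trans h1, ?_, ?_⟩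
  · intro K hK
    obtain ⟨K', hK', rfl⟩ := Finset.mem_image.1 hK
    exact hG _ (h2 _ hK')
  · intro t ht
    obtain ⟨K, hK, htK⟩ := mem_iUnion₂.1 (h3 ht)
    exact mem_iUnion₂.2 ⟨f ⁻¹' K, Finset.mem_image.2 ⟨K, hK, rfl⟩, htK⟩

/-- An interval on which the geometric inequality holds and on which the absolute value of the
Wronskian is monotone, with a finite end point on the side where it is small. -/
structure IsGood (c : ℝ) (p : Fin 3 → ℝ[X]) (K : Set ℝ) : Prop where
  ordConnected : K.OrdConnected
  geomIneq : GeomIneq c p K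
  monotone : (MonotoneOn (fun t => |(wron p).eval t|) K ∧ BddBelow K) ∨
    (AntitoneOn (fun t => |(wron p).eval t|) K ∧ BddAbove K)

theorem IsGood.of_shift {c e b : ℝ} (he : e = 1 ∨ e = -1) {p : Fin 3 → ℝ[X]} {K : Set ℝ}
    (h : IsGood c (shift e b p) K) : IsGood c p ((fun t => e * (t - b)) ⁻¹' K) := by
  have hback : ∀ t, b + e * (e * (t - b)) = t := by
    intro t; rcases he with rfl | rfl <;> ring
  have hw : ∀ t, |(wron p).eval t| = |(wron (shift e b p)).eval (e * (t - b))| := by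
    intro t; rw [abs_wron_shift he, hback]
  refine ⟨⟨fun x hx y hy z hz => ?_⟩, h.geomIneq.of_shift he, ?_⟩
  · rcases he with rfl | rfl
    · exact h.ordConnected.out hx hy ⟨by linarith [hz.1], by linarith [hz.2]⟩
    · exact h.ordConnected.out hy hx ⟨by linarith [hz.2], by linarith [hz.1]⟩
  · simp only [hw]
    rcases he with rfl | rfl
    · rcases h.monotone with ⟨h1, B, h2⟩ | ⟨h1, B, h2⟩
      · exact Or.inl ⟨fun x hx y hy hxy => h1 hx hy (by linarith),
          B + b, fun x hx => by linarith [h2 hx]⟩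
      · exact Or.inr ⟨fun x hx y hy hxy => h1 hx hy (by linarith),
          B + b, fun x hx => by linarith [h2 hx]⟩
    · rcases h.monotone with ⟨h1, B, h2⟩ | ⟨h1, B, h2⟩
      · exact Or.inr ⟨fun x hx y hy hxy => h1 hy hx (by linarith),
          b - B, fun x hx => by linarith [h2 hx]⟩
      · exact Or.inl ⟨fun x hx y hy hxy => h1 hy hx (by linarith),
          b - B, fun x hx => by linarith [h2 hx]⟩

theorem abs_monotoneOn_or_antitoneOn {f : ℝ[X]} {Z : Set ℝ} (hZ : Convex ℝ Z)
    (h : ∀ s ∈ Z, f.eval s ≠ 0 ∧ (derivative f = 0 ∨ (derivative f).eval s ≠ 0)) :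
    MonotoneOn (fun s => |f.eval s|) Z ∨ AntitoneOn (fun s => |f.eval s|) Z := by
  by_cases hd : derivative f = 0
  · left
    intro x _ y _ _
    rw [eq_C_of_derivative_eq_zero hd]; simp
  have h' : ∀ s ∈ Z, (f * derivative f).eval s ≠ 0 := by
    intro s hs
    rw [eval_mul]
    exact mul_ne_zero (h s hs).1 ((h s hs).2.resolve_left hd)
  have hsq : ∀ s, HasDerivAt (fun s => f.eval s ^ 2) (2 * (f * derivative f).eval s) s := by
    intro s
    refine ((f.hasDerivAt s).pow 2).congr_deriv ?_
    rw [eval_mul]; push_cast; ring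
  have hcont : ContinuousOn (fun s => (f * derivative f).eval s) Z :=
    (Polynomial.continuous _).continuousOn
  have hsign : (∀ s ∈ Z, 0 ≤ (f * derivative f).eval s) ∨
      (∀ s ∈ Z, (f * derivative f).eval s ≤ 0) := by
    by_contra hcon
    push Not at hcon
    obtain ⟨⟨a, ha, ha0⟩, ⟨b, hb, hb0⟩⟩ := hcon
    obtain ⟨s, hs, hs0⟩ := hZ.isPreconnected.intermediate_value ha hb hcont ⟨ha0.le, hb0.le⟩
    exact h' s hs hs0
  have hcont2 : ContinuousOn (fun s => f.eval s ^ 2) Z :=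
    ((Polynomial.continuous _).pow 2).continuousOn
  rcases hsign with hs | hs
  · left
    have := monotoneOn_of_deriv_nonneg hZ hcont2
      (fun s _ => (hsq s).differentiableAt.differentiableWithinAt)
      (fun s hs' => by rw [(hsq s).deriv]; linarith [hs s (interior_subset hs')])
    exact fun x hx y hy hxy => sq_le_sq.1 (this hx hy hxy)
  · right
    have := antitoneOn_of_deriv_nonpos hZ hcont2
      (fun s _ => (hsq s).differentiableAt.differentiableWithinAt)
      (fun s hs' => by rw [(hsq s).deriv]; linarith [hs s (interior_subset hs')])
    exact fun x hx y hy hxy => sq_le_sq.1 (this hx hy hxy)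

theorem natDegree_wron_le {N : ℕ} {p : Fin 3 → ℝ[X]} (hp : ∀ i, (p i).natDegree ≤ N) :
    (wron p).natDegree ≤ 3 * N := by
  rw [wron, Matrix.det_apply]
  refine natDegree_sum_le_of_forall_le _ _ fun σ _ => ?_
  refine (natDegree_smul_le _ _).trans ((natDegree_prod_le _ _).trans ?_)
  calc ∑ i : Fin 3, (Matrix.of (fun i j : Fin 3 => derivative^[(j : ℕ)] (p i)) (σ i) i).natDegree
      ≤ ∑ _i : Fin 3, N := Finset.sum_le_sum fun i _ =>
        ((natDegree_iterate_derivative _ _).trans (Nat.sub_le _ _)).trans (hp _)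
    _ = 3 * N := by simp

/-- The points `s > 0` such that `(0, 2 s)` contains no root of `f` and, unless `f` is constant,
no root of `f'`. -/
def rootFree (f : ℝ[X]) : Set ℝ :=
  {s | 0 < s ∧ ∀ u ∈ Ioo 0 (2 * s), f.eval u ≠ 0 ∧
    (derivative f = 0 ∨ (derivative f).eval u ≠ 0)}

theorem mem_rootFree_of_le {f : ℝ[X]} {s t : ℝ} (hs : s ∈ rootFree f) (ht : 0 < t)
    (hts : t ≤ s) : t ∈ rootFree f :=
  ⟨ht, fun u hu => hs.2 u ⟨hu.1, by linarith [hu.2]⟩⟩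

theorem ordConnected_rootFree (f : ℝ[X]) : (rootFree f).OrdConnected :=
  ⟨fun _ hx _ hy _ hz => mem_rootFree_of_le hy (hx.1.trans_le hz.1) hz.2⟩

theorem monotoneOn_rootFree (f : ℝ[X]) :
    MonotoneOn (fun s => |f.eval s|) (rootFree f) ∨
      (AntitoneOn (fun s => |f.eval s|) (rootFree f) ∧ BddAbove (rootFree f)) := by
  have h := abs_monotoneOn_or_antitoneOn (f := f) (ordConnected_rootFree f).convex
    fun s hs => hs.2 s ⟨hs.1, by linarith [hs.1]⟩
  rcases h with h | h
  · exact Or.inl h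
  by_cases hb : BddAbove (rootFree f)
  · exact Or.inr ⟨h, hb⟩
  -- a polynomial that is bounded at infinity is constant
  left
  have hall : ∀ s, 0 < s → s ∈ rootFree f := by
    intro s hs
    obtain ⟨t, ht, hst⟩ := not_bddAbove_iff.1 hb s
    exact mem_rootFree_of_le ht hs hst.le
  have hdeg := (Polynomial.isBoundedUnder_abs_atTop_iff f).1
    ⟨|f.eval 1|, by
      rw [Filter.eventually_map]
      filter_upwards [Filter.eventually_ge_atTop (1 : ℝ)] with s hs
      exact h (hall 1 one_pos) (hall s (by linarith)) hs⟩
  rw [eq_C_of_degree_le_zero hdeg]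
  intro x _ y _ _
  simp

theorem ordConnected_dominant (N : ℕ) (ε : ℝ) (hε : 0 ≤ ε) (p : Fin 3 → ℝ[X])
    (κ : Fin 3 → ℕ) : ({r | 0 < r ∧ IsDominant N ε p κ r} : Set ℝ).OrdConnected := by
  refine ⟨fun x hx y hy z hz => ⟨hx.1.trans_le hz.1, hx.2.1, fun κ' hκ' hne => ?_⟩⟩
  have hx0 := hx.1
  have hz0 : 0 < z := hx.1.trans_le hz.1
  have hy0 : 0 < y := hy.1
  have h1 := hx.2.2 κ' hκ' hne
  have h2 := hy.2.2 κ' hκ' hne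
  set a := |coeffMinor p κ'| with ha
  set b := |coeffMinor p κ| with hb
  have ha0 : 0 ≤ a := abs_nonneg _
  have hb0 : 0 ≤ b := abs_nonneg _
  rcases lt_or_gt_of_ne hne with hlt | hlt
  · obtain ⟨d, hd⟩ : ∃ d, ∑ j, κ j = ∑ j, κ' j + d := ⟨∑ j, κ j - ∑ j, κ' j, by omega⟩
    rw [hd, pow_add] at h1 ⊢
    have h3 : a ≤ ε * b * x ^ d := by
      refine le_of_mul_le_mul_right ?_ (pow_pos hx0 (∑ j, κ' j)); linarith
    have h4 : x ^ d ≤ z ^ d := pow_le_pow_left₀ hx0.le hz.1 _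
    calc a * z ^ (∑ j, κ' j) ≤ (ε * b * x ^ d) * z ^ (∑ j, κ' j) := by gcongr
      _ ≤ (ε * b * z ^ d) * z ^ (∑ j, κ' j) := by gcongr
      _ = _ := by ring
  · obtain ⟨d, hd⟩ : ∃ d, ∑ j, κ' j = ∑ j, κ j + d := ⟨∑ j, κ' j - ∑ j, κ j, by omega⟩
    rw [hd, pow_add] at h2 ⊢
    have h3 : a * y ^ d ≤ ε * b := by
      refine le_of_mul_le_mul_right ?_ (pow_pos hy0 (∑ j, κ j)); linarith
    have h4 : z ^ d ≤ y ^ d := pow_le_pow_left₀ hz0.le hz.2 _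
    calc a * (z ^ (∑ j, κ j) * z ^ d) = (a * z ^ d) * z ^ (∑ j, κ j) := by ring
      _ ≤ (a * y ^ d) * z ^ (∑ j, κ j) := by gcongr
      _ ≤ (ε * b) * z ^ (∑ j, κ j) := by gcongr
      _ = _ := by ring

/-- To the right of `0`, as long as `0` is the nearest point of a set containing the roots of
the Wronskian and of its derivative, the line is covered by boundedly many good intervals. -/
theorem exists_coveredBy_rootFree (N : ℕ) :
    ∃ (c : ℝ) (M : ℕ), 0 < c ∧ ∀ p : Fin 3 → ℝ[X], (∀ i, (p i).natDegree ≤ N) → wron p ≠ 0 →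
      CoveredBy (IsGood c p) M (rootFree (wron p)) := by
  obtain ⟨c₁, hc₁, hgeom⟩ := geomIneq_of_dominant N
  obtain ⟨D, hD1, hD⟩ := exists_doubling (3 * N)
  obtain ⟨c₂, δ, hc₂, hδ, hδ1, hnear⟩ := geomIneq_near_doubling_point N D
  set Λ : ℝ := max ((tol N)⁻¹) 2 with hΛ
  have hΛ2 : 2 ≤ Λ := le_max_right _ _
  have hΛ0 : 0 < Λ := by linarith
  have hΛt : Λ⁻¹ ≤ tol N := inv_le_of_inv_le₀ (tol_pos N) (le_max_left _ _)
  set q : ℝ := 1 + δ / 3 with hq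
  have hq1 : 1 < q := by rw [hq]; linarith
  have hq2 : q ^ 2 ≤ 1 + δ := by rw [hq]; nlinarith
  obtain ⟨n, hn⟩ := pow_unbounded_of_one_lt (Λ ^ 2) hq1
  refine ⟨min c₁ c₂, Fintype.card (Fin 3 → Fin (N + 1)) * 1 +
    Fintype.card ((Fin 3 → Fin (N + 1)) × (Fin 3 → Fin (N + 1))) * (Fintype.card (Fin n) * 1),
    lt_min hc₁ hc₂, fun p hp hw => ?_⟩
  obtain ⟨ρ, hρ0, hρ⟩ := exists_scales hp hw
  set Z := rootFree (wron p) with hZ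
  have hZc := ordConnected_rootFree (wron p)
  have hgood : ∀ K ⊆ Z, K.OrdConnected → GeomIneq (min c₁ c₂) p K → IsGood (min c₁ c₂) p K := by
    intro K hKZ hK hg
    refine ⟨hK, hg, ?_⟩
    rcases monotoneOn_rootFree (wron p) with h | ⟨h, hb⟩
    · exact Or.inl ⟨h.mono hKZ, 0, fun x hx => (hKZ hx).1.le⟩
    · exact Or.inr ⟨h.mono hKZ, hb.mono hKZ⟩
  have hcov1 : CoveredBy (IsGood (min c₁ c₂) p) (Fintype.card (Fin 3 → Fin (N + 1)) * 1)
      (⋃ κ : Fin 3 → Fin (N + 1), if StrictMono (fun j => (κ j : ℕ)) then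
        Z ∩ {r | 0 < r ∧ IsDominant N Λ⁻¹ p (fun j => κ j) r} else ∅) := by
    refine CoveredBy.iUnion fun κ => ?_
    split_ifs with hκ
    · have hoc := (ordConnected_dominant N Λ⁻¹ (by positivity) p (fun j => κ j))
      refine CoveredBy.of_self (hgood _ inter_subset_left (hZc.inter hoc) ?_)
      exact ((hgeom p (fun j => κ j) Λ⁻¹ _ hp hκ (by have := (κ 2).2; omega) (by positivity) hΛt
        hoc (fun r hr => hr.1) (fun r hr => hr.2)).mono inter_subset_right).mono_const
          (min_le_left _ _)
    · exact CoveredBy.empty 1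
  have hcov2 : CoveredBy (IsGood (min c₁ c₂) p)
      (Fintype.card ((Fin 3 → Fin (N + 1)) × (Fin 3 → Fin (N + 1))) * (Fintype.card (Fin n) * 1))
      (⋃ π, ⋃ i : Fin n, Z ∩ Ioc (ρ π / Λ * q ^ (i : ℕ) / q)
        (ρ π / Λ * q ^ (i : ℕ) / q + δ * (ρ π / Λ * q ^ (i : ℕ) / q))) := by
    refine CoveredBy.iUnion fun π => CoveredBy.iUnion fun i => ?_
    set s := ρ π / Λ * q ^ (i : ℕ) / q with hs
    have hs0 : 0 < s := by have := hρ0 π; positivity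
    rcases (Z ∩ Ioc s (s + δ * s)).eq_empty_or_nonempty with he | ⟨u, huZ, hu⟩
    · rw [he]; exact CoveredBy.empty 1
    refine CoveredBy.of_self (hgood _ inter_subset_left (hZc.inter ordConnected_Ioc) ?_)
    have hsZ : s ∈ Z := mem_rootFree_of_le huZ hs0 hu.1.le
    have hne : (wron p).eval s ≠ 0 := (hsZ.2 s ⟨hs0, by linarith⟩).1
    refine ((hnear p s s hp hne hs0 ?_).mono inter_subset_right).mono_const (min_le_right _ _)
    intro v hv
    -- `|L|` is monotone on `(0, 2 s)`, hence doubling at `s`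
    rcases abs_monotoneOn_or_antitoneOn (f := wron p) (convex_Ioo 0 (2 * s)) hsZ.2 with h | h
    · have hd := hD (wron p) (natDegree_wron_le hp) (s / 2) (s / 2) |(wron p).eval s|
        (fun x hx => h ⟨by nlinarith [hx.1], by nlinarith [hx.2]⟩ ⟨hs0, by linarith⟩
          (by nlinarith [hx.2])) (1 + 2 * v / s) ⟨by
            have : 0 ≤ 2 * v / s := div_nonneg (by linarith [hv.1]) hs0.le
            linarith, by
            have : 2 * v / s ≤ 1 := by rw [div_le_one hs0]; linarith [hv.2]
            linarith⟩
      have e : s / 2 + s / 2 * (1 + 2 * v / s) = s + v := by field_simp; ring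
      rwa [e] at hd
    · have h1 : |(wron p).eval (s + v)| ≤ |(wron p).eval s| :=
        h ⟨hs0, by linarith⟩ ⟨by linarith [hv.1], by linarith [hv.2]⟩ (by linarith [hv.1])
      have : 0 ≤ |(wron p).eval s| := abs_nonneg _
      nlinarith
  refine (hcov1.union hcov2).mono le_rfl fun r hr => ?_
  have hr0 : 0 < r := hr.1
  by_cases hout : ∀ π, r ∉ Ioo (ρ π / Λ) (Λ * ρ π)
  · left
    obtain ⟨κ, hκ, hdom⟩ := hρ Λ r (by linarith) hr0 hout
    refine mem_iUnion.2 ⟨κ, ?_⟩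
    rw [if_pos hκ]
    exact ⟨hr, hr0, hdom⟩
  · right
    push Not at hout
    obtain ⟨π, hπ⟩ := hout
    have hρπ := hρ0 π
    have hb0 : 0 < ρ π / Λ := by positivity
    obtain ⟨i, hi1, hi2⟩ := exists_nat_pow_near (x := r / (ρ π / Λ)) (y := q)
      (by rw [le_div_iff₀ hb0]; linarith [hπ.1]) hq1
    rw [le_div_iff₀ hb0] at hi1
    rw [div_lt_iff₀ hb0] at hi2
    have hin : i < n := by
      by_contra hni
      have h1 : q ^ n ≤ q ^ i := pow_le_pow_right₀ hq1.le (not_lt.1 hni)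
      have h2 : Λ ^ 2 * (ρ π / Λ) < q ^ i * (ρ π / Λ) :=
        mul_lt_mul_of_pos_right (lt_of_lt_of_le hn h1) hb0
      have h3 : Λ ^ 2 * (ρ π / Λ) = Λ * ρ π := by field_simp
      linarith [hπ.2]
    refine mem_iUnion₂.2 ⟨π, ⟨i, hin⟩, hr, ?_, ?_⟩
    · have hq0 : 0 < q := by linarith
      rw [div_lt_iff₀ hq0]
      have : r < r * q := lt_mul_of_one_lt_right hr0 hq1
      dsimp only
      linarith
    · dsimp only
      have hq0 : 0 < q := by linarith
      have hs0 : 0 < ρ π / Λ * q ^ i / q := by positivity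
      calc r ≤ q ^ (i + 1) * (ρ π / Λ) := hi2.le
        _ = q ^ 2 * (ρ π / Λ * q ^ i / q) := by rw [pow_succ]; field_simp
        _ ≤ (1 + δ) * (ρ π / Λ * q ^ i / q) := by gcongr
        _ = _ := by ring

/-- **Decomposition of the line.** Up to a finite set the line is covered by a bounded number of
good intervals: every point lies to the left or to the right of its nearest point in the set of
roots of the Wronskian and of its derivative. -/
theorem exists_coveredBy_compl (N : ℕ) :
    ∃ (c : ℝ) (M : ℕ), 0 < c ∧ ∀ p : Fin 3 → ℝ[X], (∀ i, (p i).natDegree ≤ N) → wron p ≠ 0 →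
      ∃ B : Finset ℝ, CoveredBy (IsGood c p) M (B : Set ℝ)ᶜ := by
  classical
  obtain ⟨c, M, hc, h⟩ := exists_coveredBy_rootFree N
  refine ⟨c, (1 + 3 * N + 3 * N) * (Fintype.card Bool * M), hc, fun p hp hw => ?_⟩
  set L := wron p with hL
  set B : Finset ℝ := {0} ∪ L.roots.toFinset ∪ (derivative L).roots.toFinset with hB
  have hLdeg : L.natDegree ≤ 3 * N := natDegree_wron_le hp
  have hBcard : B.card ≤ 1 + 3 * N + 3 * N := by
    refine (Finset.card_union_le _ _).trans (add_le_add ((Finset.card_union_le _ _).trans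
      (add_le_add (by simp) ?_)) ?_)
    · exact (Multiset.toFinset_card_le _).trans ((card_roots' L).trans hLdeg)
    · exact (Multiset.toFinset_card_le _).trans ((card_roots' _).trans
        ((natDegree_derivative_le L).trans (by omega)))
  refine ⟨B, ?_⟩
  set e : Bool → ℝ := fun s => if s then 1 else -1 with he
  have he' : ∀ s, e s = 1 ∨ e s = -1 := by intro s; cases s <;> simp [he]
  have hw' : ∀ s b, wron (shift (e s) b p) ≠ 0 := by
    intro s b h0
    refine hw (Polynomial.funext fun t => ?_)
    have h1 := abs_wron_shift (he' s) b p (e s * (t - b))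
    have h2 : b + e s * (e s * (t - b)) = t := by
      rcases he' s with h | h <;> rw [h] <;> ring
    rw [h0, h2, eval_zero, abs_zero] at h1
    rw [eval_zero]
    exact abs_eq_zero.1 h1.symm
  have hcov : CoveredBy (IsGood c p) (B.card * (Fintype.card Bool * M))
      (⋃ b ∈ B, ⋃ s : Bool,
        (fun t => e s * (t - b)) ⁻¹' rootFree (wron (shift (e s) b p))) := by
    refine CoveredBy.biUnion _ fun b _ => CoveredBy.iUnion fun s => ?_
    exact (h _ (natDegree_shift_le (e s) b hp) (hw' s b)).preimage _
      fun K hK => hK.of_shift (he' s)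
  refine hcov.mono (Nat.mul_le_mul_right _ hBcard) fun t ht => ?_
  have hBne : B.Nonempty := ⟨0, by simp [hB]⟩
  obtain ⟨b, hb, hmin⟩ := Finset.exists_min_image B (fun b => |t - b|) hBne
  have htb : t ≠ b := fun h => ht (by rw [h]; exact hb)
  obtain ⟨s, hs⟩ : ∃ s, e s * (t - b) = |t - b| := by
    rcases le_total 0 (t - b) with h0 | h0
    · exact ⟨true, by simp [he, abs_of_nonneg h0]⟩
    · exact ⟨false, by simp [he, abs_of_nonpos h0]⟩
  refine mem_iUnion₂.2 ⟨b, hb, mem_iUnion.2 ⟨s, ?_⟩⟩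
  change e s * (t - b) ∈ rootFree (wron (shift (e s) b p))
  rw [hs]
  have hpos : 0 < |t - b| := abs_pos.2 (sub_ne_zero.2 htb)
  have hnotB : ∀ u ∈ Ioo 0 (2 * |t - b|), b + e s * u ∉ B := by
    intro u hu hmem
    have h1 := hmin _ hmem
    have h2 : |t - (b + e s * u)| < |t - b| := by
      have h3 : t - (b + e s * u) = e s * (|t - b| - u) := by
        have : t - b = e s * |t - b| := by
          rw [← hs]; rcases he' s with h | h <;> rw [h] <;> ring
        linear_combination this
      have h4 : |e s| = 1 := by rcases he' s with h | h <;> simp [h]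
      rw [h3, abs_mul, h4, one_mul, abs_lt]
      constructor <;> linarith [hu.1, hu.2]
    linarith
  have hee : e s ≠ 0 := by rcases he' s with h | h <;> simp [h]
  have hder : derivative (wron (shift (e s) b p)) =
      C (e s ^ 4) * (derivative L).comp (C b + C (e s) * X) := by
    rw [wron_shift, derivative_C_mul, derivative_comp]
    simp only [derivative_add, derivative_C, derivative_mul, derivative_X, zero_mul, mul_one,
      zero_add, C_pow]
    ring
  refine ⟨hpos, fun u hu => ⟨?_, ?_⟩⟩
  · intro h0
    have h1 := abs_wron_shift (he' s) b p u
    rw [h0, abs_zero] at h1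
    refine hnotB u hu ?_
    have : L.IsRoot (b + e s * u) := abs_eq_zero.1 h1.symm
    simp only [hB, Finset.mem_union, Multiset.mem_toFinset]
    exact Or.inl (Or.inr ((mem_roots hw).2 this))
  · by_cases hd : derivative L = 0
    · left; rw [hder, hd]; simp
    right
    intro h0
    refine hnotB u hu ?_
    rw [hder, eval_mul, eval_C, mul_eq_zero] at h0
    have h1 := h0.resolve_left (pow_ne_zero _ hee)
    rw [eval_comp] at h1
    have : (derivative L).IsRoot (b + e s * u) := by simpa using h1
    simp only [hB, Finset.mem_union, Multiset.mem_toFinset]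
    exact Or.inr ((mem_roots hd).2 this)

/-! ### The weight as a change of variable -/

/-- The density `|L| ^ {1/6}`. -/
noncomputable def wt (L : ℝ[X]) (t : ℝ) : ℝ := |L.eval t| ^ ((1 : ℝ) / 6)

theorem continuous_wt (L : ℝ[X]) : Continuous (wt L) :=
  (Polynomial.continuous L).abs.rpow_const fun _ => Or.inr (by norm_num)

theorem wt_nonneg (L : ℝ[X]) (t : ℝ) : 0 ≤ wt L t := Real.rpow_nonneg (abs_nonneg _) _

theorem wt_le_wt {L : ℝ[X]} {s t : ℝ} (h : |L.eval s| ≤ |L.eval t|) : wt L s ≤ wt L t :=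
  Real.rpow_le_rpow (abs_nonneg _) h (by norm_num)

theorem wt_pow_six (L : ℝ[X]) (t : ℝ) : wt L t ^ 6 = |L.eval t| := by
  rw [wt, ← Real.rpow_natCast, ← Real.rpow_mul (abs_nonneg _)]
  norm_num

/-- The measure `|L| ^ {1/6} dt`. -/
noncomputable def wtMeasure (L : ℝ[X]) : Measure ℝ :=
  volume.withDensity fun t => ENNReal.ofReal (wt L t)

theorem measurable_ofReal_wt (L : ℝ[X]) : Measurable fun t => ENNReal.ofReal (wt L t) :=
  (continuous_wt L).measurable.ennreal_ofReal

/-- A primitive of the density. -/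
noncomputable def wtPrim (L : ℝ[X]) (a t : ℝ) : ℝ := ∫ s in a..t, wt L s

theorem wtPrim_sub (L : ℝ[X]) (a s t : ℝ) :
    wtPrim L a t - wtPrim L a s = ∫ r in s..t, wt L r := by
  unfold wtPrim
  rw [intervalIntegral.integral_interval_sub_left] <;>
    exact (continuous_wt L).intervalIntegrable _ _

theorem monotone_wtPrim (L : ℝ[X]) (a : ℝ) : Monotone (wtPrim L a) := by
  intro s t hst
  have : 0 ≤ wtPrim L a t - wtPrim L a s := by
    rw [wtPrim_sub]
    exact intervalIntegral.integral_nonneg hst fun r _ => wt_nonneg L r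
  linarith

theorem continuous_wtPrim (L : ℝ[X]) (a : ℝ) : Continuous (wtPrim L a) :=
  intervalIntegral.continuous_primitive (fun _ _ => (continuous_wt L).intervalIntegrable _ _) a

theorem wtMeasure_Icc (L : ℝ[X]) (a : ℝ) {s t : ℝ} (hst : s ≤ t) :
    wtMeasure L (Icc s t) = ENNReal.ofReal (wtPrim L a t - wtPrim L a s) := by
  rw [wtMeasure, withDensity_apply _ measurableSet_Icc, wtPrim_sub,
    intervalIntegral.integral_of_le hst, ← integral_Icc_eq_integral_Ioc,
    ofReal_integral_eq_lintegral_ofReal]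
  · exact (continuous_wt L).continuousOn.integrableOn_Icc
  · exact Filter.Eventually.of_forall fun r => wt_nonneg L r

/-- In the variable `u = ∫ wt`, the measure `wtMeasure` is dominated by Lebesgue measure: this is
the only property of the new variable needed to remove exceptional parameters. -/
theorem wtMeasure_abs_sub_le (L : ℝ[X]) (a v δ : ℝ) :
    wtMeasure L {t | |wtPrim L a t - v| ≤ δ} ≤ ENNReal.ofReal (2 * δ) := by
  set S := {t | |wtPrim L a t - v| ≤ δ} with hS
  have hSc : IsClosed S :=
    isClosed_le ((continuous_wtPrim L a).sub continuous_const).abs continuous_const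
  have hU : S = ⋃ n : ℕ, S ∩ Icc (-(n : ℝ)) n := by
    rw [← inter_iUnion]
    have : (⋃ n : ℕ, Icc (-(n : ℝ)) n) = univ := by
      refine eq_univ_of_forall fun t => ?_
      obtain ⟨n, hn⟩ := exists_nat_ge |t|
      exact mem_iUnion.2 ⟨n, abs_le.1 hn⟩
    rw [this, inter_univ]
  have hmono : Monotone fun n : ℕ => S ∩ Icc (-(n : ℝ)) n := by
    intro m n hmn
    have : (m : ℝ) ≤ n := by exact_mod_cast hmn
    exact inter_subset_inter_right _ (Icc_subset_Icc (by linarith) this)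
  rw [hU, hmono.measure_iUnion]
  refine iSup_le fun n => ?_
  have hc : IsCompact (S ∩ Icc (-(n : ℝ)) n) := isCompact_Icc.inter_left hSc
  rcases (S ∩ Icc (-(n : ℝ)) n).eq_empty_or_nonempty with he | hne
  · rw [he]; simp
  obtain ⟨x, hx, hxmin⟩ := hc.exists_isMinOn hne continuousOn_id
  obtain ⟨y, hy, hymax⟩ := hc.exists_isMaxOn hne continuousOn_id
  have hxy : x ≤ y := hymax hx
  calc wtMeasure L (S ∩ Icc (-(n : ℝ)) n) ≤ wtMeasure L (Icc x y) :=
        measure_mono fun t ht => ⟨hxmin ht, hymax ht⟩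
    _ = ENNReal.ofReal (wtPrim L a y - wtPrim L a x) := wtMeasure_Icc L a hxy
    _ ≤ ENNReal.ofReal (2 * δ) := by
        refine ENNReal.ofReal_le_ofReal ?_
        have h1 := abs_le.1 (show |wtPrim L a x - v| ≤ δ from hx.1)
        have h2 := abs_le.1 (show |wtPrim L a y - v| ≤ δ from hy.1)
        linarith [h1.1, h2.2]

/-- Three nonnegative numbers, of which the first and third are at least `a` and at distance at
least `a` from each other and the second is at least `b`, with distances at least `b` and `a` from
the first and third: the product of the distances is large relative to the spread. -/
theorem separated_product {a b u₁ u₂ u₃ : ℝ} (ha : 0 < a) (hb : 0 < b) (h1 : a ≤ u₁)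
    (h2 : b ≤ u₂) (h3 : a ≤ u₃) (h12 : b ≤ |u₁ - u₂|) (h13 : a ≤ |u₁ - u₃|)
    (h23 : a ≤ |u₂ - u₃|) {m M : ℝ} (hm : m = min u₁ (min u₂ u₃)) (hM : M = max u₁ (max u₂ u₃)) :
    a ^ 2 * b / 8 * M ≤ m * (|u₁ - u₂| * |u₁ - u₃| * |u₂ - u₃|) := by
  have hprod : a ^ 2 * b ≤ |u₁ - u₂| * |u₁ - u₃| * |u₂ - u₃| := by
    calc a ^ 2 * b = b * a * a := by ring
      _ ≤ _ := by gcongr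
  have key : ∀ x y z : ℝ, 0 < x → x ≤ y → y ≤ z → x = m → z = M →
      |u₁ - u₂| * |u₁ - u₃| * |u₂ - u₃| = (z - x) * ((z - y) * (y - x)) →
      (2 * x ≤ z → a ^ 2 * b / 4 ≤ x * ((z - y) * (y - x))) →
      a ^ 2 * b / 8 * M ≤ m * (|u₁ - u₂| * |u₁ - u₃| * |u₂ - u₃|) := by
    rintro x y z hx hxy hyz rfl rfl he hk
    rcases le_total (2 * x) z with h | h
    · rw [he]
      have h4 := hk h
      have h5 : z / 2 ≤ z - x := by linarith
      have h6 : 0 ≤ a ^ 2 * b / 4 := by positivity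
      calc a ^ 2 * b / 8 * z = (z / 2) * (a ^ 2 * b / 4) := by ring
        _ ≤ (z - x) * (x * ((z - y) * (y - x))) :=
          mul_le_mul h5 h4 h6 (by linarith)
        _ = _ := by ring
    · have h7 : 0 < a ^ 2 * b := by positivity
      nlinarith
  have hab : 0 < a ^ 2 * b := by positivity
  have prod3 : ∀ {p q r x y z : ℝ}, 0 ≤ p → 0 ≤ q → 0 ≤ r → p ≤ x → q ≤ y → r ≤ z →
      p * (q * r) ≤ x * (y * z) := by
    intro p q r x y z hp hq hr h1 h2 h3
    exact mul_le_mul h1 (mul_le_mul h2 h3 hr (hq.trans h2)) (mul_nonneg hq hr) (hp.trans h1)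
  rcases le_total u₁ u₂ with g12 | g12 <;> rcases le_total u₁ u₃ with g13 | g13 <;>
    rcases le_total u₂ u₃ with g23 | g23
  · -- `u₁ ≤ u₂ ≤ u₃`
    rw [abs_of_nonpos (sub_nonpos.2 g12)] at h12
    rw [abs_of_nonpos (sub_nonpos.2 g23)] at h23
    refine key u₁ u₂ u₃ (by linarith) g12 g23 (by rw [hm]; simp [*]) (by rw [hM]; simp [*]) ?_ ?_
    · rw [abs_of_nonpos (sub_nonpos.2 g12), abs_of_nonpos (sub_nonpos.2 g13),
        abs_of_nonpos (sub_nonpos.2 g23)]; ring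
    · intro _
      have := prod3 ha.le ha.le hb.le h1 (by linarith : a ≤ u₃ - u₂) (by linarith : b ≤ u₂ - u₁)
      linarith
  · -- `u₁ ≤ u₃ ≤ u₂`
    rw [abs_of_nonpos (sub_nonpos.2 g13)] at h13
    rw [abs_of_nonneg (sub_nonneg.2 g23)] at h23
    refine key u₁ u₃ u₂ (by linarith) g13 g23 (by rw [hm]; simp [*]) (by rw [hM]; simp [*]) ?_ ?_
    · rw [abs_of_nonpos (sub_nonpos.2 g12), abs_of_nonpos (sub_nonpos.2 g13),
        abs_of_nonneg (sub_nonneg.2 g23)]; ring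
    · intro h
      rcases le_total (b / 4) (u₂ - u₃) with h5 | h5
      · have := prod3 ha.le (by positivity) ha.le h1 h5 (by linarith : a ≤ u₃ - u₁)
        linarith
      · have := prod3 ha.le ha.le (by positivity) h1 (by linarith : a ≤ u₂ - u₃)
          (by linarith : b / 4 ≤ u₃ - u₁)
        linarith
  · -- degenerate: all equal
    have e1 : u₁ = u₃ := by linarith
    rw [e1] at h13; simp at h13; linarith
  · -- `u₃ ≤ u₁ ≤ u₂`
    rw [abs_of_nonpos (sub_nonpos.2 g12)] at h12
    rw [abs_of_nonneg (sub_nonneg.2 g13)] at h13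
    refine key u₃ u₁ u₂ (by linarith) g13 g12 (by rw [hm]; simp [*]) (by rw [hM]; simp [*]) ?_ ?_
    · rw [abs_of_nonpos (sub_nonpos.2 g12), abs_of_nonneg (sub_nonneg.2 g13),
        abs_of_nonneg (sub_nonneg.2 g23)]; ring
    · intro _
      have := prod3 ha.le hb.le ha.le h3 (by linarith : b ≤ u₂ - u₁) (by linarith : a ≤ u₁ - u₃)
      linarith
  · -- `u₂ ≤ u₁ ≤ u₃`
    rw [abs_of_nonneg (sub_nonneg.2 g12)] at h12
    rw [abs_of_nonpos (sub_nonpos.2 g13)] at h13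
    refine key u₂ u₁ u₃ (by linarith) g12 g13 (by rw [hm]; simp [*]) (by rw [hM]; simp [*]) ?_ ?_
    · rw [abs_of_nonneg (sub_nonneg.2 g12), abs_of_nonpos (sub_nonpos.2 g13),
        abs_of_nonpos (sub_nonpos.2 g23)]; ring
    · intro _
      rcases le_total (a / 2) (u₁ - u₂) with h5 | h5
      · have := prod3 hb.le ha.le (by positivity) h2 (by linarith : a ≤ u₃ - u₁) h5
        linarith
      · have := prod3 (by positivity) ha.le hb.le (by linarith : a / 2 ≤ u₂)
          (by linarith : a ≤ u₃ - u₁) (by linarith : b ≤ u₁ - u₂)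
        linarith
  · -- degenerate: all equal
    have e1 : u₁ = u₃ := by linarith
    rw [e1] at h13; simp at h13; linarith
  · -- `u₂ ≤ u₃ ≤ u₁`
    rw [abs_of_nonneg (sub_nonneg.2 g13)] at h13
    rw [abs_of_nonpos (sub_nonpos.2 g23)] at h23
    refine key u₂ u₃ u₁ (by linarith) g23 g13 (by rw [hm]; simp [*]) (by rw [hM]; simp [*]) ?_ ?_
    · rw [abs_of_nonneg (sub_nonneg.2 g12), abs_of_nonneg (sub_nonneg.2 g13),
        abs_of_nonpos (sub_nonpos.2 g23)]; ring
    · intro _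
      have := prod3 hb.le ha.le ha.le h2 (by linarith : a ≤ u₁ - u₃) (by linarith : a ≤ u₃ - u₂)
      linarith
  · -- `u₃ ≤ u₂ ≤ u₁`
    rw [abs_of_nonneg (sub_nonneg.2 g12)] at h12
    rw [abs_of_nonneg (sub_nonneg.2 g23)] at h23
    refine key u₃ u₂ u₁ (by linarith) g23 g12 (by rw [hm]; simp [*]) (by rw [hM]; simp [*]) ?_ ?_
    · rw [abs_of_nonneg (sub_nonneg.2 g12), abs_of_nonneg (sub_nonneg.2 g13),
        abs_of_nonneg (sub_nonneg.2 g23)]; ring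
    · intro _
      have := prod3 ha.le hb.le ha.le h3 (by linarith : b ≤ u₁ - u₂) (by linarith : a ≤ u₂ - u₃)
      linarith

/-- The kernel `∏ wt(tᵢ) ∏ |tᵢ - tⱼ|` for an increasing weight, in the variable `u = ∫ wt`. The
doubling property of polynomials gives `wt(t) (t - a) ≈ u(t)`, whence `wt(x) / wt(z) ≳ u(x) / u(z)`
for `x < z`. -/
theorem increment_product_le {n : ℕ} {D : ℝ} (hD1 : 1 ≤ D)
    (hD : ∀ p : ℝ[X], p.natDegree ≤ n → ∀ a h M : ℝ,
      (∀ s ∈ Icc (0 : ℝ) 1, |p.eval (a + h * s)| ≤ M) →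
        ∀ s ∈ Icc (0 : ℝ) 2, |p.eval (a + h * s)| ≤ D * M)
    {L : ℝ[X]} (hL : L.natDegree ≤ n) {K : Set ℝ} (hK : K.OrdConnected)
    (hmono : MonotoneOn (fun t => |L.eval t|) K) (hbdd : BddBelow K) {x y z : ℝ} (hx : x ∈ K)
    (hy : y ∈ K) (hz : z ∈ K) (hxy : x < y) (hyz : y < z) :
    wtPrim L (sInf K) x * ((wtPrim L (sInf K) y - wtPrim L (sInf K) x) *
      (wtPrim L (sInf K) z - wtPrim L (sInf K) x) * (wtPrim L (sInf K) z - wtPrim L (sInf K) y)) ≤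
    3 * D * (wtPrim L (sInf K) z *
      (wt L x * wt L y * wt L z * ((y - x) * (z - x) * (z - y)))) := by
  set a := sInf K with ha
  set u := wtPrim L a with hu
  have haK : ∀ t ∈ K, a ≤ t := fun t ht => csInf_le hbdd ht
  have hwm : MonotoneOn (wt L) K := fun s hs t ht hst => wt_le_wt (hmono hs ht hst)
  have hIoc : ∀ t ∈ K, ∀ s, a < s → s ≤ t → s ∈ K := by
    intro t ht s has hst
    obtain ⟨k, hk, hks⟩ := exists_lt_of_csInf_lt ⟨t, ht⟩ has
    exact hK.out hk ht ⟨hks.le, hst⟩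
  -- upper bound for increments of `u`
  have hup : ∀ s t, a ≤ s → s ≤ t → t ∈ K → u t - u s ≤ wt L t * (t - s) := by
    intro s t has hst ht
    rw [hu, wtPrim_sub]
    have : ∫ r in s..t, wt L r ≤ ∫ _r in s..t, wt L t := by
      refine intervalIntegral.integral_mono_on_of_le_Ioo hst
        ((continuous_wt L).intervalIntegrable _ _) (by simp) fun r hr => ?_
      exact hwm (hIoc t ht r (lt_of_le_of_lt has hr.1) hr.2.le) ht hr.2.le
    rwa [intervalIntegral.integral_const, smul_eq_mul, mul_comm] at this
  have hua : u a = 0 := by simp [hu, wtPrim]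
  have humono : Monotone u := monotone_wtPrim L a
  have hu0 : ∀ t ∈ K, 0 ≤ u t := fun t ht => by rw [← hua]; exact humono (haK t ht)
  have hlow : ∀ t ∈ K, wt L t * (t - a) ≤ 3 * D * u t := by
    intro t ht
    rcases (haK t ht).eq_or_lt with h | h
    · rw [← h]; simp [hua]
    have hmid : (a + 2 * t) / 3 ∈ K := hIoc t ht _ (by linarith) (by linarith)
    -- the doubling property, applied on the upper two thirds of `[a, t]`
    have hd := hD L hL ((2 * a + t) / 3) ((t - a) / 3) |L.eval ((a + 2 * t) / 3)|
      (fun s hs => hmono (hIoc t ht _ (by nlinarith [hs.1]) (by nlinarith [hs.2])) hmid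
        (by nlinarith [hs.2])) 2 (by norm_num)
    have e : (2 * a + t) / 3 + (t - a) / 3 * 2 = t := by ring
    rw [e] at hd
    have hw : wt L t ≤ D * wt L ((a + 2 * t) / 3) := by
      have h6 : wt L t ^ 6 ≤ (D * wt L ((a + 2 * t) / 3)) ^ 6 := by
        rw [wt_pow_six, mul_pow, wt_pow_six]
        exact hd.trans (mul_le_mul_of_nonneg_right (le_self_pow₀ hD1 (by norm_num))
          (abs_nonneg _))
      exact le_of_pow_le_pow_left₀ (by norm_num)
        (mul_nonneg (by linarith) (wt_nonneg L _)) h6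
    have hint : wt L ((a + 2 * t) / 3) * ((t - a) / 3) ≤ u t - u ((a + 2 * t) / 3) := by
      rw [hu, wtPrim_sub]
      have : ∫ _r in ((a + 2 * t) / 3)..t, wt L ((a + 2 * t) / 3) ≤
          ∫ r in ((a + 2 * t) / 3)..t, wt L r := by
        refine intervalIntegral.integral_mono_on_of_le_Ioo (by linarith) (by simp)
          ((continuous_wt L).intervalIntegrable _ _) fun r hr => ?_
        exact hwm hmid (hK.out hmid ht ⟨hr.1.le, hr.2.le⟩) hr.1.le
      rw [intervalIntegral.integral_const, smul_eq_mul] at this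
      calc _ = (t - (a + 2 * t) / 3) * wt L ((a + 2 * t) / 3) := by ring
        _ ≤ _ := this
    have h0 := hu0 _ hmid
    calc wt L t * (t - a) ≤ D * wt L ((a + 2 * t) / 3) * (t - a) :=
          mul_le_mul_of_nonneg_right hw (by linarith)
      _ = 3 * D * (wt L ((a + 2 * t) / 3) * ((t - a) / 3)) := by ring
      _ ≤ 3 * D * u t := mul_le_mul_of_nonneg_left (by linarith) (by linarith)
  have hax := haK x hx
  have hay := haK y hy
  have haz := haK z hz
  have e1 := hup x y hax hxy.le hy
  have e2 := hup y z hay hyz.le hz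
  have e3 := hup x z hax (hxy.trans hyz).le hz
  have d1 : 0 ≤ u y - u x := sub_nonneg.2 (humono hxy.le)
  have d2 : 0 ≤ u z - u y := sub_nonneg.2 (humono hyz.le)
  have d3 : 0 ≤ u z - u x := by linarith
  have wx := wt_nonneg L x
  have wy := wt_nonneg L y
  have wz := wt_nonneg L z
  have hratio : u x * wt L z ≤ 3 * D * (wt L x * u z) := by
    have f1 : u x ≤ wt L x * (x - a) := by
      have := hup a x le_rfl hax hx
      rw [hua] at this; linarith
    calc u x * wt L z ≤ wt L x * (x - a) * wt L z := mul_le_mul_of_nonneg_right f1 wz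
      _ ≤ wt L x * (z - a) * wt L z := by
          refine mul_le_mul_of_nonneg_right (mul_le_mul_of_nonneg_left (by linarith) wx) wz
      _ = wt L x * (wt L z * (z - a)) := by ring
      _ ≤ wt L x * (3 * D * u z) := mul_le_mul_of_nonneg_left (hlow z hz) wx
      _ = _ := by ring
  rcases wz.eq_or_lt with h0 | h0
  · have f1 : u z ≤ 0 := by
      have := hup a z le_rfl haz hz
      rw [hua, ← h0] at this; linarith
    have f2 := hu0 x hx
    have f3 : u z - u x = 0 := by linarith
    have f4 : u z = 0 := by linarith [hu0 z hz]
    rw [f3, f4]; simp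
  · have hΔ : (u y - u x) * (u z - u x) * (u z - u y) ≤
        (wt L y * (y - x)) * (wt L z * (z - x)) * (wt L z * (z - y)) := by
      refine mul_le_mul (mul_le_mul e1 e3 d3 ?_) e2 d2 ?_
      · exact mul_nonneg wy (by linarith)
      · exact mul_nonneg (mul_nonneg wy (by linarith)) (mul_nonneg wz (by linarith))
    refine le_of_mul_le_mul_right ?_ h0
    have hV : 0 ≤ (wt L y * (y - x)) * (wt L z * (z - x)) * (wt L z * (z - y)) :=
      mul_nonneg (mul_nonneg (mul_nonneg wy (by linarith)) (mul_nonneg wz (by linarith)))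
        (mul_nonneg wz (by linarith))
    calc u x * ((u y - u x) * (u z - u x) * (u z - u y)) * wt L z
        = (u x * wt L z) * ((u y - u x) * (u z - u x) * (u z - u y)) := by ring
      _ ≤ (u x * wt L z) *
          ((wt L y * (y - x)) * (wt L z * (z - x)) * (wt L z * (z - y))) :=
          mul_le_mul_of_nonneg_left hΔ (mul_nonneg (hu0 x hx) wz)
      _ ≤ (3 * D * (wt L x * u z)) *
          ((wt L y * (y - x)) * (wt L z * (z - x)) * (wt L z * (z - y))) :=
          mul_le_mul_of_nonneg_right hratio hV
      _ = _ := by ring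

/-- The properties of a variable `u` on `K` in which the measure `wtMeasure L` is dominated by
Lebesgue measure and the kernel `∏ wt(tᵢ) ∏ |tᵢ - tⱼ|` is large at separated points. -/
structure IsVariable (c : ℝ) (L : ℝ[X]) (K : Set ℝ) (u : ℝ → ℝ) : Prop where
  measurable : Measurable u
  nonneg : ∀ t ∈ K, 0 ≤ u t
  measure_le : ∀ v δ, wtMeasure L {t | |u t - v| ≤ δ} ≤ ENNReal.ofReal (2 * δ)
  kernel_le : ∀ x ∈ K, ∀ y ∈ K, ∀ z ∈ K, ∀ a b, 0 < a → 0 < b → a ≤ u x → b ≤ u y → a ≤ u z →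
    b ≤ |u x - u y| → a ≤ |u x - u z| → a ≤ |u y - u z| →
    c * (a ^ 2 * b) ≤ wt L x * wt L y * wt L z * |(y - x) * (z - x) * (z - y)|

theorem isVariable_of_monotoneOn {n : ℕ} {D : ℝ} (hD1 : 1 ≤ D)
    (hD : ∀ p : ℝ[X], p.natDegree ≤ n → ∀ a h M : ℝ,
      (∀ s ∈ Icc (0 : ℝ) 1, |p.eval (a + h * s)| ≤ M) →
        ∀ s ∈ Icc (0 : ℝ) 2, |p.eval (a + h * s)| ≤ D * M)
    {L : ℝ[X]} (hL : L.natDegree ≤ n) {K : Set ℝ} (hK : K.OrdConnected)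
    (hmono : MonotoneOn (fun t => |L.eval t|) K) (hbdd : BddBelow K) :
    IsVariable (1 / (24 * D)) L K (wtPrim L (sInf K)) := by
  have hmonoU := monotone_wtPrim L (sInf K)
  refine ⟨(continuous_wtPrim L _).measurable, fun t ht => ?_, wtMeasure_abs_sub_le L _, ?_⟩
  · have : wtPrim L (sInf K) (sInf K) = 0 := by simp [wtPrim]
    rw [← this]; exact hmonoU (csInf_le hbdd ht)
  intro x hx y hy z hz a b ha hb h1 h2 h3 h12 h13 h23
  have hinc := fun {x y z : ℝ} => increment_product_le (x := x) (y := y) (z := z)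
    hD1 hD hL hK hmono hbdd
  set u := wtPrim L (sInf K) with hu
  have hsep := separated_product ha hb h1 h2 h3 h12 h13 h23 rfl rfl
  have key : ∀ p ∈ K, ∀ q ∈ K, ∀ r ∈ K, p < q → q < r → u p = min (u x) (min (u y) (u z)) →
      u r = max (u x) (max (u y) (u z)) →
      |u x - u y| * |u x - u z| * |u y - u z| = (u q - u p) * (u r - u p) * (u r - u q) →
      wt L x * wt L y * wt L z * |(y - x) * (z - x) * (z - y)| =
        wt L p * wt L q * wt L r * ((q - p) * (r - p) * (r - q)) →
      1 / (24 * D) * (a ^ 2 * b) ≤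
        wt L x * wt L y * wt L z * |(y - x) * (z - x) * (z - y)| := by
    intro p hp q hq r hr hpq hqr hup hur hΔ hW
    rw [hW]
    rw [← hup, ← hur, hΔ] at hsep
    have h := hsep.trans (hinc hp hq hr hpq hqr)
    have hr0 : 0 < u r := by rw [hur]; exact lt_max_of_lt_left (by linarith)
    refine le_of_mul_le_mul_left ?_ hr0
    have hD0 : 0 < D := by linarith
    rw [show u r * (1 / (24 * D) * (a ^ 2 * b)) = (a ^ 2 * b / 8 * u r) / (3 * D) by
      field_simp; norm_num]
    rw [div_le_iff₀ (by positivity)]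
    linarith
  have nxy : x ≠ y := by rintro rfl; simp at h12; linarith
  have nxz : x ≠ z := by rintro rfl; simp at h13; linarith
  have nyz : y ≠ z := by rintro rfl; simp at h23; linarith
  have ab : ∀ {s t : ℝ}, s < t → |u s - u t| = u t - u s := fun {s t} h => by
    rw [abs_sub_comm, abs_of_nonneg (sub_nonneg.2 (hmonoU h.le))]
  have ab' : ∀ {s t : ℝ}, s < t → |u t - u s| = u t - u s := fun {s t} h =>
    abs_of_nonneg (sub_nonneg.2 (hmonoU h.le))
  have abt : ∀ {s t : ℝ}, s < t → |t - s| = t - s := fun {s t} h =>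
    abs_of_nonneg (sub_nonneg.2 h.le)
  have abt' : ∀ {s t : ℝ}, s < t → |s - t| = t - s := fun {s t} h => by
    rw [abs_sub_comm, abs_of_nonneg (sub_nonneg.2 h.le)]
  have mu : ∀ {s t : ℝ}, s < t → u s ≤ u t := fun h => hmonoU h.le
  rw [abs_mul, abs_mul] at key ⊢
  rcases nxy.lt_or_gt with g12 | g12 <;> rcases nxz.lt_or_gt with g13 | g13 <;>
    rcases nyz.lt_or_gt with g23 | g23
  · exact key x hx y hy z hz g12 g23 (by simp [mu g12, mu g23])
      (by simp [mu g13, mu g23])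
      (by rw [ab g12, ab g13, ab g23]) (by rw [abt g12, abt g13, abt g23])
  · exact key x hx z hz y hy g13 g23 (by simp [mu g13, mu g23])
      (by simp [mu g12, mu g23])
      (by rw [ab g12, ab g13, ab' g23]; ring) (by rw [abt g12, abt g13, abt' g23]; ring)
  · linarith
  · exact key z hz x hx y hy g13 g12 (by simp [mu g13, mu g23])
      (by simp [mu g12, mu g23])
      (by rw [ab g12, ab' g13, ab' g23]; ring) (by rw [abt g12, abt' g13, abt' g23]; ring)
  · exact key y hy x hx z hz g12 g13 (by simp [mu g12, mu g23])
      (by simp [mu g13, mu g23])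
      (by rw [ab' g12, ab g13, ab g23]; ring) (by rw [abt' g12, abt g13, abt g23]; ring)
  · linarith
  · exact key y hy z hz x hx g23 g13 (by simp [mu g12, mu g23])
      (by simp [mu g13, mu g23])
      (by rw [ab' g12, ab' g13, ab g23]; ring) (by rw [abt' g12, abt' g13, abt g23]; ring)
  · exact key z hz y hy x hx g23 g12 (by simp [mu g13, mu g23])
      (by simp [mu g12, mu g23])
      (by rw [ab' g12, ab' g13, ab' g23]; ring) (by rw [abt' g12, abt' g13, abt' g23]; ring)

theorem wt_comp_neg (L : ℝ[X]) (t : ℝ) : wt (L.comp (-X)) t = wt L (-t) := by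
  simp [wt, eval_comp]

theorem wtMeasure_preimage_neg (L : ℝ[X]) {S : Set ℝ} (hS : MeasurableSet S) :
    wtMeasure L (Neg.neg ⁻¹' S) = wtMeasure (L.comp (-X)) S := by
  rw [wtMeasure, wtMeasure, withDensity_apply _ hS, withDensity_apply _ (measurable_neg hS),
    ← (Measure.measurePreserving_neg (volume : Measure ℝ)).setLIntegral_comp_preimage hS
      (measurable_ofReal_wt _)]
  simp [wt_comp_neg]

theorem IsGood.exists_isVariable (n : ℕ) :
    ∃ c₀ : ℝ, 0 < c₀ ∧ ∀ (c : ℝ) (p : Fin 3 → ℝ[X]) (K : Set ℝ), (wron p).natDegree ≤ n →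
      IsGood c p K → ∃ u, IsVariable c₀ (wron p) K u := by
  obtain ⟨D, hD1, hD⟩ := exists_doubling n
  refine ⟨1 / (24 * D), by positivity, fun c p K hL hK => ?_⟩
  set L := wron p
  rcases hK.monotone with ⟨h, hb⟩ | ⟨h, hb⟩
  · exact ⟨_, isVariable_of_monotoneOn hD1 hD hL hK.ordConnected h hb⟩
  -- reflect the parameter
  set K' : Set ℝ := Neg.neg ⁻¹' K with hK'
  have hL' : (L.comp (-X)).natDegree ≤ n := by
    refine natDegree_comp_le.trans ?_
    rw [natDegree_neg, natDegree_X, mul_one]; exact hL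
  have hoc : K'.OrdConnected := ⟨fun x hx y hy z hz =>
    hK.ordConnected.out hy hx ⟨by linarith [hz.2], by linarith [hz.1]⟩⟩
  have hm : MonotoneOn (fun t => |(L.comp (-X)).eval t|) K' := by
    intro x hx y hy hxy
    simp only [eval_comp, eval_neg, eval_X]
    exact h hy hx (by linarith)
  have hb' : BddBelow K' := by
    obtain ⟨B, hB⟩ := hb
    exact ⟨-B, fun x hx => by linarith [hB hx]⟩
  have hv := isVariable_of_monotoneOn hD1 hD hL' hoc hm hb'
  set u := wtPrim (L.comp (-X)) (sInf K')
  have hK'' : ∀ t ∈ K, -t ∈ K' := fun t ht => by simpa [hK'] using ht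
  refine ⟨fun t => u (-t), hv.measurable.comp measurable_neg, fun t ht => hv.nonneg _ (hK'' t ht),
    fun v δ => ?_, ?_⟩
  · have hms : MeasurableSet {t | |u t - v| ≤ δ} := by
      have := hv.measurable
      exact measurableSet_le (by fun_prop) measurable_const
    have := wtMeasure_preimage_neg L hms
    refine le_trans (le_of_eq ?_) (hv.measure_le v δ)
    rw [← this]; rfl
  · intro x hx y hy z hz a b ha hb h1 h2 h3 h12 h13 h23
    have := hv.kernel_le _ (hK'' x hx) _ (hK'' y hy) _ (hK'' z hz) a b ha hb h1 h2 h3 h12 h13 h23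
    simp only [wt_comp_neg, neg_neg] at this
    refine this.trans (le_of_eq ?_)
    congr 1
    rw [← abs_neg]
    congr 1; ring

/-! ### Injectivity of sums of three points of the curve -/

/-- The tangent vectors of the curve `P`. -/
noncomputable def velocity (P : Fin 3 → ℝ[X]) : Fin 3 → ℝ[X] := fun i => derivative (P i)

theorem alternant_swap_left (p : Fin 3 → ℝ[X]) (x y z : ℝ) :
    alternant p y x z = -alternant p x y z := by
  simp only [alternant_eq]; ring

theorem alternant_swap_right (p : Fin 3 → ℝ[X]) (x y z : ℝ) :
    alternant p x z y = -alternant p x y z := by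
  simp only [alternant_eq]; ring

/-- For `a < b` there is a linear combination of the coordinates of the curve that increases up
to `a`, decreases between `a` and `b` and increases from `b` on. -/
theorem exists_test_function {c : ℝ} {P : Fin 3 → ℝ[X]} {K : Set ℝ} (hK : K.OrdConnected)
    (hg : GeomIneq c (velocity P) K) {a b : ℝ} (ha : a ∈ K) (hb : b ∈ K) (hab : a < b) :
    ∃ ξ : Fin 3 → ℝ,
      StrictMonoOn (fun t => ∑ i, ξ i * (P i).eval t) (K ∩ Iic a) ∧
      StrictAntiOn (fun t => ∑ i, ξ i * (P i).eval t) (Icc a b) ∧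
      StrictMonoOn (fun t => ∑ i, ξ i * (P i).eval t) (K ∩ Ici b) := by
  obtain ⟨σ, hσ⟩ := hg
  set p := velocity P with hp
  set ξ : Fin 3 → ℝ := ![σ * ((p 1).eval a * (p 2).eval b - (p 2).eval a * (p 1).eval b),
    σ * ((p 2).eval a * (p 0).eval b - (p 0).eval a * (p 2).eval b),
    σ * ((p 0).eval a * (p 1).eval b - (p 1).eval a * (p 0).eval b)] with hξ
  have hd : ∀ t, HasDerivAt (fun t => ∑ i, ξ i * (P i).eval t) (σ * alternant p t a b) t := by
    intro t
    have := HasDerivAt.fun_sum (u := Finset.univ) (A := fun i t => ξ i * (P i).eval t)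
      (A' := fun i => ξ i * (p i).eval t) (x := t)
      fun i _ => ((P i).hasDerivAt t).const_mul (ξ i)
    refine this.congr_deriv ?_
    simp only [Fin.sum_univ_three, alternant_eq, hξ, Matrix.cons_val]
    ring
  have hc : ∀ S : Set ℝ, ContinuousOn (fun t => ∑ i, ξ i * (P i).eval t) S := fun S t _ =>
    (hd t).continuousAt.continuousWithinAt
  refine ⟨ξ, ?_, ?_, ?_⟩
  · refine strictMonoOn_of_deriv_pos (hK.inter ordConnected_Iic).convex (hc _) fun t ht => ?_
    have h1 : t ∈ K := (interior_subset ht).1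
    have h2 : t < a := by
      have := interior_mono inter_subset_right ht
      rwa [interior_Iic] at this
    rw [(hd t).deriv]
    exact (hσ t h1 a ha b hb h2 hab).1
  · refine strictAntiOn_of_deriv_neg (convex_Icc a b) (hc _) fun t ht => ?_
    rw [interior_Icc] at ht
    rw [(hd t).deriv]
    have := (hσ a ha t (hK.out ha hb ⟨ht.1.le, ht.2.le⟩) b hb ht.1 ht.2).1
    rw [alternant_swap_left] at this
    linarith
  · refine strictMonoOn_of_deriv_pos (hK.inter ordConnected_Ici).convex (hc _) fun t ht => ?_
    have h1 : t ∈ K := (interior_subset ht).1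
    have h2 : b < t := by
      have := interior_mono inter_subset_right ht
      rwa [interior_Ici] at this
    rw [(hd t).deriv]
    have := (hσ a ha b hb t h1 hab h2).1
    rw [alternant_swap_right, alternant_swap_left] at this
    linarith

/-- The partial sums of six signs with sum zero change sign at most twice; a test function with
matching monotonicity shows that a signed sum of six points of the curve with these signs vanishes
only if the points cancel in pairs. -/
theorem eq_of_signed_sum_eq_zero {c : ℝ} {P : Fin 3 → ℝ[X]} {K : Set ℝ} (hK : K.OrdConnected)
    (hg : GeomIneq c (velocity P) K) {x₁ x₂ x₃ x₄ x₅ x₆ : ℝ} (h1 : x₁ ∈ K) (h2 : x₂ ∈ K)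
    (h4 : x₄ ∈ K) (h6 : x₆ ∈ K) (h12 : x₁ ≤ x₂) (h23 : x₂ ≤ x₃) (h34 : x₃ ≤ x₄) (h45 : x₄ ≤ x₅)
    (h56 : x₅ ≤ x₆) (h24 : x₂ < x₄) (h46 : x₄ < x₆)
    {e₁ e₂ e₃ e₄ e₅ e₆ : ℝ} (he1 : e₁ = 1 ∨ e₁ = -1) (he2 : e₂ = 1 ∨ e₂ = -1)
    (he3 : e₃ = 1 ∨ e₃ = -1) (he4 : e₄ = 1 ∨ e₄ = -1) (he5 : e₅ = 1 ∨ e₅ = -1)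
    (he6 : e₆ = 1 ∨ e₆ = -1) (hsum : e₁ + e₂ + e₃ + e₄ + e₅ + e₆ = 0)
    (hP : ∀ i, e₁ * (P i).eval x₁ + e₂ * (P i).eval x₂ + e₃ * (P i).eval x₃ +
      e₄ * (P i).eval x₄ + e₅ * (P i).eval x₅ + e₆ * (P i).eval x₆ = 0) :
    x₁ = x₂ ∧ x₃ = x₄ ∧ x₅ = x₆ := by
  have h3 : x₃ ∈ K := hK.out h2 h4 ⟨h23, h34⟩
  have h5 : x₅ ∈ K := hK.out h4 h6 ⟨h45, h56⟩
  have hcomb : ∀ ξ : Fin 3 → ℝ,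
      e₁ * (∑ i, ξ i * (P i).eval x₁) + e₂ * (∑ i, ξ i * (P i).eval x₂) +
      e₃ * (∑ i, ξ i * (P i).eval x₃) + e₄ * (∑ i, ξ i * (P i).eval x₄) +
      e₅ * (∑ i, ξ i * (P i).eval x₅) + e₆ * (∑ i, ξ i * (P i).eval x₆) = 0 := by
    intro ξ
    simp only [Fin.sum_univ_three]
    linear_combination ξ 0 * hP 0 + ξ 1 * hP 1 + ξ 2 * hP 2
  by_contra hne
  have hstrict : x₁ < x₂ ∨ x₃ < x₄ ∨ x₅ < x₆ := by
    by_contra hcon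
    push Not at hcon
    exact hne ⟨le_antisymm h12 hcon.1, le_antisymm h34 hcon.2.1, le_antisymm h56 hcon.2.2⟩
  -- the four patterns of signs on `[x₁, x₂]`, `[x₃, x₄]`, `[x₅, x₆]`
  obtain ⟨ξA, a1, a2, a3⟩ := exists_test_function hK hg h2 h4 h24
  obtain ⟨ξB, b1, b2, -⟩ := exists_test_function hK hg h2 h6 (h24.trans h46)
  obtain ⟨ξC, c1, c2, -⟩ := exists_test_function hK hg h4 h6 h46
  obtain ⟨ξD, -, d2, -⟩ := exists_test_function hK hg h1 h6 (h12.trans_lt (h24.trans h46))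
  set A : ℝ → ℝ := fun t => ∑ i, ξA i * (P i).eval t with hAdef
  set B : ℝ → ℝ := fun t => ∑ i, ξB i * (P i).eval t with hBdef
  set C : ℝ → ℝ := fun t => ∑ i, ξC i * (P i).eval t with hCdef
  set D : ℝ → ℝ := fun t => ∑ i, ξD i * (P i).eval t with hDdef
  have hA : e₁ * A x₁ + e₂ * A x₂ + e₃ * A x₃ + e₄ * A x₄ + e₅ * A x₅ +
      e₆ * A x₆ = 0 := hcomb ξA
  have hB : e₁ * B x₁ + e₂ * B x₂ + e₃ * B x₃ + e₄ * B x₄ + e₅ * B x₅ +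
      e₆ * B x₆ = 0 := hcomb ξB
  have hC : e₁ * C x₁ + e₂ * C x₂ + e₃ * C x₃ + e₄ * C x₄ + e₅ * C x₅ +
      e₆ * C x₆ = 0 := hcomb ξC
  have hD : e₁ * D x₁ + e₂ * D x₂ + e₃ * D x₃ + e₄ * D x₄ + e₅ * D x₅ +
      e₆ * D x₆ = 0 := hcomb ξD
  have h14 : x₁ ≤ x₄ := h12.trans h24.le
  have h35 : x₃ ≤ x₅ := h34.trans h45
  have h36 : x₃ ≤ x₆ := h34.trans h46.le
  have h13 : x₁ ≤ x₃ := h12.trans h23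
  have m2 : ∀ {f : ℝ → ℝ} {S : Set ℝ}, StrictMonoOn f S → ∀ {x y}, x ∈ S → y ∈ S → x ≤ y →
      f x ≤ f y := fun h _ _ hx hy hxy => h.monotoneOn hx hy hxy
  have n2 : ∀ {f : ℝ → ℝ} {S : Set ℝ}, StrictAntiOn f S → ∀ {x y}, x ∈ S → y ∈ S → x ≤ y →
      f y ≤ f x := fun h _ _ hx hy hxy => h.antitoneOn hx hy hxy
  have A12 : A x₁ ≤ A x₂ := m2 a1 ⟨h1, h12⟩ ⟨h2, self_mem_Iic⟩ h12
  have A23 : A x₃ ≤ A x₂ := n2 a2 ⟨le_rfl, h24.le⟩ ⟨h23, h34⟩ h23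
  have A34 : A x₄ ≤ A x₃ := n2 a2 ⟨h23, h34⟩ ⟨h24.le, le_rfl⟩ h34
  have A45 : A x₄ ≤ A x₅ := m2 a3 ⟨h4, self_mem_Ici⟩ ⟨h5, h45⟩ h45
  have A56 : A x₅ ≤ A x₆ := m2 a3 ⟨h5, h45⟩ ⟨h6, h46.le⟩ h56
  have As : 0 < (A x₂ - A x₁) + (A x₃ - A x₄) + (A x₆ - A x₅) := by
    rcases hstrict with h | h | h
    · have := a1 ⟨h1, h12⟩ ⟨h2, self_mem_Iic⟩ h; linarith
    · have := a2 ⟨h23, h34⟩ ⟨h24.le, le_rfl⟩ h; linarith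
    · have := a3 ⟨h5, h45⟩ ⟨h6, h46.le⟩ h; linarith
  have B12 : B x₁ ≤ B x₂ := m2 b1 ⟨h1, h12⟩ ⟨h2, self_mem_Iic⟩ h12
  have B23 : B x₃ ≤ B x₂ := n2 b2 ⟨le_rfl, h24.le.trans h46.le⟩ ⟨h23, h36⟩ h23
  have B34 : B x₄ ≤ B x₃ := n2 b2 ⟨h23, h36⟩ ⟨h24.le, h46.le⟩ h34
  have B45 : B x₅ ≤ B x₄ := n2 b2 ⟨h24.le, h46.le⟩ ⟨h23.trans h35, h56⟩ h45
  have B56 : B x₆ ≤ B x₅ := n2 b2 ⟨h23.trans h35, h56⟩ ⟨h24.le.trans h46.le, le_rfl⟩ h56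
  have Bs : 0 < (B x₂ - B x₁) + (B x₃ - B x₄) + (B x₅ - B x₆) := by
    rcases hstrict with h | h | h
    · have := b1 ⟨h1, h12⟩ ⟨h2, self_mem_Iic⟩ h; linarith
    · have := b2 ⟨h23, h36⟩ ⟨h24.le, h46.le⟩ h; linarith
    · have := b2 ⟨h23.trans h35, h56⟩ ⟨h24.le.trans h46.le, le_rfl⟩ h; linarith
  have C12 : C x₁ ≤ C x₂ := m2 c1 ⟨h1, h14⟩ ⟨h2, h24.le⟩ h12
  have C23 : C x₂ ≤ C x₃ := m2 c1 ⟨h2, h24.le⟩ ⟨h3, h34⟩ h23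
  have C34 : C x₃ ≤ C x₄ := m2 c1 ⟨h3, h34⟩ ⟨h4, self_mem_Iic⟩ h34
  have C45 : C x₅ ≤ C x₄ := n2 c2 ⟨le_rfl, h46.le⟩ ⟨h45, h56⟩ h45
  have C56 : C x₆ ≤ C x₅ := n2 c2 ⟨h45, h56⟩ ⟨h46.le, le_rfl⟩ h56
  have Cs : 0 < (C x₂ - C x₁) + (C x₄ - C x₃) + (C x₅ - C x₆) := by
    rcases hstrict with h | h | h
    · have := c1 ⟨h1, h14⟩ ⟨h2, h24.le⟩ h; linarith
    · have := c1 ⟨h3, h34⟩ ⟨h4, self_mem_Iic⟩ h; linarith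
    · have := c2 ⟨h45, h56⟩ ⟨h46.le, le_rfl⟩ h; linarith
  have h16 : x₁ ≤ x₆ := h14.trans h46.le
  have h15 : x₁ ≤ x₅ := h14.trans h45
  have D12 : D x₂ ≤ D x₁ := n2 d2 ⟨le_rfl, h16⟩ ⟨h12, h23.trans h36⟩ h12
  have D23 : D x₃ ≤ D x₂ := n2 d2 ⟨h12, h23.trans h36⟩ ⟨h13, h36⟩ h23
  have D34 : D x₄ ≤ D x₃ := n2 d2 ⟨h13, h36⟩ ⟨h14, h46.le⟩ h34
  have D45 : D x₅ ≤ D x₄ := n2 d2 ⟨h14, h46.le⟩ ⟨h15, h56⟩ h45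
  have D56 : D x₆ ≤ D x₅ := n2 d2 ⟨h15, h56⟩ ⟨h16, le_rfl⟩ h56
  have Ds : 0 < (D x₁ - D x₂) + (D x₃ - D x₄) + (D x₅ - D x₆) := by
    rcases hstrict with h | h | h
    · have := d2 ⟨le_rfl, h16⟩ ⟨h12, h23.trans h36⟩ h; linarith
    · have := d2 ⟨h13, h36⟩ ⟨h14, h46.le⟩ h; linarith
    · have := d2 ⟨h15, h56⟩ ⟨h16, le_rfl⟩ h; linarith
  clear_value A B C D
  rcases he1 with rfl | rfl <;> rcases he2 with rfl | rfl <;> rcases he3 with rfl | rfl <;>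
    rcases he4 with rfl | rfl <;> rcases he5 with rfl | rfl <;> rcases he6 with rfl | rfl <;>
    first
    | linarith only [hsum]
    | linarith only [hA, A12, A23, A34, A45, A56, As]
    | linarith only [hB, B12, B23, B34, B45, B56, Bs]
    | linarith only [hC, C12, C23, C34, C45, C56, Cs]
    | linarith only [hD, D12, D23, D34, D45, D56, Ds]

/-- Signed sums of three points of the curve at increasing parameters determine the
parameters. -/
theorem eq_of_signed_sum_eq {c : ℝ} {P : Fin 3 → ℝ[X]} {K : Set ℝ} (hK : K.OrdConnected)
    (hg : GeomIneq c (velocity P) K) {e₁ e₂ e₃ : ℝ} (he1 : e₁ = 1 ∨ e₁ = -1)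
    (he2 : e₂ = 1 ∨ e₂ = -1) (he3 : e₃ = 1 ∨ e₃ = -1) {t₁ t₂ t₃ s₁ s₂ s₃ : ℝ}
    (ht1 : t₁ ∈ K) (ht2 : t₂ ∈ K) (ht3 : t₃ ∈ K) (hs1 : s₁ ∈ K) (hs2 : s₂ ∈ K) (hs3 : s₃ ∈ K)
    (ht12 : t₁ < t₂) (ht23 : t₂ < t₃) (hs12 : s₁ < s₂) (hs23 : s₂ < s₃)
    (h : ∀ i, e₁ * (P i).eval t₁ + e₂ * (P i).eval t₂ + e₃ * (P i).eval t₃ =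
      e₁ * (P i).eval s₁ + e₂ * (P i).eval s₂ + e₃ * (P i).eval s₃) :
    t₁ = s₁ ∧ t₂ = s₂ ∧ t₃ = s₃ := by
  wlog h11 : t₁ ≤ s₁ generalizing t₁ t₂ t₃ s₁ s₂ s₃
  · obtain ⟨a, b, c⟩ := this hs1 hs2 hs3 ht1 ht2 ht3 hs12 hs23 ht12 ht23 (fun i => (h i).symm)
      (le_of_not_ge h11)
    exact ⟨a.symm, b.symm, c.symm⟩
  have ng : ∀ {e : ℝ}, e = 1 ∨ e = -1 → -e = 1 ∨ -e = -1 := by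
    rintro e (rfl | rfl) <;> simp
  have n1 := ng he1
  have n2 := ng he2
  have n3 := ng he3
  rcases le_total t₂ s₁ with g21 | g21
  · rcases le_total t₃ s₁ with g31 | g31
    · obtain ⟨a, b, c⟩ := eq_of_signed_sum_eq_zero hK hg ht1 ht2 hs1 hs3 ht12.le ht23.le g31
        hs12.le hs23.le (by linarith) (by linarith) he1 he2 he3 n1 n2 n3 (by ring)
        (fun i => by linarith [h i])
      refine ⟨?_, ?_, ?_⟩ <;> linarith
    rcases le_total t₃ s₂ with g32 | g32
    · obtain ⟨a, b, c⟩ := eq_of_signed_sum_eq_zero hK hg ht1 ht2 ht3 hs3 ht12.le g21 g31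
        g32 hs23.le (by linarith) (by linarith) he1 he2 n1 he3 n2 n3 (by ring)
        (fun i => by linarith [h i])
      refine ⟨?_, ?_, ?_⟩ <;> linarith
    rcases le_total t₃ s₃ with g33 | g33
    · obtain ⟨a, b, c⟩ := eq_of_signed_sum_eq_zero hK hg ht1 ht2 hs2 hs3 ht12.le g21 hs12.le
        g32 g33 (by linarith) (by linarith) he1 he2 n1 n2 he3 n3 (by ring)
        (fun i => by linarith [h i])
      refine ⟨?_, ?_, ?_⟩ <;> linarith
    · obtain ⟨a, b, c⟩ := eq_of_signed_sum_eq_zero hK hg ht1 ht2 hs2 ht3 ht12.le g21 hs12.le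
        hs23.le g33 (by linarith) (by linarith) he1 he2 n1 n2 n3 he3 (by ring)
        (fun i => by linarith [h i])
      refine ⟨?_, ?_, ?_⟩ <;> linarith
  rcases le_total t₂ s₂ with g22 | g22
  · rcases le_total t₃ s₂ with g32 | g32
    · obtain ⟨a, b, c⟩ := eq_of_signed_sum_eq_zero hK hg ht1 hs1 ht3 hs3 h11 g21 ht23.le
        g32 hs23.le (by linarith) (by linarith) he1 n1 he2 he3 n2 n3 (by ring)
        (fun i => by linarith [h i])
      refine ⟨?_, ?_, ?_⟩ <;> linarith
    rcases le_total t₃ s₃ with g33 | g33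
    · obtain ⟨a, b, c⟩ := eq_of_signed_sum_eq_zero hK hg ht1 hs1 hs2 hs3 h11 g21 g22
        g32 g33 (by linarith) (by linarith) he1 n1 he2 n2 he3 n3 (by ring)
        (fun i => by linarith [h i])
      refine ⟨?_, ?_, ?_⟩ <;> linarith
    · obtain ⟨a, b, c⟩ := eq_of_signed_sum_eq_zero hK hg ht1 hs1 hs2 ht3 h11 g21 g22
        hs23.le g33 (by linarith) (by linarith) he1 n1 he2 n2 n3 he3 (by ring)
        (fun i => by linarith [h i])
      refine ⟨?_, ?_, ?_⟩ <;> linarith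
  rcases le_total t₂ s₃ with g23 | g23
  · rcases le_total t₃ s₃ with g33 | g33
    · obtain ⟨a, b, c⟩ := eq_of_signed_sum_eq_zero hK hg ht1 hs1 ht2 hs3 h11 hs12.le g22
        ht23.le g33 (by linarith) (by linarith) he1 n1 n2 he2 he3 n3 (by ring)
        (fun i => by linarith [h i])
      refine ⟨?_, ?_, ?_⟩ <;> linarith
    · obtain ⟨a, b, c⟩ := eq_of_signed_sum_eq_zero hK hg ht1 hs1 ht2 ht3 h11 hs12.le g22
        g23 g33 (by linarith) (by linarith) he1 n1 n2 he2 n3 he3 (by ring)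
        (fun i => by linarith [h i])
      refine ⟨?_, ?_, ?_⟩ <;> linarith
  · obtain ⟨a, b, c⟩ := eq_of_signed_sum_eq_zero hK hg ht1 hs1 hs3 ht3 h11 hs12.le hs23.le
      g23 ht23.le (by linarith) (by linarith) he1 n1 n2 n3 he2 he3 (by ring)
      (fun i => by linarith [h i])
    refine ⟨?_, ?_, ?_⟩ <;> linarith

/-! ### The change of variables -/

/-- Integrating the Jacobian over a set of parameters on which three points of the curve, with
signs `-`, `+`, `-`, sum to a point of `G - x₀`: each of the six orderings of the parameters
contributes at most the volume of `G`. -/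
theorem lintegral_abs_alternant_le {c : ℝ} {P : Fin 3 → ℝ[X]} {K : Set ℝ} (hK : K.OrdConnected)
    (hg : GeomIneq c (velocity P) K) {x₀ : Fin 3 → ℝ} {Ω G : Set (Fin 3 → ℝ)}
    (hΩ : MeasurableSet Ω) (hΩK : ∀ t ∈ Ω, ∀ j, t j ∈ K)
    (hG : ∀ t ∈ Ω, (fun i => x₀ i - (P i).eval (t 0) + (P i).eval (t 1) - (P i).eval (t 2)) ∈ G) :
    ∫⁻ t in Ω, ENNReal.ofReal |alternant (velocity P) (t 0) (t 1) (t 2)| ≤ 6 * volume G := by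
  set e : Fin 3 → ℝ := ![-1, 1, -1] with he
  have he1 : ∀ j, e j = 1 ∨ e j = -1 := by
    intro j; fin_cases j <;> simp [he]
  set Ψ : (Fin 3 → ℝ) → Fin 3 → ℝ := fun t i => x₀ i + ∑ j, e j * (P i).eval (t j) with hΨ
  set M : (Fin 3 → ℝ) → Matrix (Fin 3) (Fin 3) ℝ := fun t =>
    Matrix.of fun i j => e j * (velocity P i).eval (t j) with hM
  have hderiv : ∀ t, HasFDerivAt Ψ (LinearMap.toContinuousLinearMap (Matrix.toLin' (M t))) t := by
    intro t
    rw [hasFDerivAt_pi']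
    intro i
    have h1 : ∀ j, HasFDerivAt (fun t : Fin 3 → ℝ => e j * (P i).eval (t j))
        ((e j * (velocity P i).eval (t j)) •
          ContinuousLinearMap.proj (R := ℝ) (φ := fun _ : Fin 3 => ℝ) j) t := by
      intro j
      have h2 : HasFDerivAt (fun t : Fin 3 → ℝ => t j)
        (ContinuousLinearMap.proj (R := ℝ) (φ := fun _ : Fin 3 => ℝ) j) t :=
        hasFDerivAt_apply j t
      have h3 := (((P i).hasDerivAt (t j)).const_mul (e j)).comp_hasFDerivAt t h2
      exact h3
    have h4 := (HasFDerivAt.fun_sum (u := Finset.univ) fun j _ => h1 j).const_add (x₀ i)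
    refine h4.congr_fderiv ?_
    ext v
    simp [hM, Matrix.mulVec, dotProduct]
  have hdet : ∀ t, |(LinearMap.toContinuousLinearMap (Matrix.toLin' (M t))).det| =
      |alternant (velocity P) (t 0) (t 1) (t 2)| := by
    intro t
    rw [LinearMap.det_toContinuousLinearMap, LinearMap.det_toLin', Matrix.det_fin_three,
      alternant_eq]
    simp only [hM, he, Matrix.of_apply, Matrix.cons_val]
    congr 1
    ring
  have hΨG : ∀ t ∈ Ω, Ψ t ∈ G := by
    intro t ht
    have := hG t ht
    convert this using 1
    funext i
    simp only [hΨ, he, Fin.sum_univ_three, Matrix.cons_val]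
    ring
  -- split according to the order of the three parameters
  set S : Equiv.Perm (Fin 3) → Set (Fin 3 → ℝ) := fun σ => {t | t (σ 0) < t (σ 1) ∧
    t (σ 1) < t (σ 2)} with hS
  have hSm : ∀ σ, MeasurableSet (S σ) := fun σ =>
    (measurableSet_lt (measurable_pi_apply (σ 0)) (measurable_pi_apply (σ 1))).inter
      (measurableSet_lt (measurable_pi_apply (σ 1)) (measurable_pi_apply (σ 2)))
  have hpiece : ∀ σ, ∫⁻ t in Ω ∩ S σ, ENNReal.ofReal |alternant (velocity P) (t 0) (t 1) (t 2)| ≤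
      volume G := by
    intro σ
    have hinj : InjOn Ψ (Ω ∩ S σ) := by
      intro t ht s hs hts
      have hi : ∀ i, e (σ 0) * (P i).eval (t (σ 0)) + e (σ 1) * (P i).eval (t (σ 1)) +
          e (σ 2) * (P i).eval (t (σ 2)) = e (σ 0) * (P i).eval (s (σ 0)) +
          e (σ 1) * (P i).eval (s (σ 1)) + e (σ 2) * (P i).eval (s (σ 2)) := by
        intro i
        have h1 := congrFun hts i
        simp only [hΨ, add_right_inj] at h1
        rw [← Equiv.sum_comp σ, ← Equiv.sum_comp σ fun j => e j * (P i).eval (s j),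
          Fin.sum_univ_three, Fin.sum_univ_three] at h1
        exact h1
      obtain ⟨a0, a1, a2⟩ := eq_of_signed_sum_eq hK hg (he1 (σ 0)) (he1 (σ 1)) (he1 (σ 2))
        (hΩK t ht.1 _) (hΩK t ht.1 _) (hΩK t ht.1 _) (hΩK s hs.1 _) (hΩK s hs.1 _)
        (hΩK s hs.1 _) ht.2.1 ht.2.2 hs.2.1 hs.2.2 hi
      funext j
      obtain ⟨k, rfl⟩ := σ.surjective j
      fin_cases k
      exacts [a0, a1, a2]
    have h := lintegral_abs_det_fderiv_eq_addHaar_image (volume : Measure (Fin 3 → ℝ))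
      (hΩ.inter (hSm σ)) (fun t _ => (hderiv t).hasFDerivWithinAt) hinj
    simp only [hdet] at h
    rw [h]
    exact measure_mono (image_subset_iff.2 fun t ht => hΨG t ht.1)
  -- parameters that are not distinct do not contribute
  have hzero : ∀ t, t ∉ ⋃ σ, S σ → alternant (velocity P) (t 0) (t 1) (t 2) = 0 := by
    intro t ht
    by_contra hne
    apply ht
    have hinj : Function.Injective t := by
      have n01 : t 0 ≠ t 1 := fun h => hne (by rw [alternant_eq, h]; ring)
      have n02 : t 0 ≠ t 2 := fun h => hne (by rw [alternant_eq, h]; ring)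
      have n12 : t 1 ≠ t 2 := fun h => hne (by rw [alternant_eq, h]; ring)
      intro i j hij
      fin_cases i <;> fin_cases j <;> simp_all
    have hm : StrictMono (t ∘ Tuple.sort t) :=
      (Tuple.monotone_sort t).strictMono_of_injective (hinj.comp (Tuple.sort t).injective)
    exact mem_iUnion.2 ⟨Tuple.sort t, hm (by decide), hm (by decide)⟩
  set g : (Fin 3 → ℝ) → ℝ≥0∞ := fun t =>
    ENNReal.ofReal |alternant (velocity P) (t 0) (t 1) (t 2)| with hg
  have hsm : MeasurableSet (⋃ σ, S σ) := MeasurableSet.iUnion hSm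
  have hsplit : ∫⁻ t in Ω, g t = ∫⁻ t in Ω ∩ ⋃ σ, S σ, g t := by
    rw [← lintegral_inter_add_sdiff g Ω hsm]
    have : ∫⁻ t in Ω \ ⋃ σ, S σ, g t = 0 := by
      rw [setLIntegral_eq_zero_iff' (hΩ.diff hsm)]
      · refine Filter.Eventually.of_forall fun t ht => ?_
        simp [hg, hzero t ht.2]
      · have : Measurable g := by
          simp only [hg, alternant_eq]
          have hev : ∀ i j, Measurable fun t : Fin 3 → ℝ => (velocity P i).eval (t j) :=
            fun i j => (Polynomial.continuous _).measurable.comp (measurable_pi_apply j)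
          fun_prop
        exact this.aemeasurable
    rw [this, add_zero]
  calc ∫⁻ t in Ω, g t = ∫⁻ t in ⋃ σ, Ω ∩ S σ, g t := by rw [hsplit, inter_iUnion]
    _ ≤ ∑' σ, ∫⁻ t in Ω ∩ S σ, g t := lintegral_iUnion_le _ _
    _ ≤ ∑' _σ : Equiv.Perm (Fin 3), volume G := ENNReal.tsum_le_tsum hpiece
    _ = 6 * volume G := by
        rw [tsum_fintype, Finset.sum_const, Finset.card_univ, Fintype.card_perm, Fintype.card_fin]
        simp [Nat.factorial]

/-- The geometric inequality does not depend on the order of the three points. -/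
theorem GeomIneq.le_abs {c : ℝ} {p : Fin 3 → ℝ[X]} {K : Set ℝ} (hg : GeomIneq c p K) {x y z : ℝ}
    (hx : x ∈ K) (hy : y ∈ K) (hz : z ∈ K) :
    c * |(wron p).eval x * (wron p).eval y * (wron p).eval z| *
      |(y - x) * (z - x) * (z - y)| ^ 3 ≤ |alternant p x y z| ^ 3 := by
  obtain ⟨σ, hσ⟩ := hg
  have key : ∀ a ∈ K, ∀ b ∈ K, ∀ d ∈ K, a < b → b < d →
      |(y - x) * (z - x) * (z - y)| = |(b - a) * (d - b) * (d - a)| →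
      |(wron p).eval x * (wron p).eval y * (wron p).eval z| =
        |(wron p).eval a * (wron p).eval b * (wron p).eval d| →
      |alternant p x y z| = |alternant p a b d| →
      c * |(wron p).eval x * (wron p).eval y * (wron p).eval z| *
      |(y - x) * (z - x) * (z - y)| ^ 3 ≤ |alternant p x y z| ^ 3 := by
    intro a ha b hb d hd hab hbd h1 h2 h3
    rw [h1, h2, h3, abs_of_nonneg (mul_nonneg (mul_nonneg (by linarith) (by linarith))
      (by linarith : (0:ℝ) ≤ d - a))]
    exact (hσ a ha b hb d hd hab hbd).2
  by_cases exy : x = y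
  · subst exy; simp
  by_cases exz : x = z
  · subst exz; simp
  by_cases eyz : y = z
  · subst eyz; simp
  have ab : ∀ {a b : ℝ}, a = -b → |a| = |b| := fun h => by rw [h, abs_neg]
  rcases lt_or_gt_of_ne exy with h12 | h12 <;> rcases lt_or_gt_of_ne exz with h13 | h13 <;>
    rcases lt_or_gt_of_ne eyz with h23 | h23
  · exact key x hx y hy z hz h12 h23 (by congr 1; ring) rfl rfl
  · exact key x hx z hz y hy h13 h23 (ab (by ring)) (by congr 1; ring)
      (ab (by simp only [alternant_eq]; ring))
  · linarith
  · exact key z hz x hx y hy h13 h12 (by congr 1; ring) (by congr 1; ring)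
      (by congr 1; simp only [alternant_eq]; ring)
  · exact key y hy x hx z hz h12 h13 (ab (by ring)) (by congr 1; ring)
      (ab (by simp only [alternant_eq]; ring))
  · linarith
  · exact key y hy z hz x hx h23 h13 (by congr 1; ring) (by congr 1; ring)
      (by congr 1; simp only [alternant_eq]; ring)
  · exact key z hz y hy x hx h23 h12 (ab (by ring)) (by congr 1; ring)
      (ab (by simp only [alternant_eq]; ring))

/-- At separated parameters the Jacobian is at least a constant times `a² b` times the product of
the weights. -/
theorem le_abs_alternant {c c₀ : ℝ} (hc : 0 < c) {p : Fin 3 → ℝ[X]} {K : Set ℝ}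
    (hg : GeomIneq c p K) {u : ℝ → ℝ} (hu : IsVariable c₀ (wron p) K u) {x y z a b : ℝ}
    (hx : x ∈ K) (hy : y ∈ K) (hz : z ∈ K) (ha : 0 < a) (hb : 0 < b) (h1 : a ≤ u x)
    (h2 : b ≤ u y) (h3 : a ≤ u z) (h12 : b ≤ |u x - u y|) (h13 : a ≤ |u x - u z|)
    (h23 : a ≤ |u y - u z|) :
    min c 1 * c₀ * (a ^ 2 * b) * (wt (wron p) x * wt (wron p) y * wt (wron p) z) ≤
      |alternant p x y z| := by
  have hk := hu.kernel_le x hx y hy z hz a b ha hb h1 h2 h3 h12 h13 h23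
  have hgi := hg.le_abs hx hy hz
  set w := wt (wron p) x * wt (wron p) y * wt (wron p) z with hw
  set V := |(y - x) * (z - x) * (z - y)| with hV
  have hw0 : 0 ≤ w := mul_nonneg (mul_nonneg (wt_nonneg _ _) (wt_nonneg _ _)) (wt_nonneg _ _)
  have hV0 : 0 ≤ V := abs_nonneg _
  have hd0 : 0 < min c 1 := lt_min hc one_pos
  have hw6 : |(wron p).eval x * (wron p).eval y * (wron p).eval z| = w ^ 6 := by
    rw [abs_mul, abs_mul, ← wt_pow_six, ← wt_pow_six, ← wt_pow_six, hw]; ring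
  rw [hw6] at hgi
  have hd3 : min c 1 ^ 3 ≤ c := by
    calc min c 1 ^ 3 ≤ min c 1 ^ 1 := pow_le_pow_of_le_one hd0.le (min_le_right _ _) (by norm_num)
      _ ≤ c := by rw [pow_one]; exact min_le_left _ _
  have h3' : (min c 1 * w ^ 2 * V) ^ 3 ≤ |alternant p x y z| ^ 3 := by
    refine le_trans ?_ hgi
    calc (min c 1 * w ^ 2 * V) ^ 3 = min c 1 ^ 3 * w ^ 6 * V ^ 3 := by ring
      _ ≤ c * w ^ 6 * V ^ 3 := by gcongr
  have h4 := le_of_pow_le_pow_left₀ (by norm_num) (abs_nonneg _) h3'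
  calc min c 1 * c₀ * (a ^ 2 * b) * w = min c 1 * (c₀ * (a ^ 2 * b)) * w := by ring
    _ ≤ min c 1 * (w * V) * w := by gcongr
    _ = min c 1 * w ^ 2 * V := by ring
    _ ≤ _ := h4

/-- A triple integral over `Fin 3 → ℝ` as an iterated integral. -/
theorem lintegral_fin_three (g : ℝ → ℝ → ℝ → ℝ≥0∞)
    (hg : Measurable fun q : ℝ × ℝ × ℝ => g q.1 q.2.1 q.2.2) :
    ∫⁻ t : Fin 3 → ℝ, g (t 0) (t 1) (t 2) = ∫⁻ x, ∫⁻ y, ∫⁻ z, g x y z := by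
  have e1 := volume_preserving_piFinSuccAbove (fun _ : Fin 3 => ℝ) 0
  have e2 := volume_preserving_piFinTwo (fun _ : Fin 2 => ℝ)
  have e : MeasurePreserving (fun t : Fin 3 → ℝ => (t 0, t 1, t 2)) volume volume := by
    have := ((MeasurePreserving.id (volume : Measure ℝ)).prod e2).comp e1
    exact this
  rw [show (fun t : Fin 3 → ℝ => g (t 0) (t 1) (t 2)) =
    fun t => (fun q : ℝ × ℝ × ℝ => g q.1 q.2.1 q.2.2) ((fun t : Fin 3 → ℝ => (t 0, t 1, t 2)) t)
    from rfl]
  rw [e.lintegral_comp hg]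
  rw [Measure.volume_eq_prod, lintegral_prod _ hg.aemeasurable]
  refine lintegral_congr fun x => ?_
  have hx : Measurable fun q : ℝ × ℝ => g x q.1 q.2 := hg.comp (measurable_const.prodMk measurable_id)
  rw [Measure.volume_eq_prod, lintegral_prod _ hx.aemeasurable]

/-! ### A lower bound for the volume of a set reached by three steps along the curve -/

theorem continuous_curve (P : Fin 3 → ℝ[X]) : Continuous (curve P) := by
  unfold curve
  exact (PiLp.continuous_toLp 2 _).comp (continuous_pi fun i => (P i).continuous)

theorem measurable_curve (P : Fin 3 → ℝ[X]) : Measurable (curve P) :=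
  (continuous_curve P).measurable

theorem mul_le_lintegral {L : ℝ[X]} {S : Set ℝ} (hS : MeasurableSet S) {m k : ℝ≥0∞}
    (hm : m ≤ wtMeasure L S) {h : ℝ → ℝ≥0∞} (hh : ∀ x ∈ S, ENNReal.ofReal (wt L x) * k ≤ h x) :
    m * k ≤ ∫⁻ x, h x := by
  calc m * k ≤ wtMeasure L S * k := by gcongr
    _ = ∫⁻ x in S, ENNReal.ofReal (wt L x) * k := by
        rw [lintegral_mul_const _ (measurable_ofReal_wt L), wtMeasure, withDensity_apply _ hS]
    _ ≤ ∫⁻ x in S, h x := setLIntegral_mono' hS hh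
    _ ≤ ∫⁻ x, h x := setLIntegral_le_lintegral _ _

/-- Removing from a set the parameters at which the variable is close to one of finitely many
values. -/
theorem IsVariable.le_measure_of_subset {c : ℝ} {L : ℝ[X]} {K : Set ℝ} {u : ℝ → ℝ}
    (hu : IsVariable c L K u) {k : ℕ} (v : Fin k → ℝ) {m δ : ℝ} (hδ : 0 ≤ δ) {A S : Set ℝ}
    (hA : ENNReal.ofReal m ≤ wtMeasure L A) (hAS : A ⊆ S ∪ ⋃ i, {t | |u t - v i| ≤ δ}) :
    ENNReal.ofReal (m - k * (2 * δ)) ≤ wtMeasure L S := by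
  have h1 : wtMeasure L A ≤ wtMeasure L S + ENNReal.ofReal (k * (2 * δ)) := by
    refine (measure_mono hAS).trans ((measure_union_le _ _).trans ?_)
    gcongr
    calc wtMeasure L (⋃ i, {t | |u t - v i| ≤ δ}) ≤ ∑ i, wtMeasure L {t | |u t - v i| ≤ δ} :=
          measure_iUnion_fintype_le _ _
      _ ≤ ∑ _i : Fin k, ENNReal.ofReal (2 * δ) := Finset.sum_le_sum fun i _ => hu.measure_le _ _
      _ = ENNReal.ofReal (k * (2 * δ)) := by
          rw [ENNReal.ofReal_mul (Nat.cast_nonneg k)]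
          simp
  rw [ENNReal.ofReal_sub _ (by positivity)]
  exact tsub_le_iff_right.2 (hA.trans h1)

/-- Let every point of `F` reach `E` along a set of parameters of measure `α / 2`, every point of
`E'` reach `F` (backwards) along a set of measure `β / 4` and let `x₀` reach `E'` along a set of
measure `α / 8`. The paths with three steps from `x₀` to `E`, restricted to separated parameters,
give a lower bound for the volume of `E`. -/
theorem le_volume_of_three_steps {c c₀ : ℝ} (hc : 0 < c) (hc₀ : 0 < c₀) {P : Fin 3 → ℝ[X]}
    {K : Set ℝ} (hK : K.OrdConnected) (hg : GeomIneq c (velocity P) K) {u : ℝ → ℝ}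
    (hu : IsVariable c₀ (wron (velocity P)) K u) {E F E' : Set (EuclideanSpace ℝ (Fin 3))}
    (hE : MeasurableSet E) (hF : MeasurableSet F) (hE' : MeasurableSet E')
    {x₀ : EuclideanSpace ℝ (Fin 3)} {α β : ℝ} (hα : 0 < α) (hβ : 0 < β)
    (h1 : ∀ x ∈ F, ENNReal.ofReal (α / 2) ≤
      (wtMeasure (wron (velocity P))).restrict K {t | x - curve P t ∈ E})
    (h2 : ∀ y ∈ E', ENNReal.ofReal (β / 4) ≤
      (wtMeasure (wron (velocity P))).restrict K {t | y + curve P t ∈ F})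
    (h3 : ENNReal.ofReal (α / 8) ≤
      (wtMeasure (wron (velocity P))).restrict K {t | x₀ - curve P t ∈ E'}) :
    ENNReal.ofReal (min c 1 * c₀ / 100663296 * (α ^ 4 * β ^ 2)) ≤ volume E := by
  set L := wron (velocity P) with hL
  have hKm : MeasurableSet K := hK.measurableSet
  have hγ := measurable_curve P
  have hum := hu.measurable
  rw [Measure.restrict_apply' hKm] at h3
  replace h2 : ∀ y ∈ E', ENNReal.ofReal (β / 4) ≤ wtMeasure L ({t | y + curve P t ∈ F} ∩ K) := by
    intro y hy
    have := h2 y hy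
    rwa [Measure.restrict_apply' hKm] at this
  replace h1 : ∀ x ∈ F, ENNReal.ofReal (α / 2) ≤ wtMeasure L ({t | x - curve P t ∈ E} ∩ K) := by
    intro y hy
    have := h1 y hy
    rwa [Measure.restrict_apply' hKm] at this
  set a := α / 32 with ha
  set b := β / 32 with hb
  have ha0 : 0 < a := by positivity
  have hb0 : 0 < b := by positivity
  -- the admissible parameters of the three steps
  set A : Set ℝ := {x | x ∈ K ∧ x₀ - curve P x ∈ E' ∧ a ≤ u x} with hA
  set B : Set (ℝ × ℝ) := {q | q.2 ∈ K ∧ x₀ - curve P q.1 + curve P q.2 ∈ F ∧ b ≤ u q.2 ∧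
    b ≤ |u q.1 - u q.2|} with hB
  set D : Set (ℝ × ℝ × ℝ) := {q | q.2.2 ∈ K ∧
    x₀ - curve P q.1 + curve P q.2.1 - curve P q.2.2 ∈ E ∧ a ≤ u q.2.2 ∧
    a ≤ |u q.1 - u q.2.2| ∧ a ≤ |u q.2.1 - u q.2.2|} with hD
  have hAm : MeasurableSet A := by
    have m1 : Measurable fun x : ℝ => x₀ - curve P x := by fun_prop
    exact hKm.inter ((m1 hE').inter (measurableSet_le measurable_const hum))
  have hBm : MeasurableSet B := by
    have m1 : Measurable fun q : ℝ × ℝ => x₀ - curve P q.1 + curve P q.2 := by fun_prop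
    have m2 : Measurable fun q : ℝ × ℝ => |u q.1 - u q.2| := by fun_prop
    exact (measurable_snd hKm).inter ((m1 hF).inter
      ((measurableSet_le measurable_const (hum.comp measurable_snd)).inter
        (measurableSet_le measurable_const m2)))
  have hDm : MeasurableSet D := by
    have m0 : Measurable fun q : ℝ × ℝ × ℝ => q.2.2 := by fun_prop
    have m1 : Measurable fun q : ℝ × ℝ × ℝ =>
      x₀ - curve P q.1 + curve P q.2.1 - curve P q.2.2 := by fun_prop
    have m2 : Measurable fun q : ℝ × ℝ × ℝ => |u q.1 - u q.2.2| := by fun_prop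
    have m3 : Measurable fun q : ℝ × ℝ × ℝ => |u q.2.1 - u q.2.2| := by fun_prop
    exact (m0 hKm).inter ((m1 hE).inter
      ((measurableSet_le measurable_const (hum.comp m0)).inter
        ((measurableSet_le measurable_const m2).inter (measurableSet_le measurable_const m3))))
  have small : ∀ {t d : ℝ}, t ∈ K → ¬ d ≤ u t → |u t - 0| ≤ d := by
    intro t d ht hd
    rw [sub_zero, abs_of_nonneg (hu.nonneg t ht)]
    exact (not_le.1 hd).le
  have hA' : ENNReal.ofReal (α / 16) ≤ wtMeasure L A := by
    have := hu.le_measure_of_subset ![0] ha0.le (S := A) h3 (by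
      intro t ht
      by_cases h : a ≤ u t
      · exact Or.inl ⟨ht.2, ht.1, h⟩
      · exact Or.inr (mem_iUnion.2 ⟨0, small ht.2 h⟩))
    refine le_trans (ENNReal.ofReal_le_ofReal ?_) this
    rw [ha]; push_cast; linarith
  have hB' : ∀ x ∈ A, ENNReal.ofReal (β / 8) ≤ wtMeasure L {y | (x, y) ∈ B} := by
    intro x hx
    have := hu.le_measure_of_subset ![0, u x] hb0.le (S := {y | (x, y) ∈ B})
      (h2 _ hx.2.1) (by
        intro t ht
        by_cases h : b ≤ u t
        · by_cases h' : b ≤ |u x - u t|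
          · exact Or.inl ⟨ht.2, ht.1, h, h'⟩
          · refine Or.inr (mem_iUnion.2 ⟨1, ?_⟩)
            rw [abs_sub_comm] at h'
            exact (not_le.1 h').le
        · exact Or.inr (mem_iUnion.2 ⟨0, small ht.2 h⟩))
    refine le_trans (ENNReal.ofReal_le_ofReal ?_) this
    rw [hb]; push_cast; linarith
  have hD' : ∀ x y, (x, y) ∈ B → ENNReal.ofReal (α / 4) ≤ wtMeasure L {z | (x, y, z) ∈ D} := by
    intro x y hxy
    have := hu.le_measure_of_subset ![0, u x, u y] ha0.le (S := {z | (x, y, z) ∈ D})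
      (h1 _ hxy.2.1) (by
        intro t ht
        by_cases h : a ≤ u t
        · by_cases h' : a ≤ |u x - u t|
          · by_cases h'' : a ≤ |u y - u t|
            · exact Or.inl ⟨ht.2, ht.1, h, h', h''⟩
            · refine Or.inr (mem_iUnion.2 ⟨2, ?_⟩)
              rw [abs_sub_comm] at h''
              exact (not_le.1 h'').le
          · refine Or.inr (mem_iUnion.2 ⟨1, ?_⟩)
            rw [abs_sub_comm] at h'
            exact (not_le.1 h').le
        · exact Or.inr (mem_iUnion.2 ⟨0, small ht.2 h⟩))
    refine le_trans (ENNReal.ofReal_le_ofReal ?_) this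
    rw [ha]; push_cast; linarith
  set Q : Set (ℝ × ℝ × ℝ) := {q | q.1 ∈ A ∧ (q.1, q.2.1) ∈ B ∧ q ∈ D} with hQ
  have hQm : MeasurableSet Q :=
    (measurable_fst hAm).inter
      (((measurable_fst.prodMk (measurable_fst.comp measurable_snd) :
        Measurable fun q : ℝ × ℝ × ℝ => (q.1, q.2.1)) hBm).inter hDm)
  set W : ℝ × ℝ × ℝ → ℝ≥0∞ := fun q => ENNReal.ofReal (wt L q.1) * ENNReal.ofReal (wt L q.2.1) *
    ENNReal.ofReal (wt L q.2.2) with hW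
  have hWm : Measurable W :=
    (((measurable_ofReal_wt L).comp measurable_fst).mul
      ((measurable_ofReal_wt L).comp (measurable_fst.comp measurable_snd))).mul
      ((measurable_ofReal_wt L).comp (measurable_snd.comp measurable_snd))
  set g : ℝ → ℝ → ℝ → ℝ≥0∞ := fun x y z => Q.indicator W (x, y, z) with hgdef
  have hlow : ENNReal.ofReal (α / 16) * (ENNReal.ofReal (β / 8) * ENNReal.ofReal (α / 4)) ≤
      ∫⁻ x, ∫⁻ y, ∫⁻ z, g x y z := by
    refine mul_le_lintegral hAm hA' fun x hx => ?_
    have hS : MeasurableSet {y | (x, y) ∈ B} := measurable_prodMk_left hBm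
    have := mul_le_lintegral hS (hB' x hx) (k := ENNReal.ofReal (α / 4) * ENNReal.ofReal (wt L x))
      (h := fun y => ∫⁻ z, g x y z) fun y hy => ?_
    · calc _ = _ := by ring
        _ ≤ _ := this
    · have hS' : MeasurableSet {z | (x, y, z) ∈ D} := 
        (measurable_const.prodMk (measurable_const.prodMk measurable_id) :
          Measurable fun z : ℝ => (x, y, z)) hDm
      have := mul_le_lintegral hS' (hD' x y hy)
        (k := ENNReal.ofReal (wt L y) * ENNReal.ofReal (wt L x))
        (h := fun z => g x y z) fun z hz => ?_
      · calc _ = _ := by ring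
          _ ≤ _ := this
      · simp only [hgdef]
        rw [indicator_of_mem (show (x, y, z) ∈ Q from ⟨hx, hy, hz⟩)]
        exact le_of_eq (by simp only [hW]; ring)
  rw [← lintegral_fin_three g (hWm.indicator hQm)] at hlow
  set Ω : Set (Fin 3 → ℝ) := {t | (t 0, t 1, t 2) ∈ Q} with hΩ
  have hm3 : Measurable fun t : Fin 3 → ℝ => (t 0, t 1, t 2) := by fun_prop
  have hΩm : MeasurableSet Ω := hm3 hQm
  set d := min c 1 * c₀ * (a ^ 2 * b) with hd
  have hd1 : 0 < min c 1 := lt_min hc one_pos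
  have hd0 : 0 < d := by positivity
  have hup : ENNReal.ofReal d * ∫⁻ t : Fin 3 → ℝ, g (t 0) (t 1) (t 2) ≤ 6 * volume E := by
    have e1 : ∫⁻ t : Fin 3 → ℝ, g (t 0) (t 1) (t 2) =
        ∫⁻ t in Ω, W (t 0, t 1, t 2) := by
      rw [← lintegral_indicator hΩm]
      rfl
    have e2 : ENNReal.ofReal d * ∫⁻ t in Ω, W (t 0, t 1, t 2) ≤
        ∫⁻ t in Ω, ENNReal.ofReal |alternant (velocity P) (t 0) (t 1) (t 2)| := by
      have hm : Measurable fun t : Fin 3 → ℝ => W (t 0, t 1, t 2) := hWm.comp hm3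
      rw [← lintegral_const_mul _ hm]
      refine setLIntegral_mono' hΩm fun t ht => ?_
      obtain ⟨⟨f1, f2, f3⟩, ⟨f4, f5, f6, f7⟩, f8, f9, f10, f11, f12⟩ := ht
      have := le_abs_alternant hc hg hu f1 f4 f8 ha0 hb0 f3 f6 f10 f7 f11 f12
      simp only [hW]
      rw [← ENNReal.ofReal_mul (wt_nonneg _ _),
        ← ENNReal.ofReal_mul (mul_nonneg (wt_nonneg _ _) (wt_nonneg _ _)),
        ← ENNReal.ofReal_mul hd0.le]
      exact ENNReal.ofReal_le_ofReal this
    have hpre := (PiLp.volume_preserving_toLp (Fin 3)).measure_preimage hE.nullMeasurableSet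
    rw [e1, ← hpre]
    refine e2.trans (lintegral_abs_alternant_le hK hg (x₀ := fun i => x₀ i) hΩm ?_ ?_)
    · intro t ht j
      obtain ⟨f1, f2, f3⟩ := ht
      fin_cases j
      exacts [f1.1, f2.1, f3.1]
    · intro t ht
      have := ht.2.2.2.1
      have he : WithLp.toLp 2 (fun i => x₀ i - (P i).eval (t 0) + (P i).eval (t 1) -
          (P i).eval (t 2)) = x₀ - curve P (t 0) + curve P (t 1) - curve P (t 2) := by
        ext i
        simp [curve]
      rw [mem_preimage, he]
      exact this
  have hfin := (mul_le_mul_right hlow (ENNReal.ofReal d)).trans hup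
  rw [← ENNReal.ofReal_mul (by positivity), ← ENNReal.ofReal_mul (by positivity),
    ← ENNReal.ofReal_mul (by positivity)] at hfin
  rw [← ENNReal.mul_le_mul_iff_right (a := 6) (by norm_num) (by norm_num)]
  refine le_trans (le_of_eq ?_) hfin
  rw [show (6 : ℝ≥0∞) = ENNReal.ofReal 6 by simp, ← ENNReal.ofReal_mul (by norm_num)]
  congr 1
  rw [hd, ha, hb]
  ring

/-! ### The restricted weak type estimate on one interval -/

/-- The bilinear form `⟨1_F, A 1_E⟩` of the averaging operator with respect to the measure `ν`. -/
noncomputable def form (ν : Measure ℝ) (P : Fin 3 → ℝ[X])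
    (E F : Set (EuclideanSpace ℝ (Fin 3))) : ℝ≥0∞ :=
  ∫⁻ x in F, ν {t | x - curve P t ∈ E}

theorem measurable_measure_sub_mem (ν : Measure ℝ) [SFinite ν] (P : Fin 3 → ℝ[X])
    {E : Set (EuclideanSpace ℝ (Fin 3))} (hE : MeasurableSet E) :
    Measurable fun x => ν {t | x - curve P t ∈ E} := by
  have hγ := measurable_curve P
  have m : Measurable fun q : EuclideanSpace ℝ (Fin 3) × ℝ => q.1 - curve P q.2 := by fun_prop
  exact measurable_measure_prodMk_left (m hE)

theorem measurable_measure_add_mem (ν : Measure ℝ) [SFinite ν] (P : Fin 3 → ℝ[X])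
    {E : Set (EuclideanSpace ℝ (Fin 3))} (hE : MeasurableSet E) :
    Measurable fun x => ν {t | x + curve P t ∈ E} := by
  have hγ := measurable_curve P
  have m : Measurable fun q : EuclideanSpace ℝ (Fin 3) × ℝ => q.1 + curve P q.2 := by fun_prop
  exact measurable_measure_prodMk_left (m hE)

/-- The form as an integral over `E`: the adjoint of the operator. -/
theorem form_eq (ν : Measure ℝ) [SFinite ν] (P : Fin 3 → ℝ[X])
    {E F : Set (EuclideanSpace ℝ (Fin 3))} (hE : MeasurableSet E) (hF : MeasurableSet F) :
    form ν P E F = ∫⁻ y in E, ν {t | y + curve P t ∈ F} := by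
  have hγ := measurable_curve P
  have m1 : Measurable fun q : EuclideanSpace ℝ (Fin 3) × ℝ => q.1 - curve P q.2 := by fun_prop
  have m2 : Measurable fun q : EuclideanSpace ℝ (Fin 3) × ℝ => q.1 + curve P q.2 := by fun_prop
  have hE1 : Measurable (E.indicator (1 : EuclideanSpace ℝ (Fin 3) → ℝ≥0∞)) :=
    measurable_one.indicator hE
  have hF1 : Measurable (F.indicator (1 : EuclideanSpace ℝ (Fin 3) → ℝ≥0∞)) :=
    measurable_one.indicator hF
  calc form ν P E F
      = ∫⁻ x, ∫⁻ t, F.indicator 1 x * E.indicator 1 (x - curve P t) ∂ν := by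
        rw [form, ← lintegral_indicator hF]
        refine lintegral_congr fun x => ?_
        have hx : Measurable fun t => x - curve P t := by fun_prop
        have hm : MeasurableSet {t | x - curve P t ∈ E} := hx hE
        have hx' : Measurable fun t =>
            E.indicator (1 : EuclideanSpace ℝ (Fin 3) → ℝ≥0∞) (x - curve P t) := hE1.comp hx
        rw [lintegral_const_mul _ hx']
        by_cases hxS : x ∈ F
        · simp only [indicator_of_mem hxS, Pi.one_apply, one_mul]
          rw [← lintegral_indicator_one hm]
          rfl
        · simp [hxS]
    _ = ∫⁻ t, ∫⁻ x, F.indicator 1 x * E.indicator 1 (x - curve P t) ∂volume ∂ν :=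
        lintegral_lintegral_swap
          (((hF1.comp measurable_fst).mul (hE1.comp m1)).aemeasurable)
    _ = ∫⁻ t, ∫⁻ y, F.indicator 1 (y + curve P t) * E.indicator 1 y ∂volume ∂ν := by
        refine lintegral_congr fun t => ?_
        rw [← lintegral_add_right_eq_self _ (curve P t)]
        simp
    _ = ∫⁻ y, ∫⁻ t, F.indicator 1 (y + curve P t) * E.indicator 1 y ∂ν :=
        (lintegral_lintegral_swap
          (((hF1.comp m2).mul (hE1.comp measurable_fst)).aemeasurable)).symm
    _ = ∫⁻ y in E, ν {t | y + curve P t ∈ F} := by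
        rw [← lintegral_indicator hE]
        refine lintegral_congr fun x => ?_
        have hx : Measurable fun t => x + curve P t := by fun_prop
        have hm : MeasurableSet {t | x + curve P t ∈ F} := hx hF
        have hx' : Measurable fun t =>
            F.indicator (1 : EuclideanSpace ℝ (Fin 3) → ℝ≥0∞) (x + curve P t) := hF1.comp hx
        rw [lintegral_mul_const _ hx']
        by_cases hxS : x ∈ E
        · simp only [indicator_of_mem hxS, Pi.one_apply, mul_one]
          rw [← lintegral_indicator_one hm]
          rfl
        · simp [hxS]

/-- Discarding the part of a set of finite measure where a function is below a threshold. -/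
theorem setLIntegral_le_add_superlevel {α : Type*} [MeasurableSpace α] {μ : Measure α}
    {f : α → ℝ≥0∞} (hf : Measurable f) (S : Set α) (θ : ℝ≥0∞) :
    ∫⁻ x in S, f x ∂μ ≤ ∫⁻ x in S ∩ {x | θ ≤ f x}, f x ∂μ + θ * μ S := by
  have hm : MeasurableSet {x | θ ≤ f x} := measurableSet_le measurable_const hf
  rw [← lintegral_inter_add_sdiff f S hm]
  gcongr
  calc ∫⁻ x in S \ {x | θ ≤ f x}, f x ∂μ ≤ ∫⁻ _x in S \ {x | θ ≤ f x}, θ ∂μ := by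
        rw [sdiff_eq, inter_comm, ← Measure.restrict_restrict hm.compl]
        exact setLIntegral_mono' hm.compl fun x hx => (not_le.1 (show ¬θ ≤ f x from hx)).le
    _ = θ * μ (S \ {x | θ ≤ f x}) := setLIntegral_const _ _
    _ ≤ θ * μ S := by gcongr; exact sdiff_subset

/-- The constant in the estimate on one interval. -/
noncomputable def stepConst (c c₀ : ℝ) : ℝ := min c 1 * c₀ / 100663296

/-- The estimate for sets of finite measure and a bounded interval, by successive refinement of
`F` and `E`. -/
theorem form_pow_le {c c₀ : ℝ} (hc : 0 < c) (hc₀ : 0 < c₀) {P : Fin 3 → ℝ[X]}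
    {K : Set ℝ} (hK : K.OrdConnected) (hg : GeomIneq c (velocity P) K) {u : ℝ → ℝ}
    (hu : IsVariable c₀ (wron (velocity P)) K u) (hfin : wtMeasure (wron (velocity P)) K ≠ ∞)
    {E F : Set (EuclideanSpace ℝ (Fin 3))} (hE : MeasurableSet E) (hF : MeasurableSet F)
    (hE' : volume E ≠ ∞) (hF' : volume F ≠ ∞) :
    ENNReal.ofReal (stepConst c c₀) *
      form ((wtMeasure (wron (velocity P))).restrict K) P E F ^ 6 ≤
        volume E ^ 3 * volume F ^ 4 := by
  have : SFinite (wtMeasure (wron (velocity P))) := by unfold wtMeasure; infer_instance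
  set ν := (wtMeasure (wron (velocity P))).restrict K with hν
  have hνfin : ν univ ≠ ∞ := by rwa [hν, Measure.restrict_apply_univ]
  set T := form ν P E F with hT
  have hTF : T ≤ ν univ * volume F := by
    rw [hT, form, ← setLIntegral_const]
    exact lintegral_mono fun x => measure_mono (subset_univ _)
  have hTE : T ≤ ν univ * volume E := by
    rw [hT, form_eq ν P hE hF, ← setLIntegral_const]
    exact lintegral_mono fun x => measure_mono (subset_univ _)
  have hTfin : T ≠ ∞ := ne_top_of_le_ne_top (ENNReal.mul_ne_top hνfin hF') hTF
  rcases eq_or_ne T 0 with h0 | h0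
  · rw [h0]; simp
  have hF0 : volume F ≠ 0 := fun h => h0 (by rw [h, mul_zero] at hTF; simpa using hTF)
  have hE0 : volume E ≠ 0 := fun h => h0 (by rw [h, mul_zero] at hTE; simpa using hTE)
  set τ := T.toReal with hτ
  set e := (volume E).toReal with he
  set f := (volume F).toReal with hf
  have hτ0 : 0 < τ := ENNReal.toReal_pos h0 hTfin
  have he0 : 0 < e := ENNReal.toReal_pos hE0 hE'
  have hf0 : 0 < f := ENNReal.toReal_pos hF0 hF'
  have eT : T = ENNReal.ofReal τ := (ENNReal.ofReal_toReal hTfin).symm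
  have eE : volume E = ENNReal.ofReal e := (ENNReal.ofReal_toReal hE').symm
  have eF : volume F = ENNReal.ofReal f := (ENNReal.ofReal_toReal hF').symm
  set α := τ / f with hα
  set β := τ / e with hβ
  have hα0 : 0 < α := by positivity
  have hβ0 : 0 < β := by positivity
  have hαf : α * f = τ := by rw [hα]; field_simp
  have hβe : β * e = τ := by rw [hβ]; field_simp
  have hsub : ∀ {X : ℝ≥0∞} {r s : ℝ}, 0 ≤ s → ENNReal.ofReal r ≤ X + ENNReal.ofReal s →
      ENNReal.ofReal (r - s) ≤ X := by
    intro X r s hs h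
    rw [ENNReal.ofReal_sub _ hs]
    exact tsub_le_iff_right.2 h
  -- the points of `F` from which `E` is reached often
  set F₁ := F ∩ {x | ENNReal.ofReal (α / 2) ≤ ν {t | x - curve P t ∈ E}} with hF₁
  have hma := measurable_measure_sub_mem ν P hE
  have hF₁m : MeasurableSet F₁ := hF.inter (measurableSet_le measurable_const hma)
  have hT₁ : ENNReal.ofReal (τ / 2) ≤ form ν P E F₁ := by
    have h := setLIntegral_le_add_superlevel (μ := volume) hma F (ENNReal.ofReal (α / 2))
    rw [show ∫⁻ x in F, ν {t | x - curve P t ∈ E} = ENNReal.ofReal τ from eT, eF,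
      ← ENNReal.ofReal_mul (by positivity), show α / 2 * f = τ / 2 by linarith] at h
    have := hsub (by positivity) h
    rwa [show τ - τ / 2 = τ / 2 by ring] at this
  -- the points of `E` which are reached often from `F₁`
  set E₁ := E ∩ {y | ENNReal.ofReal (β / 4) ≤ ν {t | y + curve P t ∈ F₁}} with hE₁
  have hmb := measurable_measure_add_mem ν P hF₁m
  have hE₁m : MeasurableSet E₁ := hE.inter (measurableSet_le measurable_const hmb)
  have hT₂ : ENNReal.ofReal (τ / 4) ≤ form ν P E₁ F₁ := by
    rw [form_eq ν P hE hF₁m] at hT₁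
    rw [form_eq ν P hE₁m hF₁m]
    have h := hT₁.trans
      (setLIntegral_le_add_superlevel (μ := volume) hmb E (ENNReal.ofReal (β / 4)))
    rw [eE, ← ENNReal.ofReal_mul (by positivity), show β / 4 * e = τ / 4 by linarith] at h
    have := hsub (by positivity) h
    rwa [show τ / 2 - τ / 4 = τ / 4 by ring] at this
  have hx₀ : ∃ x₀, ENNReal.ofReal (α / 8) ≤ ν {t | x₀ - curve P t ∈ E₁} := by
    by_contra! hcon
    have : form ν P E₁ F₁ ≤ ENNReal.ofReal (τ / 8) := by
      calc form ν P E₁ F₁ ≤ ∫⁻ _x in F₁, ENNReal.ofReal (α / 8) :=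
            lintegral_mono fun x => (hcon x).le
        _ = ENNReal.ofReal (α / 8) * volume F₁ := setLIntegral_const _ _
        _ ≤ ENNReal.ofReal (α / 8) * volume F := by gcongr; exact inter_subset_left
        _ = ENNReal.ofReal (τ / 8) := by
            rw [eF, ← ENNReal.ofReal_mul (by positivity)]; congr 1; linarith
    have h2 := hT₂.trans this
    rw [ENNReal.ofReal_le_ofReal_iff (by positivity)] at h2
    linarith
  obtain ⟨x₀, hx₀⟩ := hx₀
  have hmain := le_volume_of_three_steps hc hc₀ hK hg hu hE hF₁m hE₁m hα0 hβ0
    (fun x hx => hx.2) (fun y hy => hy.2) hx₀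
  rw [← stepConst, eE, ENNReal.ofReal_le_ofReal_iff he0.le] at hmain
  have hk0 : 0 < stepConst c c₀ := by
    unfold stepConst
    have : 0 < min c 1 := lt_min hc one_pos
    positivity
  rw [eT, eE, eF, ← ENNReal.ofReal_pow hτ0.le, ← ENNReal.ofReal_pow he0.le,
    ← ENNReal.ofReal_pow hf0.le, ← ENNReal.ofReal_mul hk0.le, ← ENNReal.ofReal_mul (by positivity)]
  refine ENNReal.ofReal_le_ofReal ?_
  have h6 : α ^ 4 * β ^ 2 = τ ^ 6 / (f ^ 4 * e ^ 2) := by rw [hα, hβ]; field_simp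
  rw [h6, ← mul_div_assoc, div_le_iff₀ (by positivity)] at hmain
  calc _ ≤ e * (f ^ 4 * e ^ 2) := hmain
    _ = _ := by ring

/-- The estimate on one interval. -/
theorem form_restrict_le {c c₀ : ℝ} (hc : 0 < c) (hc₀ : 0 < c₀) {P : Fin 3 → ℝ[X]}
    {K : Set ℝ} (hK : K.OrdConnected) (hg : GeomIneq c (velocity P) K) {u : ℝ → ℝ}
    (hu : IsVariable c₀ (wron (velocity P)) K u)
    {E F : Set (EuclideanSpace ℝ (Fin 3))} (hE : MeasurableSet E) (hF : MeasurableSet F) :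
    form ((wtMeasure (wron (velocity P))).restrict K) P E F ≤
      ENNReal.ofReal (stepConst c c₀ ^ (-(1 : ℝ) / 6)) *
        (volume E ^ ((1 : ℝ) / 2) * volume F ^ ((2 : ℝ) / 3)) := by
  set L := wron (velocity P) with hL
  have : SFinite (wtMeasure L) := by unfold wtMeasure; infer_instance
  have hk0 : 0 < stepConst c c₀ := by
    unfold stepConst
    have : 0 < min c 1 := lt_min hc one_pos
    positivity
  have hk6 : 0 < stepConst c c₀ ^ (-(1 : ℝ) / 6) := Real.rpow_pos_of_pos hk0 _
  -- sets of infinite measure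
  by_cases hE0 : volume E = 0
  · have : form ((wtMeasure L).restrict K) P E F = 0 := by
      rw [form_eq _ P hE hF, Measure.restrict_eq_zero.2 hE0, lintegral_zero_measure]
    rw [this]; exact zero_le
  by_cases hF0 : volume F = 0
  · have : form ((wtMeasure L).restrict K) P E F = 0 := by
      rw [form, Measure.restrict_eq_zero.2 hF0, lintegral_zero_measure]
    rw [this]; exact zero_le
  by_cases hE' : volume E = ∞
  · rw [hE', ENNReal.top_rpow_of_pos (by norm_num), ENNReal.top_mul (fun h => hF0 ((ENNReal.rpow_eq_zero_iff_of_pos (by norm_num)).1 h)),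
      ENNReal.mul_top (by simpa using hk6)]
    exact le_top
  by_cases hF' : volume F = ∞
  · rw [hF', ENNReal.top_rpow_of_pos (by norm_num), ENNReal.mul_top (by simp [hE0, hE']),
      ENNReal.mul_top (by simpa using hk6)]
    exact le_top
  -- bounded pieces of `K`
  set Kn : ℕ → Set ℝ := fun n => K ∩ Icc (-(n : ℝ)) n with hKn
  have hmono : Monotone Kn := by
    intro m n hmn
    have : (m : ℝ) ≤ n := by exact_mod_cast hmn
    exact inter_subset_inter_right _ (Icc_subset_Icc (by linarith) this)
  have hU : K = ⋃ n, Kn n := by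
    rw [hKn, ← inter_iUnion]
    have : (⋃ n : ℕ, Icc (-(n : ℝ)) n) = univ := by
      refine eq_univ_of_forall fun t => ?_
      obtain ⟨n, hn⟩ := exists_nat_ge |t|
      exact mem_iUnion.2 ⟨n, abs_le.1 hn⟩
    rw [this, inter_univ]
  have hpiece : ∀ n, form ((wtMeasure L).restrict (Kn n)) P E F ≤
      ENNReal.ofReal (stepConst c c₀ ^ (-(1 : ℝ) / 6)) *
        (volume E ^ ((1 : ℝ) / 2) * volume F ^ ((2 : ℝ) / 3)) := by
    intro n
    have hsub : Kn n ⊆ K := inter_subset_left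
    have hu' : IsVariable c₀ L (Kn n) u := ⟨hu.measurable, fun t ht => hu.nonneg t (hsub ht),
      hu.measure_le, fun x hx y hy z hz => hu.kernel_le x (hsub hx) y (hsub hy) z (hsub hz)⟩
    have hfin : wtMeasure L (Kn n) ≠ ∞ := by
      refine ne_top_of_le_ne_top ?_ (measure_mono inter_subset_right)
      rw [wtMeasure_Icc L 0 (by linarith [Nat.cast_nonneg (α := ℝ) n])]
      exact ENNReal.ofReal_ne_top
    have h := form_pow_le hc hc₀ (hK.inter ordConnected_Icc) (hg.mono hsub) hu' hfin hE hF hE' hF'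
    have h' := ENNReal.rpow_le_rpow h (show (0 : ℝ) ≤ 1 / 6 by norm_num)
    have hh : (0 : ℝ) ≤ 1 / 6 := by norm_num
    rw [ENNReal.mul_rpow_of_nonneg _ _ hh, ENNReal.mul_rpow_of_nonneg _ _ hh,
      ← ENNReal.rpow_natCast, ← ENNReal.rpow_natCast, ← ENNReal.rpow_natCast,
      ← ENNReal.rpow_mul, ← ENNReal.rpow_mul, ← ENNReal.rpow_mul,
      ENNReal.ofReal_rpow_of_pos hk0] at h'
    norm_num at h'
    have h1 : ENNReal.ofReal (stepConst c c₀ ^ (-(1 : ℝ) / 6)) *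
        ENNReal.ofReal (stepConst c c₀ ^ ((1 : ℝ) / 6)) = 1 := by
      rw [← ENNReal.ofReal_mul hk6.le, ← Real.rpow_add hk0]
      norm_num
    calc form ((wtMeasure L).restrict (Kn n)) P E F
        = ENNReal.ofReal (stepConst c c₀ ^ (-(1 : ℝ) / 6)) *
          (ENNReal.ofReal (stepConst c c₀ ^ ((1 : ℝ) / 6)) *
            form ((wtMeasure L).restrict (Kn n)) P E F) := by rw [← mul_assoc, h1, one_mul]
      _ ≤ _ := by gcongr
  have hmeas : ∀ x, (wtMeasure L).restrict K {t | x - curve P t ∈ E} =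
      ⨆ n, (wtMeasure L).restrict (Kn n) {t | x - curve P t ∈ E} := by
    intro x
    have hm : MeasurableSet {t | x - curve P t ∈ E} := by
      have hγ := measurable_curve P
      have : Measurable fun t => x - curve P t := by fun_prop
      exact this hE
    simp only [Measure.restrict_apply hm]
    rw [← Monotone.measure_iUnion, ← inter_iUnion, ← hU]
    exact fun m n hmn => inter_subset_inter_right _ (hmono hmn)
  rw [form]
  simp only [hmeas]
  rw [lintegral_iSup (fun n => measurable_measure_sub_mem _ P hE)]
  · exact iSup_le hpiece
  · intro m n hmn x
    exact Measure.restrict_mono (hmono hmn) le_rfl _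

/-! ### The restricted weak type estimates on the line -/

theorem natDegree_velocity_le {N : ℕ} {P : Fin 3 → ℝ[X]} (hP : ∀ i, (P i).natDegree ≤ N)
    (i : Fin 3) : (velocity P i).natDegree ≤ N :=
  (natDegree_derivative_le _).trans ((Nat.sub_le _ _).trans (hP i))

/-- The estimate `⟨1_F, A 1_E⟩ ≤ C |E| ^ {1/2} |F| ^ {2/3}`, uniformly over polynomial curves of
bounded degree. -/
theorem exists_form_le (N : ℕ) : ∃ C : ℝ≥0, ∀ P : Fin 3 → ℝ[X], (∀ i, (P i).natDegree ≤ N) →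
    ∀ E F : Set (EuclideanSpace ℝ (Fin 3)), MeasurableSet E → MeasurableSet F →
      form (wtMeasure (wron (velocity P))) P E F ≤
        C * (volume E ^ ((1 : ℝ) / 2) * volume F ^ ((2 : ℝ) / 3)) := by
  obtain ⟨c, M, hc, hcov⟩ := exists_coveredBy_compl N
  obtain ⟨c₀, hc₀, hvar⟩ := IsGood.exists_isVariable (3 * N)
  refine ⟨M * Real.toNNReal (stepConst c c₀ ^ (-(1 : ℝ) / 6)), fun P hP E F hE hF => ?_⟩
  have hv := natDegree_velocity_le hP
  set L := wron (velocity P) with hL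
  by_cases h0 : L = 0
  · have : wtMeasure L = 0 := by
      have hz : (fun t => ENNReal.ofReal (wt L t)) = 0 := by
        funext t
        simp [wt, h0, Real.zero_rpow]
      rw [wtMeasure, hz, withDensity_zero]
    rw [form, this]
    simp
  obtain ⟨B, 𝒦, hcard, hgood, hsub⟩ := hcov (velocity P) hv h0
  have hB : wtMeasure L B = 0 := by
    have : wtMeasure L ≪ volume := withDensity_absolutelyContinuous _ _
    exact this (B.finite_toSet.measure_zero _)
  have hle : ∀ S, wtMeasure L S ≤ ∑ K ∈ 𝒦, (wtMeasure L).restrict K S := by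
    intro S
    calc wtMeasure L S ≤ wtMeasure L ((B : Set ℝ) ∪ ⋃ K ∈ 𝒦, S ∩ K) := by
          refine measure_mono fun t ht => ?_
          by_cases htB : t ∈ (B : Set ℝ)
          · exact Or.inl htB
          · obtain ⟨K, hK, htK⟩ := mem_iUnion₂.1 (hsub htB)
            exact Or.inr (mem_iUnion₂.2 ⟨K, hK, ht, htK⟩)
      _ ≤ wtMeasure L B + wtMeasure L (⋃ K ∈ 𝒦, S ∩ K) := measure_union_le _ _
      _ ≤ 0 + ∑ K ∈ 𝒦, wtMeasure L (S ∩ K) := by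
          gcongr
          · exact hB.le
          · exact measure_biUnion_finset_le _ _
      _ = ∑ K ∈ 𝒦, (wtMeasure L).restrict K S := by
          rw [zero_add]
          refine Finset.sum_congr rfl fun K hK => ?_
          rw [Measure.restrict_apply' (hgood K hK).ordConnected.measurableSet]
  have : SFinite (wtMeasure L) := by unfold wtMeasure; infer_instance
  calc form (wtMeasure L) P E F
      ≤ ∫⁻ x in F, ∑ K ∈ 𝒦, (wtMeasure L).restrict K {t | x - curve P t ∈ E} :=
        lintegral_mono fun x => hle _
    _ = ∑ K ∈ 𝒦, form ((wtMeasure L).restrict K) P E F :=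
        lintegral_finsetSum _ fun K _ => measurable_measure_sub_mem _ P hE
    _ ≤ ∑ _K ∈ 𝒦, ENNReal.ofReal (stepConst c c₀ ^ (-(1 : ℝ) / 6)) *
        (volume E ^ ((1 : ℝ) / 2) * volume F ^ ((2 : ℝ) / 3)) := by
        refine Finset.sum_le_sum fun K hK => ?_
        obtain ⟨u, hu⟩ := hvar c (velocity P) K (natDegree_wron_le hv) (hgood K hK)
        exact form_restrict_le hc hc₀ (hgood K hK).ordConnected (hgood K hK).geomIneq hu hE hF
    _ = (𝒦.card : ℝ≥0∞) * (ENNReal.ofReal (stepConst c c₀ ^ (-(1 : ℝ) / 6)) *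
        (volume E ^ ((1 : ℝ) / 2) * volume F ^ ((2 : ℝ) / 3))) := by
        rw [Finset.sum_const, nsmul_eq_mul]
    _ ≤ (M : ℝ≥0∞) * (ENNReal.ofReal (stepConst c c₀ ^ (-(1 : ℝ) / 6)) *
        (volume E ^ ((1 : ℝ) / 2) * volume F ^ ((2 : ℝ) / 3))) := by
        gcongr
    _ = _ := by
        push_cast
        rw [mul_assoc]
        rfl

theorem wtMeasure_neg_curve (P : Fin 3 → ℝ[X]) :
    wtMeasure (wron (velocity (-P))) = wtMeasure (wron (velocity P)) := by
  have : wron (velocity (-P)) = -wron (velocity P) := by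
    simp only [wron_eq, velocity, Pi.neg_apply, derivative_neg]
    ring
  simp only [wtMeasure, wt, this, eval_neg, abs_neg]

/-- The adjoint is the averaging operator of the reflected curve. -/
theorem form_neg (ν : Measure ℝ) [SFinite ν] (P : Fin 3 → ℝ[X])
    {E F : Set (EuclideanSpace ℝ (Fin 3))} (hE : MeasurableSet E) (hF : MeasurableSet F) :
    form ν P E F = form ν (-P) F E := by
  rw [form_eq ν P hE hF, form]
  have : ∀ t, curve (-P) t = -curve P t := by
    intro t
    ext i
    simp [curve]
  simp only [this, sub_neg_eq_add]

/-- The dual estimate `⟨1_F, A 1_E⟩ ≤ C |E| ^ {2/3} |F| ^ {1/2}`. -/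
theorem exists_form_le' (N : ℕ) : ∃ C : ℝ≥0, ∀ P : Fin 3 → ℝ[X], (∀ i, (P i).natDegree ≤ N) →
    ∀ E F : Set (EuclideanSpace ℝ (Fin 3)), MeasurableSet E → MeasurableSet F →
      form (wtMeasure (wron (velocity P))) P E F ≤
        C * (volume E ^ ((2 : ℝ) / 3) * volume F ^ ((1 : ℝ) / 2)) := by
  obtain ⟨C, hC⟩ := exists_form_le N
  refine ⟨C, fun P hP E F hE hF => ?_⟩
  have : SFinite (wtMeasure (wron (velocity P))) := by unfold wtMeasure; infer_instance
  have h := hC (-P) (fun i => by simpa using hP i) F E hF hE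
  rw [wtMeasure_neg_curve, ← form_neg _ P hE hF] at h
  rwa [mul_comm (volume E ^ _)]

theorem affineDensity_eq (P : Fin 3 → ℝ[X]) (t : ℝ) :
    affineDensity P t = wt (wron (velocity P)) t := by
  have h1 : torsion P t = (wron (velocity P)).eval t := by
    rw [torsion, wron, ← coe_evalRingHom, RingHom.map_det]
    congr 1
  rw [affineDensity, wt, h1]
  norm_num

/-! ### From restricted weak type to Lorentz spaces -/

theorem measurable_sub_curve (P : Fin 3 → ℝ[X]) :
    Measurable fun q : EuclideanSpace ℝ (Fin 3) × ℝ => q.1 - curve P q.2 := by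
  have := measurable_curve P
  fun_prop

theorem measurable_sub_curve_right (P : Fin 3 → ℝ[X]) (x : EuclideanSpace ℝ (Fin 3)) :
    Measurable fun t => x - curve P t := by
  have := measurable_curve P
  fun_prop

/-- The layer cake formula for the averages over a set `F`. -/
theorem setLIntegral_lintegral_sub_curve (ν : Measure ℝ) [SFinite ν] (P : Fin 3 → ℝ[X])
    {f : EuclideanSpace ℝ (Fin 3) → ℂ} (hf : Measurable f)
    (F : Set (EuclideanSpace ℝ (Fin 3))) :
    ∫⁻ x in F, ∫⁻ t, ‖f (x - curve P t)‖ₑ ∂ν =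
      ∫⁻ s in Ioi (0 : ℝ), form ν P {y | s < ‖f y‖} F := by
  have hm := measurable_sub_curve P
  set μ := ((volume.restrict F).prod ν).map
    fun q : EuclideanSpace ℝ (Fin 3) × ℝ => q.1 - curve P q.2 with hμ
  have h1 : ∫⁻ x in F, ∫⁻ t, ‖f (x - curve P t)‖ₑ ∂ν = ∫⁻ y, ENNReal.ofReal ‖f y‖ ∂μ := by
    simp only [ofReal_norm]
    have hfm : Measurable fun q : EuclideanSpace ℝ (Fin 3) × ℝ => ‖f (q.1 - curve P q.2)‖ₑ :=
      hf.enorm.comp hm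
    rw [hμ, lintegral_map hf.enorm hm, lintegral_prod _ hfm.aemeasurable]
  have h2 : ∀ {A : Set (EuclideanSpace ℝ (Fin 3))}, MeasurableSet A → μ A = form ν P A F := by
    intro A hA
    rw [hμ, Measure.map_apply hm hA, Measure.prod_apply (hm hA)]
    rfl
  rw [h1, lintegral_eq_lintegral_meas_lt μ (Filter.Eventually.of_forall fun y => norm_nonneg _)
    hf.norm.aemeasurable]
  refine lintegral_congr fun s => ?_
  exact h2 (measurableSet_lt measurable_const hf.norm)

theorem lorentzNorm_one {α : Type*} [MeasurableSpace α] {p : ℝ} {μ : Measure α} {f : α → ℂ} :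
    lorentzNorm p 1 μ f =
      ENNReal.ofReal p * ∫⁻ s in Ioi (0 : ℝ), distribFun μ f s ^ (1 / p) := by
  rw [lorentzNorm, if_neg ENNReal.one_ne_top]
  simp only [ENNReal.toReal_one, ENNReal.rpow_one, div_one]
  congr 1
  refine setLIntegral_congr_fun measurableSet_Ioi fun s hs => ?_
  have h0 : ENNReal.ofReal s ≠ 0 := by simpa using hs
  rw [mul_comm]
  exact ENNReal.mul_div_cancel_right h0 ENNReal.ofReal_ne_top

/-- A function whose integral over every set `F` of finite measure is at most `D |F| ^ {1 - 1/q}`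
is in weak `L^q`. -/
theorem mul_measure_rpow_le {α : Type*} [MeasurableSpace α] {μ : Measure α} [SigmaFinite μ]
    {G : α → ℝ≥0∞} (hG : Measurable G) {D : ℝ≥0∞} {q : ℝ} (hq : 0 < q)
    (h : ∀ F, MeasurableSet F → ∫⁻ x in F, G x ∂μ ≤ D * μ F ^ (1 - 1 / q)) (s : ℝ≥0∞) :
    s * μ {x | s < G x} ^ (1 / q) ≤ D := by
  have hq' : 0 < 1 / q := by positivity
  have hSm : MeasurableSet {x | s < G x} := measurableSet_lt measurable_const hG
  have hpiece : ∀ n, s * μ ({x | s < G x} ∩ spanningSets μ n) ^ (1 / q) ≤ D := by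
    intro n
    set F := {x | s < G x} ∩ spanningSets μ n with hF
    have hFm : MeasurableSet F := hSm.inter (measurableSet_spanningSets μ n)
    have hfin : μ F ≠ ∞ :=
      ne_top_of_le_ne_top (measure_spanningSets_lt_top μ n).ne (measure_mono inter_subset_right)
    rcases eq_or_ne (μ F) 0 with h0 | h0
    · rw [h0, ENNReal.zero_rpow_of_pos hq', mul_zero]; exact zero_le
    have h1 : s * μ F ≤ D * μ F ^ (1 - 1 / q) := by
      refine le_trans ?_ (h F hFm)
      rw [← setLIntegral_const]
      exact setLIntegral_mono' hFm fun x hx => hx.1.le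
    have h2 : μ F ^ (1 - 1 / q) ≠ 0 := (ENNReal.rpow_pos (pos_iff_ne_zero.2 h0) hfin).ne'
    have h3 : μ F ^ (1 - 1 / q) ≠ ∞ := ENNReal.rpow_ne_top_of_ne_zero h0 hfin
    rw [← ENNReal.mul_le_mul_iff_left h2 h3]
    refine le_trans (le_of_eq ?_) h1
    rw [mul_assoc, ← ENNReal.rpow_add _ _ h0 hfin]
    simp
  have hU : {x | s < G x} = ⋃ n, {x | s < G x} ∩ spanningSets μ n := by
    rw [← inter_iUnion, iUnion_spanningSets, inter_univ]
  have hmono : Monotone fun n => {x | s < G x} ∩ spanningSets μ n :=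
    fun m n hmn => inter_subset_inter_right _ (monotone_spanningSets μ hmn)
  have hlim := tendsto_measure_iUnion_atTop hmono (μ := μ)
  rw [← hU] at hlim
  rcases eq_or_ne s 0 with rfl | hs0
  · simp
  rcases eq_or_ne s ∞ with rfl | hst
  · simp [ENNReal.zero_rpow_of_pos hq', -one_div]
  have hlim' := ENNReal.Tendsto.const_mul ((ENNReal.continuous_rpow_const (y := 1 / q)).continuousAt.tendsto.comp hlim)
    (Or.inr hst) (a := s)
  exact le_of_tendsto' hlim' hpiece

/-- The measure `|L| ^ {1/6} dt` of the curve `P`. -/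
noncomputable def affineMeasure (P : Fin 3 → ℝ[X]) : Measure ℝ := wtMeasure (wron (velocity P))

instance (P : Fin 3 → ℝ[X]) : SFinite (affineMeasure P) := by
  unfold affineMeasure wtMeasure; infer_instance

theorem lintegral_affineMeasure (P : Fin 3 → ℝ[X]) {h : ℝ → ℝ≥0∞} (hh : Measurable h) :
    ∫⁻ t, h t ∂(affineMeasure P) = ∫⁻ t, ENNReal.ofReal (affineDensity P t) * h t := by
  simp only [affineDensity_eq]
  rw [affineMeasure, wtMeasure, lintegral_withDensity_eq_lintegral_mul _ (measurable_ofReal_wt _) hh]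
  rfl

/-- Changing `f` on a null set changes the integrand on a null set, for almost every `x`. -/
theorem averageIntegrand_ae_eq (P : Fin 3 → ℝ[X]) {f g : EuclideanSpace ℝ (Fin 3) → ℂ}
    (hfg : f =ᵐ[volume] g) :
    ∀ᵐ x : EuclideanSpace ℝ (Fin 3), averageIntegrand P f x =ᵐ[volume] averageIntegrand P g x := by
  set Z := toMeasurable volume {y | ¬f y = g y} with hZ
  have hZm : MeasurableSet Z := measurableSet_toMeasurable _ _
  have hZ0 : volume Z = 0 := by
    rw [hZ, measure_toMeasurable]; exact hfg
  have h0 : form (affineMeasure P) P Z univ = 0 := by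
    rw [form_eq _ P hZm MeasurableSet.univ, Measure.restrict_eq_zero.2 hZ0,
      lintegral_zero_measure]
  rw [form, Measure.restrict_univ, lintegral_eq_zero_iff (measurable_measure_sub_mem _ P hZm)] at h0
  filter_upwards [h0] with x hx
  have h1 : ∀ᵐ t ∂(affineMeasure P), f (x - curve P t) = g (x - curve P t) := by
    rw [ae_iff]
    refine measure_mono_null (fun t ht => ?_) hx
    exact subset_toMeasurable _ _ ht
  rw [affineMeasure, wtMeasure, ae_withDensity_iff (measurable_ofReal_wt _)] at h1
  filter_upwards [h1] with t ht
  simp only [averageIntegrand, affineDensity_eq]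
  by_cases hw : ENNReal.ofReal (wt (wron (velocity P)) t) = 0
  · have : wt (wron (velocity P)) t = 0 :=
      le_antisymm (ENNReal.ofReal_eq_zero.1 hw) (wt_nonneg _ _)
    simp [this]
  · rw [ht hw]

/-- A restricted weak type estimate for the averaging operator implies the estimate from `L^{p,1}`
to `L^{q,∞}`. -/
theorem lorentz_bound {P : Fin 3 → ℝ[X]} {C : ℝ≥0} {p q : ℝ} (hp : 1 ≤ p) (hq : 0 < q)
    (hform : ∀ E F : Set (EuclideanSpace ℝ (Fin 3)), MeasurableSet E → MeasurableSet F →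
      form (affineMeasure P) P E F ≤ C * (volume E ^ (1 / p) * volume F ^ (1 - 1 / q)))
    {f : EuclideanSpace ℝ (Fin 3) → ℂ} (hf : MemLorentz p 1 volume f) :
    (∀ᵐ x : EuclideanSpace ℝ (Fin 3), Integrable (averageIntegrand P f x)) ∧
      MemLorentz q ∞ volume (average P f) ∧
      lorentzNorm q ∞ volume (average P f) ≤ C * lorentzNorm p 1 volume f := by
  obtain ⟨hfm, hfin⟩ := hf
  set g := hfm.mk f with hg
  have hgm : Measurable g := hfm.stronglyMeasurable_mk.measurable
  have hfg : f =ᵐ[volume] g := hfm.ae_eq_mk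
  have hae := averageIntegrand_ae_eq P hfg
  set J : ℝ≥0∞ := ∫⁻ s in Ioi (0 : ℝ), distribFun volume f s ^ (1 / p) with hJ
  have hJle : J ≤ lorentzNorm p 1 volume f := by
    rw [lorentzNorm_one]
    calc J = 1 * J := (one_mul _).symm
      _ ≤ _ := by gcongr; simpa using ENNReal.ofReal_le_ofReal hp
  have hdist : ∀ s, distribFun volume f s = volume {y | s < ‖g y‖} := by
    intro s
    refine measure_congr ?_
    filter_upwards [hfg] with y hy
    simp only [eq_iff_iff]
    change s < ‖f y‖ ↔ s < ‖g y‖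
    rw [hy]
  -- the averages of `|f|`
  set G : EuclideanSpace ℝ (Fin 3) → ℝ≥0∞ := fun x =>
    ∫⁻ t, ‖g (x - curve P t)‖ₑ ∂(affineMeasure P) with hG
  have hGm : Measurable G :=
    Measurable.lintegral_prod_right (hgm.enorm.comp (measurable_sub_curve P))
  have hGF : ∀ F, MeasurableSet F → ∫⁻ x in F, G x ≤ C * J * volume F ^ (1 - 1 / q) := by
    intro F hF
    rw [setLIntegral_lintegral_sub_curve _ P hgm]
    calc ∫⁻ s in Ioi (0 : ℝ), form (affineMeasure P) P {y | s < ‖g y‖} F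
        ≤ ∫⁻ s in Ioi (0 : ℝ), C * volume F ^ (1 - 1 / q) * distribFun volume f s ^ (1 / p) := by
          refine lintegral_mono fun s => ?_
          refine (hform _ F (measurableSet_lt measurable_const hgm.norm) hF).trans (le_of_eq ?_)
          rw [hdist]; ring
      _ = C * volume F ^ (1 - 1 / q) * J := by
          refine lintegral_const_mul _ (Measurable.pow_const ?_ _)
          refine Antitone.measurable fun s t hst => ?_
          exact measure_mono fun y (hy : t < ‖f y‖) => lt_of_le_of_lt hst hy
      _ = _ := by ring
  have hweak := fun s => mul_measure_rpow_le hGm hq hGF s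
  have hCJ : C * J < ∞ := ENNReal.mul_lt_top ENNReal.coe_lt_top (hJle.trans_lt hfin)
  have hGfin : ∀ᵐ x, G x < ∞ := by
    have hq' : 0 < 1 / q := by positivity
    rw [ae_iff]
    by_contra hne
    set S := {x | ¬G x < ∞} with hS
    have hpos : volume S ^ (1 / q) ≠ 0 := fun h =>
      hne ((ENNReal.rpow_eq_zero_iff_of_pos hq').1 h)
    have hle : ∀ n : ℕ, (n : ℝ≥0∞) * volume S ^ (1 / q) ≤ C * J := by
      intro n
      refine le_trans ?_ (hweak n)
      gcongr
      exact fun x (hx : ¬G x < ∞) =>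
        lt_of_lt_of_le (ENNReal.natCast_lt_top n) (not_lt.1 hx)
    obtain ⟨n, hn⟩ := ENNReal.exists_nat_mul_gt hpos hCJ.ne
    exact absurd (hle n) (not_le.2 hn)
  have hGeq : ∀ x, ∫⁻ t, ‖averageIntegrand P g x t‖ₑ = G x := by
    intro x
    rw [hG]
    simp only
    have hm : Measurable fun t => ‖g (x - curve P t)‖ₑ :=
      hgm.enorm.comp (measurable_sub_curve_right P x)
    rw [lintegral_affineMeasure P hm]
    refine lintegral_congr fun t => ?_
    have h0 : 0 ≤ affineDensity P t := by rw [affineDensity_eq]; exact wt_nonneg _ _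
    rw [averageIntegrand, enorm_smul, Real.enorm_of_nonneg h0]
  have hwm : Measurable (affineDensity P) := by
    rw [show affineDensity P = wt (wron (velocity P)) from funext (affineDensity_eq P)]
    exact (continuous_wt _).measurable
  have hint : ∀ᵐ x : EuclideanSpace ℝ (Fin 3), Integrable (averageIntegrand P f x) := by
    filter_upwards [hae, hGfin] with x hx hxG
    refine Integrable.congr ?_ hx.symm
    refine ⟨(hwm.smul (hgm.comp (measurable_sub_curve_right P x))).aestronglyMeasurable, ?_⟩
    rw [hasFiniteIntegral_iff_enorm, hGeq]
    exact hxG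
  have havg : ∀ᵐ x, average P f x = average P g x := by
    filter_upwards [hae] with x hx
    exact integral_congr_ae hx
  have hsm : AEStronglyMeasurable (average P f) volume := by
    refine ⟨average P g, ?_, havg⟩
    have hm : Measurable (Function.uncurry (averageIntegrand P g)) :=
      (hwm.comp measurable_snd).smul (hgm.comp (measurable_sub_curve P))
    exact hm.stronglyMeasurable.integral_prod_right
  have hnorm : lorentzNorm q ∞ volume (average P f) ≤ C * J := by
    rw [lorentzNorm, if_pos rfl]
    refine iSup₂_le fun s hs => le_trans ?_ (hweak (ENNReal.ofReal s))
    gcongr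
    refine measure_mono_ae ?_
    filter_upwards [havg] with x hx hxs
    change s < ‖average P f x‖ at hxs
    change ENNReal.ofReal s < G x
    calc ENNReal.ofReal s < ENNReal.ofReal ‖average P f x‖ :=
          (ENNReal.ofReal_lt_ofReal_iff_of_nonneg (le_of_lt hs)).2 hxs
      _ = ‖average P g x‖ₑ := by rw [ofReal_norm, hx]
      _ ≤ ∫⁻ t, ‖averageIntegrand P g x t‖ₑ := enorm_integral_le_lintegral_enorm _
      _ = G x := hGeq x
  refine ⟨hint, ⟨hsm, hnorm.trans_lt hCJ⟩, hnorm.trans ?_⟩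
  gcongr

end PolyAverage

theorem theorem4p1 (N : ℕ) :
    ∃ C : ℝ≥0, ∀ P : Fin 3 → ℝ[X], (∀ i, (P i).natDegree ≤ N) →
      (∀ f : EuclideanSpace ℝ (Fin 3) → ℂ, PolyAverage.MemLorentz 2 1 volume f →
        (∀ᵐ x : EuclideanSpace ℝ (Fin 3), Integrable (PolyAverage.averageIntegrand P f x)) ∧
        PolyAverage.MemLorentz 3 ∞ volume (PolyAverage.average P f) ∧
        PolyAverage.lorentzNorm 3 ∞ volume (PolyAverage.average P f) ≤
          C * PolyAverage.lorentzNorm 2 1 volume f) ∧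
      (∀ f : EuclideanSpace ℝ (Fin 3) → ℂ, PolyAverage.MemLorentz (3 / 2) 1 volume f →
        (∀ᵐ x : EuclideanSpace ℝ (Fin 3), Integrable (PolyAverage.averageIntegrand P f x)) ∧
        PolyAverage.MemLorentz 2 ∞ volume (PolyAverage.average P f) ∧
        PolyAverage.lorentzNorm 2 ∞ volume (PolyAverage.average P f) ≤
          C * PolyAverage.lorentzNorm (3 / 2) 1 volume f) := by
  obtain ⟨C₁, h₁⟩ := PolyAverage.exists_form_le N
  obtain ⟨C₂, h₂⟩ := PolyAverage.exists_form_le' N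
  refine ⟨max C₁ C₂, fun P hP => ⟨fun f hf => ?_, fun f hf => ?_⟩⟩
  · refine PolyAverage.lorentz_bound (by norm_num) (by norm_num) (fun E F hE hF => ?_) hf
    refine (h₁ P hP E F hE hF).trans ?_
    rw [show (1 : ℝ) - 1 / 3 = 2 / 3 by norm_num]
    gcongr
    exact le_max_left _ _
  · refine PolyAverage.lorentz_bound (by norm_num) (by norm_num) (fun E F hE hF => ?_) hf
    refine (h₂ P hP E F hE hF).trans ?_
    rw [show (1 : ℝ) - 1 / 2 = 1 / 2 by norm_num, show (1 : ℝ) / (3 / 2) = 2 / 3 by norm_num]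
    gcongr
    exact le_max_right _ _
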